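/- Let $R$ be an integral domain (for instance a field or $\mathbb Z$), let $a,b\ge 2$, and let $P=R[x_0,\dots,x_a,y_0,\dots,y_b]$ with the standard grading. Let $I\subset P$ be the ideal of the K3 carpet $X(a,b)$, generated by the $2\times 2$ minors of $$\begin{pmatrix} x_0&\cdots&x_{a-1}\\ x_1&\cdots&x_a\end{pmatrix},\qquad \begin{pmatrix} y_0&\cdots&y_{b-1}\\ y_1&\cdots&y_b\end{pmatrix}$$ and the forms $x_{i+2}y_j-2x_{i+1}y_{j+1}+x_iy_{j+2}$ for $0\le i\le a-2$, $0\le j\le b-2$. Let $\mathrm{in}(I)$ be the ideal generated by the leading terms of the elements of $I$ for the graded reverse lexicographic order with $x_0>\cdots>x_a>y_0>\cdots>y_b$. A Schreyer resolution $F$ of an ideal $J$ (that is, of $P/J$) is built as follows. $F_0=P$, and the ordered basis of $F_1$ maps to a homogeneous normalized Gröbner basis of $J$ (leading coefficients are units and the lead monomials are the minimal generators of $\mathrm{in}(J)$). For $p\ge 1$, the basis elements of $F_{p+1}$ correspond to the pairs $(k,m)$, where $e_k$ is a basis element of $F_p$ and $m$ is a minimal monomial generator of $M_k=(n_i : i<k):n_k$;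 here $n_k e'$ is the lead monomial in $F_{p-1}$ of the image of $e_k$, and $i$ runs over the smaller indices whose lead monomials $n_ie'$ involve the same basis element $e'$. The basis element for $(k,m)$ maps to a homogeneous syzygy with lead monomial $m e_k$ (with unit coefficient) in the induced monomial order on $F_p$, which compares the lead monomials of the images in $F_{p-1}$ and breaks ties by the index. Basis elements with lead monomials $n_ie'$ on the same $e'$ are sorted first by the degree of $n_i$, then decreasingly in the monomial order. Then Schreyer resolutions of $I$ and of $\mathrm{in}(I)$ exist. Every Schreyer resolution of $I$ is a graded free resolution of $P/I$, and every Schreyer resolution of $\mathrm{in}(I)$ is a minimal graded free resolution of $P/\mathrm{in}(I)$. If $F$ is a minimal graded free resolution of $P/\mathrm{in}(I)$ or a Schreyer resolution of $I$, then $F$ has length exactly $a+b-1$, and with $\beta_{p,j}$ the number of generators of degree $j$ of $F_p$ one has $\beta_{0,0}=1$, $$\beta_{p,p+1}=p\binom{a}{p+1}+\sum_{j=0}^{b-2}\Big((a-2)\binom{a+j-1}{p-1}+\binom{a+j-2}{p-1}\Big)+\sum_{j=1}^{b-2}j\binom{a+j-2}{p-1}+(b-2)\binom{a+b-3}{p-1}+\binom{b-2}{p-1}$$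 for $1\le p\le a+b-2$, $$\begin{aligned}\beta_{p,p+2}=&\sum_{j=0}^{b-2}\binom{a+j-2}{p-2}+\sum_{j=1}^{b-2}j\binom{a+j-2}{p-2}+(b-2)\binom{a+b-3}{p-2}\\&+\sum_{q=0}^{p-2}\binom{b-2}{q}\Big((p-q-1)\binom{a}{p-q}+(a-p+q+1)\binom{a}{p-q-2}+\binom{a-2}{p-q-4}\Big)\end{aligned}$$ for $2\le p\le a+b-1$, and $$\beta_{p,p+3}=\binom{a+b-4}{p-3}\qquad\text{for } 3\le p\le a+b-1,$$ where $\binom{n}{k}=0$ for $k<0$. All other $\beta_{p,j}$ are zero, and the listed ones are nonzero, except that for $a=b=2$ some of the values $\beta_{p,p+1}$, $\beta_{p,p+2}$ given by the formulas are zero. Moreover, let $J_G$ be generated by all minimal monomial generators of $\mathrm{in}(I)$ other than $y_{b-1}^2$, i.e. by $x_ix_j$ $(1\le i\le j\le a-1)$, $x_iy_j$ $(2\le i\le a,\ 0\le j\le b-2)$ and $y_iy_j$ $(1\le i\le j\le b-1,\ (i,j)\neq(b-1,b-1))$, and let $J_H$ be generated by $x_ix_j$ $(1\le i\le j\le a-1)$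 and $x_iy_0$ $(2\le i\le a)$. Schreyer resolutions of $J_G$ and $J_H$ exist, and if $G$ and $H$ are any such, and $K$ is the Koszul complex on $y_1,\dots,y_{b-2}$, then for all $p\ge 1$, as graded free modules, $$F_p\cong G_p\oplus\bigoplus_{q=0}^{\min(b-2,p-1)}K_q\otimes H_{p-1-q}(-2).$$ -/

import Mathlib

open scoped MonomialOrder

noncomputable section

namespace K3Carpet

/-! ### The graded reverse lexicographic order -/

section DegRevLex

variable (σ : Type) [LinearOrder σ] [Fintype σ]

/-- Send an exponent vector `u` to the vector of partial sums `∑_{s ≤ v} u s`, indexed by `σᵒᵈ`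
(the last variable comes first) and compared lexicographically: the entry of the last variable is
the total degree. -/
def revLexKey : (σ →₀ ℕ) →+ Lex (σᵒᵈ → ℕ) where
  toFun u := toLex fun v => ∑ s ∈ Finset.univ.filter (· ≤ OrderDual.ofDual v), u s
  map_zero' := by
    rw [← toLex_zero]
    congr 1
    funext v
    simp
  map_add' u w := by
    rw [← toLex_add]
    congr 1
    funext v
    simp [Finset.sum_add_distrib]

variable {σ}

lemma sum_le_eq (u : σ →₀ ℕ) (v : σ) :
    ∑ s ∈ Finset.univ.filter (· ≤ v), u s =
      u v + ∑ s ∈ Finset.univ.filter (· < v), u s := by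
  have h : Finset.univ.filter (· ≤ v) = insert v (Finset.univ.filter (· < v)) := by
    ext s
    simp [le_iff_eq_or_lt]
  rw [h, Finset.sum_insert (by simp)]

lemma degree_eq_add (u : σ →₀ ℕ) (v : σ) :
    u.degree = ∑ s ∈ Finset.univ.filter (· ≤ v), u s +
      ∑ s ∈ Finset.univ.filter (v < ·), u s := by
  rw [Finsupp.degree_eq_sum, ← Finset.sum_filter_add_sum_filter_not _ (· ≤ v)]
  simp only [not_le]

/-- The textbook description of the graded reverse lexicographic order, for variables
`X s`, `s : σ`, which get smaller as `s` increases: `c < d` if `c` has smaller degree, or the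
degrees agree and at the last variable where `c` and `d` differ, `c` has the larger exponent. -/
def RevLexLT (c d : σ →₀ ℕ) : Prop :=
  c.degree < d.degree ∨
    c.degree = d.degree ∧ ∃ i, d i < c i ∧ ∀ j, i < j → c j = d j

lemma key_lt_of_revLexLT {c d : σ →₀ ℕ} (h : RevLexLT c d) :
    revLexKey σ c < revLexKey σ d := by
  rcases h with h | ⟨h, i, hi, hj⟩
  · have hne : (Finset.univ : Finset σ).Nonempty := by
      by_contra hne
      rw [Finset.not_nonempty_iff_eq_empty] at hne
      simp [Finsupp.degree_eq_sum, hne] at h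
    let v := Finset.univ.max' hne
    have hv : ∀ s, s ≤ v := fun s => Finset.le_max' _ _ (Finset.mem_univ s)
    refine ⟨OrderDual.toDual v, fun j hj => absurd (hv (OrderDual.ofDual j)) (not_le.2 hj), ?_⟩
    change ∑ s ∈ Finset.univ.filter (· ≤ v), c s < ∑ s ∈ Finset.univ.filter (· ≤ v), d s
    simpa [hv, Finsupp.degree_eq_sum] using h
  · have hS : ∀ w, i ≤ w → ∑ s ∈ Finset.univ.filter (· ≤ w), c s =
        ∑ s ∈ Finset.univ.filter (· ≤ w), d s := by
      intro w hw
      have h1 := degree_eq_add c w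
      have h2 := degree_eq_add d w
      have h3 : ∑ s ∈ Finset.univ.filter (w < ·), c s =
          ∑ s ∈ Finset.univ.filter (w < ·), d s :=
        Finset.sum_congr rfl fun s hs => hj s (hw.trans_lt (Finset.mem_filter.1 hs).2)
      omega
    have h1 := sum_le_eq c i
    have h2 := sum_le_eq d i
    have h3 := hS i le_rfl
    have hL : ∑ s ∈ Finset.univ.filter (· < i), c s <
        ∑ s ∈ Finset.univ.filter (· < i), d s := by omega
    have hne : (Finset.univ.filter (· < i)).Nonempty := by
      by_contra hne
      rw [Finset.not_nonempty_iff_eq_empty] at hne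
      simp [hne] at hL
    let v := (Finset.univ.filter (· < i)).max' hne
    have hvi : v < i := (Finset.mem_filter.1 (Finset.max'_mem _ hne)).2
    have hv : ∀ s, s < i ↔ s ≤ v := fun s =>
      ⟨fun hs => Finset.le_max' _ _ (by simpa using hs), fun hs => hs.trans_lt hvi⟩
    refine ⟨OrderDual.toDual v, fun j hj' => ?_, ?_⟩
    · refine hS (OrderDual.ofDual j) ?_
      by_contra hlt
      exact absurd ((hv _).1 (not_le.1 hlt)) (not_le.2 hj')
    · change ∑ s ∈ Finset.univ.filter (· ≤ v), c s < ∑ s ∈ Finset.univ.filter (· ≤ v), d s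
      simpa only [hv] using hL

lemma revLexLT_trichotomy (c d : σ →₀ ℕ) : RevLexLT c d ∨ c = d ∨ RevLexLT d c := by
  by_cases hcd : c = d
  · exact Or.inr (Or.inl hcd)
  rcases lt_trichotomy c.degree d.degree with h | h | h
  · exact Or.inl (Or.inl h)
  · have hne : (Finset.univ.filter fun s => c s ≠ d s).Nonempty := by
      by_contra hne
      rw [Finset.not_nonempty_iff_eq_empty, Finset.filter_eq_empty_iff] at hne
      exact hcd (Finsupp.ext fun s => not_not.1 (hne (Finset.mem_univ s)))
    have h1 := (Finset.mem_filter.1 (Finset.max'_mem _ hne)).2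
    have h2 : ∀ j, (Finset.univ.filter fun s => c s ≠ d s).max' hne < j → c j = d j := by
      intro j hj
      by_contra hne'
      exact absurd (Finset.le_max' _ j (by simpa using hne')) (not_le.2 hj)
    rcases lt_or_gt_of_ne h1 with h3 | h3
    · exact Or.inr (Or.inr (Or.inr ⟨h.symm, _, h3, fun j hj => (h2 j hj).symm⟩))
    · exact Or.inl (Or.inr ⟨h, _, h3, h2⟩)
  · exact Or.inr (Or.inr (Or.inl h))

lemma revLexKey_injective : Function.Injective (revLexKey σ) := by
  intro c d h
  rcases revLexLT_trichotomy c d with h1 | h1 | h1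
  · exact absurd h (key_lt_of_revLexLT h1).ne
  · exact h1
  · exact absurd h (key_lt_of_revLexLT h1).ne'

variable (σ)

/-- The graded reverse lexicographic order as a monomial order; the variables `X s` get smaller
as `s : σ` increases. -/
def degRevLex : MonomialOrder σ where
  syn := AddMonoidHom.mrange (revLexKey σ)
  addCommMonoidSyn := (AddMonoidHom.mrange (revLexKey σ)).toAddCommMonoid
  toSyn := AddEquiv.mk' (Equiv.ofBijective (revLexKey σ).mrangeRestrict
    ⟨fun _ _ h => revLexKey_injective (congrArg Subtype.val h),
      (revLexKey σ).mrangeRestrict_surjective⟩) (revLexKey σ).mrangeRestrict.map_add'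
  toSyn_monotone := fun _ _ h =>
    Pi.toLex_monotone fun _ => Finset.sum_le_sum fun s _ => h s

variable {σ}

lemma degRevLex_lt_iff {c d : σ →₀ ℕ} : c ≺[degRevLex σ] d ↔ RevLexLT c d := by
  change revLexKey σ c < revLexKey σ d ↔ _
  refine ⟨fun h => ?_, key_lt_of_revLexLT⟩
  rcases revLexLT_trichotomy c d with h1 | h1 | h1
  · exact h1
  · exact absurd (h1 ▸ h) (lt_irrefl (revLexKey σ c))
  · exact absurd h (key_lt_of_revLexLT h1).asymm

end DegRevLex

/-! ### Graded free complexes and resolutions -/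

open MvPolynomial

/-- A complex `F_0 ← F_1 ← F_2 ← ⋯` of finitely generated graded free modules over the standard
graded polynomial ring `R[X_s : s ∈ σ]`, with chosen homogeneous bases: `F_p` has the basis `ι p`,
`deg p` gives the degrees of the basis elements, and `d p` is the matrix of the differential
`F_{p+1} → F_p`, which is homogeneous of degree zero. -/
structure GradedFreeComplex (σ : Type) (R : Type*) [CommRing R] where
  ι : ℕ → Type
  fintype : ∀ p, Fintype (ι p)
  deg : ∀ p, ι p → ℤ
  d : ∀ p, Matrix (ι p) (ι (p + 1)) (MvPolynomial σ R)
  homogeneous : ∀ p i k, ∀ u ∈ (d p i k).support, (u.degree : ℤ) + deg p i = deg (p + 1) k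
  d_mul_d : ∀ p, d p * d (p + 1) = 0

attribute [instance] GradedFreeComplex.fintype

namespace GradedFreeComplex

variable {σ : Type} {R : Type*} [CommRing R] (F : GradedFreeComplex σ R)

/-- The graded Betti number `β_{p,j}(F)`, i.e. the rank of the degree `j` part of `F_p ⊗ R`:
the number of basis elements of `F_p` of degree `j`. -/
def betti (p : ℕ) (j : ℤ) : ℕ := Nat.card {i : F.ι p // F.deg p i = j}

/-- `F_ℓ ≠ 0` and `F_p = 0` for all `p > ℓ`. -/
def HasLength (l : ℕ) : Prop := Nonempty (F.ι l) ∧ ∀ p, l < p → IsEmpty (F.ι p)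

open Classical in
/-- `F` is a graded free resolution of `R[X_s : s ∈ σ] / J`: there is a homogeneous augmentation
`ε` of degree zero for which `0 ← R[X]/J ← F_0 ← F_1 ← ⋯` is exact. -/
def IsResolution (J : Ideal (MvPolynomial σ R)) : Prop :=
  ∃ ε : (F.ι 0 → MvPolynomial σ R) →ₗ[MvPolynomial σ R] (MvPolynomial σ R ⧸ J),
    (∀ i, ∃ f : MvPolynomial σ R, (∀ u ∈ f.support, (u.degree : ℤ) = F.deg 0 i) ∧
      ε (Pi.single i 1) = Ideal.Quotient.mk J f) ∧
    Function.Surjective ε ∧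
    Function.Exact (F.d 0).mulVecLin ε ∧
    ∀ p, Function.Exact (F.d (p + 1)).mulVecLin (F.d p).mulVecLin

/-- The differentials of `F` have no constant terms. -/
def IsMinimal : Prop := ∀ p i k, constantCoeff (F.d p i k) = 0

/-- `F` is a minimal graded free resolution of `R[X_s : s ∈ σ] / J`. -/
def IsMinimalResolution (J : Ideal (MvPolynomial σ R)) : Prop := F.IsResolution J ∧ F.IsMinimal

end GradedFreeComplex

/-! ### Initial ideals and Schreyer resolutions -/

/-- The initial ideal `in(I)`, generated by the leading terms of the elements of `I`. -/
def initialIdeal {σ : Type} {R : Type*} [CommRing R] (m : MonomialOrder σ)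
    (I : Ideal (MvPolynomial σ R)) : Ideal (MvPolynomial σ R) :=
  Ideal.span (m.leadingTerm '' (I : Set (MvPolynomial σ R)))

/-- Additional data on `F`: the basis of each `F_p` is ordered, and each basis element `e` of
`F_{p+1}` gets a monomial `mon p e` and a basis element `par p e` of `F_p`; the monomial
`(mon p e) • (par p e)` of `F_p` is meant to be the lead monomial of the image of `e`. -/
structure SchreyerFrame {σ : Type} {R : Type*} [CommRing R] (F : GradedFreeComplex σ R) where
  order : ∀ p, LinearOrder (F.ι p)
  mon : ∀ p, F.ι (p + 1) → (σ →₀ ℕ)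
  par : ∀ p, F.ι (p + 1) → F.ι p

namespace SchreyerFrame

variable {σ : Type} {R : Type*} [CommRing R] {F : GradedFreeComplex σ R} (S : SchreyerFrame F)

/-- `i < k` in the chosen order of the basis of `F_p`. -/
def before {p : ℕ} (i k : F.ι p) : Prop := (S.order p).lt i k

/-- The (expected) lead monomial in `F_p` of the image of the monomial `u • e` of `F_{p+1}`. -/
def push (p : ℕ) (v : (σ →₀ ℕ) × F.ι (p + 1)) : (σ →₀ ℕ) × F.ι p :=
  (v.1 + S.mon p v.2, S.par p v.2)

/-- The induced monomial order on the monomials `u • e` of `F_p` (given as pairs `(u, e)`):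
monomials are compared by the lead monomials of their images in `F_{p-1}`, and by the order of the
basis elements if these agree. On `F_0` (which will have rank one) it is the order `m`. -/
def lt (m : MonomialOrder σ) : ∀ p, (σ →₀ ℕ) × F.ι p → (σ →₀ ℕ) × F.ι p → Prop
  | 0, v, w => v.1 ≺[m] w.1
  | p + 1, v, w => lt m p (S.push p v) (S.push p w) ∨
      S.push p v = S.push p w ∧ S.before v.2 w.2

/-- For a basis element `e_k` of `F_{p+1}`, the monomial ideal
`M_k = (mon e_i : i < k, in e_i and in e_k involve the same basis element of F_p) : mon e_k`. -/
def colonIdeal (p : ℕ) (k : F.ι (p + 1)) : Ideal (MvPolynomial σ R) :=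
  (Ideal.span {f | ∃ i, S.before i k ∧ S.par p i = S.par p k ∧ f = monomial (S.mon p i) (1 : R)}).colon
    {monomial (S.mon p k) (1 : R)}

end SchreyerFrame

open SchreyerFrame in
/-- `F` is a Schreyer resolution of (the quotient by) the ideal `I` with respect to the monomial
order `m`. It is the outcome of the following construction, for some choice of a Gröbner basis and
of the syzygies (exactness is not part of the definition). -/
def IsSchreyerResolution {σ : Type} {R : Type*} [CommRing R] (m : MonomialOrder σ)
    (F : GradedFreeComplex σ R) (I : Ideal (MvPolynomial σ R)) : Prop :=
  ∃ S : SchreyerFrame F,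
    -- `F_0` is the polynomial ring
    (Nat.card (F.ι 0) = 1 ∧ ∀ i, F.deg 0 i = 0) ∧
    -- the differential maps the basis of `F_1` to elements of `I` whose lead monomials generate
    -- `in(I)`, and none of these divides another: they are a normalized Gröbner basis
    ((∀ i k, F.d 0 i k ∈ I) ∧
      Ideal.span (Set.range fun k => monomial (S.mon 0 k) (1 : R)) = initialIdeal m I ∧
      ∀ k l, S.mon 0 k ≤ S.mon 0 l → k = l) ∧
    -- the image of each basis element `k` of `F_{p+1}` has the lead term `c • (mon k) • (par k)`
    -- with respect to the induced monomial order on `F_p`, with a unit `c` of `R`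
    (∀ p k, IsUnit ((F.d p (S.par p k) k).coeff (S.mon p k)) ∧
      ∀ i, ∀ u ∈ (F.d p i k).support, (u, i) ≠ (S.mon p k, S.par p k) →
        S.lt m p (u, i) (S.mon p k, S.par p k)) ∧
    -- basis elements whose lead terms involve the same basis element are sorted first by the
    -- degree of the monomial, and then decreasingly with respect to `m`
    (∀ p k l, S.par p k = S.par p l →
      (S.before k l ↔ (S.mon p k).degree < (S.mon p l).degree ∨
        (S.mon p k).degree = (S.mon p l).degree ∧ S.mon p l ≺[m] S.mon p k)) ∧
    -- for `p ≥ 1`, the basis elements of `F_{p+1}` correspond to the minimal monomial generators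
    -- of the ideals `M_k`, for `k` in the basis of `F_p`
    (∀ p, Set.BijOn (fun l : F.ι (p + 2) => (S.par (p + 1) l, S.mon (p + 1) l)) Set.univ
      {q | Minimal (fun u => monomial u (1 : R) ∈ S.colonIdeal p q.1) q.2})

/-! ### The ideal of the K3 carpet -/

section Carpet

variable (R : Type*) [CommRing R] (a b : ℕ)

/-- The variables `x_0, …, x_a, y_0, …, y_b`, in this order. -/
abbrev Var : Type := Fin (a + 1) ⊕ₗ Fin (b + 1)

variable {a b} in
/-- The variable `x_i`. -/
def xVar (i : Fin (a + 1)) : MvPolynomial (Var a b) R := X (Sum.inlₗ i)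

variable {a b} in
/-- The variable `y_j`. -/
def yVar (j : Fin (b + 1)) : MvPolynomial (Var a b) R := X (Sum.inrₗ j)

/-- The matrix `MX` with rows `x_0, …, x_{a-1}` and `x_1, …, x_a`. -/
def MX : Matrix (Fin 2) (Fin a) (MvPolynomial (Var a b) R) :=
  Matrix.of ![fun c => xVar R c.castSucc, fun c => xVar R c.succ]

/-- The matrix `MY` with rows `y_0, …, y_{b-1}` and `y_1, …, y_b`. -/
def MY : Matrix (Fin 2) (Fin b) (MvPolynomial (Var a b) R) :=
  Matrix.of ![fun c => yVar R c.castSucc, fun c => yVar R c.succ]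

/-- The ideal generated by the `2 × 2` minors of a matrix with two rows. -/
def minors {A : Type*} [CommRing A] {n : ℕ} (M : Matrix (Fin 2) (Fin n) A) : Ideal A :=
  Ideal.span {f | ∃ c : Fin 2 → Fin n, f = (M.submatrix id c).det}

/-- For `a, b ≥ 2`, the ideal generated by the `2 × 2` minors of `MX` and `MY` and the forms
`x_{i+2} y_j - 2 x_{i+1} y_{j+1} + x_i y_{j+2}`: the ideal `I_{(2,1)}` of the K3 carpet. -/
def carpetIdeal : Ideal (MvPolynomial (Var a b) R) :=
  minors (MX R a b) ⊔ minors (MY R a b) ⊔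
    Ideal.span {f | ∃ (i j : ℕ) (hi : i + 2 ≤ a) (hj : j + 2 ≤ b),
      f = xVar R ⟨i + 2, by omega⟩ * yVar R ⟨j, by omega⟩
        - 2 * xVar R ⟨i + 1, by omega⟩ * yVar R ⟨j + 1, by omega⟩
        + xVar R ⟨i, by omega⟩ * yVar R ⟨j + 2, by omega⟩}

/-- The initial ideal of the carpet ideal for the graded reverse lexicographic order with
`x_0 > ⋯ > x_a > y_0 > ⋯ > y_b`. -/
def carpetInitialIdeal : Ideal (MvPolynomial (Var a b) R) :=
  initialIdeal (degRevLex (Var a b)) (carpetIdeal R a b)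

/-- The monomial ideal `J_G` generated by all `x_i x_j` with `1 ≤ i ≤ j ≤ a-1`, all `x_i y_j` with
`2 ≤ i ≤ a`, `0 ≤ j ≤ b-2`, and all `y_i y_j` with `1 ≤ i ≤ j ≤ b-1` except `y_{b-1}^2`. -/
def idealG : Ideal (MvPolynomial (Var a b) R) :=
  Ideal.span ({f | ∃ i j : Fin (a + 1), 1 ≤ i.val ∧ i ≤ j ∧ j.val + 1 ≤ a ∧ f = xVar R i * xVar R j} ∪
    {f | ∃ (i : Fin (a + 1)) (j : Fin (b + 1)), 2 ≤ i.val ∧ j.val + 2 ≤ b ∧ f = xVar R i * yVar R j} ∪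
    {f | ∃ i j : Fin (b + 1), 1 ≤ i.val ∧ i ≤ j ∧ j.val + 1 ≤ b ∧ i.val + 2 ≤ b ∧
      f = yVar R i * yVar R j})

/-- The monomial ideal `J_H` generated by all `x_i x_j` with `1 ≤ i ≤ j ≤ a-1` and all `x_i y_0`
with `2 ≤ i ≤ a`. -/
def idealH : Ideal (MvPolynomial (Var a b) R) :=
  Ideal.span ({f | ∃ i j : Fin (a + 1), 1 ≤ i.val ∧ i ≤ j ∧ j.val + 1 ≤ a ∧ f = xVar R i * xVar R j} ∪
    {f | ∃ i : Fin (a + 1), 2 ≤ i.val ∧ f = xVar R i * yVar R 0})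

end Carpet

/-- A basis of the term `K_q = Λ^q P(-1)^n` (placed in degree `q`) of the Koszul complex on `n`
variables. -/
abbrev KoszulBasis (n q : ℕ) : Type := {s : Finset (Fin n) // s.card = q}

/-- `F_p ≅ G_p ⊕ ⨁_{q=0}^{min(n,p-1)} K_q ⊗ H_{p-1-q}(-2)` as graded free modules, where `K` is the
Koszul complex on `n` variables: there is a degree preserving bijection between the homogeneous
basis of the left and that of the right side. -/
def TermDecomposes {σ : Type} {R : Type*} [CommRing R] (F G H : GradedFreeComplex σ R)
    (n p : ℕ) : Prop :=
  ∃ e : F.ι p ≃ G.ι p ⊕ (Σ q : Fin (min n (p - 1) + 1), KoszulBasis n q × H.ι (p - 1 - q)),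
    (∀ g, F.deg p (e.symm (Sum.inl g)) = G.deg p g) ∧
    ∀ (q : Fin (min n (p - 1) + 1)) (s : KoszulBasis n q) (h : H.ι (p - 1 - q)),
      F.deg p (e.symm (Sum.inr ⟨q, s, h⟩)) = (q.val : ℤ) + H.deg (p - 1 - q) h + 2

/-- The binomial coefficient `(n choose k)`, which is `0` for `k < 0`. -/
def binom (n : ℕ) (k : ℤ) : ℤ := if 0 ≤ k then (n.choose k.toNat : ℤ) else 0

end K3Carpet

end

open K3Carpet

/-! A Schreyer resolution is governed by its lead monomials. Those attached to the children of a
basis element are the minimal generators of a colon ideal formed from its earlier siblings. Hence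
the basis of `F_p` is in degree-preserving bijection with the chains of `p` successive choices of
generators in iterated colon ideals (`Path`), and these depend only on in(I) (`exists_equiv_path`).
All lead coefficients are units, so division needs no field. The lead monomial of a kernel element
is divisible by a lead monomial of the next differential, which gives exactness
(`IsSchreyerFrame.isResolution`); dividing S-vectors produces the syzygies, which gives existence
(`exists_isSchreyerResolution`).

The minors and the mixed forms have the expected quadratic lead monomials. That these generate in(I)
follows from the parametrization `carpetHom` over the dual numbers: it kills I, and it is injective
on the span of the standard monomials (`eq_zero_of_carpetHom_eq_zero`), because at most two of these
share an image exponent and their coefficients then satisfy a 2×2 linear system of determinant ±1.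

The colon ideals in in(I) are very simple: they are generated by variables, or by variables and
x_1². The only exception belongs to the last generator y_{b-1}², whose colon ideal is (y_1, …,
y_{b-2}) + J_H. The recursion `pathSeries_eq` over the first choice in a chain turns this into P_F =
P_G + q (1 + w)^{b-2} P_H (`pathSeries_quadF`), where w and q stand for one variable and one
quadric. This is the Koszul decomposition at the level of generating functions. The powers of q
separate the three strands, and their coefficients are the Betti numbers.

For minimality, a monomial ideal has a Schreyer resolution with multigraded differentials. A
constant entry would join two chains of consecutive lengths and equal multidegree, but here degree
minus length is determined by the multidegree (`sum_ne_of_isPath_quadF`). Every other Schreyer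
resolution of in(I) has the same ranks, which forces it to be minimal too, and every minimal
resolution has the same graded ranks; both come from the constant parts of the comparison maps
(`exists_comparison`). -/

noncomputable section

open MvPolynomial

namespace K3Carpet

/-! ### Monomial orders on free modules and division -/

section ModuleOrder

variable {σ : Type} {R : Type*} [CommRing R] {ι κ : Type}

/-- The coefficient of the monomial `v.1 • e_{v.2}` in a vector of polynomials. -/
def vecCoeff (g : ι → MvPolynomial σ R) (v : (σ →₀ ℕ) × ι) : R := coeff v.1 (g v.2)

lemma vecCoeff_zero (v : (σ →₀ ℕ) × ι) : vecCoeff (0 : ι → MvPolynomial σ R) v = 0 := by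
  simp [vecCoeff]

lemma vecCoeff_add (g h : ι → MvPolynomial σ R) (v : (σ →₀ ℕ) × ι) :
    vecCoeff (g + h) v = vecCoeff g v + vecCoeff h v := by
  simp [vecCoeff]

lemma vecCoeff_sub (g h : ι → MvPolynomial σ R) (v : (σ →₀ ℕ) × ι) :
    vecCoeff (g - h) v = vecCoeff g v - vecCoeff h v := by
  simp [vecCoeff]

lemma vecCoeff_monomial_smul (t : σ →₀ ℕ) (c : R) (g : ι → MvPolynomial σ R)
    (v : (σ →₀ ℕ) × ι) :
    vecCoeff (monomial t c • g) v = if t ≤ v.1 then c * vecCoeff g (v.1 - t, v.2) else 0 := by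
  simp [vecCoeff, coeff_monomial_mul']

lemma vecCoeff_monomial_smul_ne_zero {t : σ →₀ ℕ} {c : R} {g : ι → MvPolynomial σ R}
    {v : (σ →₀ ℕ) × ι} (h : vecCoeff (monomial t c • g) v ≠ 0) :
    ∃ s, vecCoeff g s ≠ 0 ∧ v = (t + s.1, s.2) := by
  rw [vecCoeff_monomial_smul] at h
  split_ifs at h with ht
  · exact ⟨(v.1 - t, v.2), right_ne_zero_of_mul h, by ext1 <;> simp [add_tsub_cancel_of_le ht]⟩
  · exact absurd rfl h

lemma vecCoeff_monomial_smul_add (t : σ →₀ ℕ) (c : R) (g : ι → MvPolynomial σ R)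
    (s : (σ →₀ ℕ) × ι) : vecCoeff (monomial t c • g) (t + s.1, s.2) = c * vecCoeff g s := by
  rw [vecCoeff_monomial_smul]
  simp

lemma vec_ext {g h : ι → MvPolynomial σ R} (H : ∀ v, vecCoeff g v = vecCoeff h v) : g = h := by
  funext i
  ext u
  exact H (u, i)

lemma exists_vecCoeff_ne_zero {g : ι → MvPolynomial σ R} (hg : g ≠ 0) : ∃ v, vecCoeff g v ≠ 0 := by
  by_contra! h
  exact hg (vec_ext fun v => by rw [h, vecCoeff_zero])

lemma finite_vecCoeff_ne_zero [Finite ι] (g : ι → MvPolynomial σ R) :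
    {v | vecCoeff g v ≠ 0}.Finite := by
  have : {v | vecCoeff g v ≠ 0} ⊆ ⋃ i, (fun u => (u, i)) '' ((g i).support : Set (σ →₀ ℕ)) := by
    rintro ⟨u, i⟩ h
    simp only [Set.mem_iUnion, Set.mem_image]
    exact ⟨i, u, by simpa [vecCoeff] using h, rfl⟩
  exact (Set.finite_iUnion fun i => (Finset.finite_toSet _).image _).subset this

/-- A strict well-order of the monomials of a free module, compatible with multiplication. -/
structure IsModuleOrder (r : (σ →₀ ℕ) × ι → (σ →₀ ℕ) × ι → Prop) : Prop where
  wf : WellFounded r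
  trans : ∀ {u v w}, r u v → r v w → r u w
  tri : ∀ u v, r u v ∨ u = v ∨ r v u
  add : ∀ (c : σ →₀ ℕ) {u v}, r u v → r (c + u.1, u.2) (c + v.1, v.2)

lemma IsModuleOrder.irrefl {r : (σ →₀ ℕ) × ι → (σ →₀ ℕ) × ι → Prop} (hr : IsModuleOrder r) (v) :
    ¬ r v v := fun h => hr.wf.asymmetric _ _ h h

/-- `v` is the lead monomial of `g`. -/
def IsLead (r : (σ →₀ ℕ) × ι → (σ →₀ ℕ) × ι → Prop) (g : ι → MvPolynomial σ R)
    (v : (σ →₀ ℕ) × ι) : Prop :=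
  vecCoeff g v ≠ 0 ∧ ∀ s, vecCoeff g s ≠ 0 → s ≠ v → r s v

/-- `v` is the lead monomial of `g`, and its coefficient is a unit. -/
def IsUnitLead (r : (σ →₀ ℕ) × ι → (σ →₀ ℕ) × ι → Prop) (g : ι → MvPolynomial σ R)
    (v : (σ →₀ ℕ) × ι) : Prop :=
  IsUnit (vecCoeff g v) ∧ ∀ s, vecCoeff g s ≠ 0 → s ≠ v → r s v

lemma exists_isLead [Finite ι] {r : (σ →₀ ℕ) × ι → (σ →₀ ℕ) × ι → Prop} (hr : IsModuleOrder r)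
    {g : ι → MvPolynomial σ R} (hg : g ≠ 0) : ∃ v, IsLead r g v := by
  obtain ⟨v, hv⟩ := exists_vecCoeff_ne_zero hg
  have key : ∀ t : Finset ((σ →₀ ℕ) × ι), t.Nonempty → ∃ v ∈ t, ∀ s ∈ t, s ≠ v → r s v := by
    intro t ht
    induction ht using Finset.Nonempty.cons_induction with
    | singleton a => exact ⟨a, by simp, by simp +contextual⟩
    | cons a t ha ht ih =>
      obtain ⟨v, hv, hmax⟩ := ih
      rcases hr.tri a v with h | h | h
      · refine ⟨v, by simp [hv], fun s hs hne => ?_⟩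
        rcases Finset.mem_cons.1 hs with rfl | hs
        · exact h
        · exact hmax s hs hne
      · exact absurd (h ▸ hv) ha
      · refine ⟨a, by simp, fun s hs hne => ?_⟩
        rcases Finset.mem_cons.1 hs with rfl | hs
        · exact absurd rfl hne
        · by_cases hsv : s = v
          · exact hsv ▸ h
          · exact hr.trans (hmax s hs hsv) h
  obtain ⟨w, hw, hmax⟩ := key (finite_vecCoeff_ne_zero g).toFinset ⟨v, by simpa using hv⟩
  exact ⟨w, by simpa using hw, fun s hs => hmax s (by simpa using hs)⟩

/-- The monomial in the target corresponding to a monomial in the source of a map whose columns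
have the lead monomials `mon k • par k`. -/
def pushMonomial (mon : κ → σ →₀ ℕ) (par : κ → ι) (v : (σ →₀ ℕ) × κ) : (σ →₀ ℕ) × ι :=
  (v.1 + mon v.2, par v.2)

/-- The induced order on the monomials in the source. -/
def inducedOrder (r : (σ →₀ ℕ) × ι → (σ →₀ ℕ) × ι → Prop) (before : κ → κ → Prop)
    (mon : κ → σ →₀ ℕ) (par : κ → ι) (v w : (σ →₀ ℕ) × κ) : Prop :=
  r (pushMonomial mon par v) (pushMonomial mon par w) ∨
    pushMonomial mon par v = pushMonomial mon par w ∧ before v.2 w.2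

lemma pushMonomial_add (mon : κ → σ →₀ ℕ) (par : κ → ι) (c : σ →₀ ℕ) (v : (σ →₀ ℕ) × κ) :
    pushMonomial mon par (c + v.1, v.2) =
      (c + (pushMonomial mon par v).1, (pushMonomial mon par v).2) := by
  simp [pushMonomial, add_assoc]

/-- Sending `v` to its pushed monomial together with its basis element maps this order into a
lexicographic product. On a fixed basis element pushing is a translation, which gives trichotomy;
finiteness of `κ` makes the tie-break well-founded. -/
lemma IsModuleOrder.induced [Finite κ] {r : (σ →₀ ℕ) × ι → (σ →₀ ℕ) × ι → Prop}
    (hr : IsModuleOrder r) (o : LinearOrder κ) (mon : κ → σ →₀ ℕ) (par : κ → ι) :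
    IsModuleOrder (inducedOrder r o.lt mon par) where
  wf := by
    have h1 : WellFounded o.lt := by
      have : IsTrans κ o.lt := ⟨fun a b c => @lt_trans _ o.toPreorder a b c⟩
      have : Std.Irrefl o.lt := ⟨fun a => @lt_irrefl _ o.toPreorder a⟩
      exact Finite.wellFounded_of_trans_of_irrefl o.lt
    have h2 := InvImage.wf (fun v : (σ →₀ ℕ) × κ => (pushMonomial mon par v, v.2))
      (WellFounded.prod_lex hr.wf h1)
    refine Subrelation.wf (fun {v w} h => ?_) h2
    rcases h with h | ⟨h, h'⟩
    · exact Prod.Lex.left _ _ h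
    · change Prod.Lex _ _ (_, _) (_, _)
      rw [h]
      exact Prod.Lex.right _ h'
  trans := by
    rintro u v w (h | ⟨h, h'⟩) (k | ⟨k, k'⟩)
    · exact Or.inl (hr.trans h k)
    · exact Or.inl (k ▸ h)
    · exact Or.inl (h ▸ k)
    · exact Or.inr ⟨h.trans k, @lt_trans _ o.toPreorder _ _ _ h' k'⟩
  tri := by
    intro u v
    rcases hr.tri (pushMonomial mon par u) (pushMonomial mon par v) with h | h | h
    · exact Or.inl (Or.inl h)
    · rcases @lt_trichotomy _ o u.2 v.2 with h' | h' | h'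
      · exact Or.inl (Or.inr ⟨h, h'⟩)
      · refine Or.inr (Or.inl (Prod.ext ?_ h'))
        have := congrArg Prod.fst h
        simp only [pushMonomial, h'] at this
        exact add_right_cancel this
      · exact Or.inr (Or.inr (Or.inr ⟨h.symm, h'⟩))
    · exact Or.inr (Or.inr (Or.inl h))
  add := by
    rintro c u v (h | ⟨h, h'⟩)
    · left
      rw [pushMonomial_add, pushMonomial_add]
      exact hr.add c h
    · right
      rw [pushMonomial_add, pushMonomial_add, h]
      exact ⟨rfl, h'⟩

lemma IsModuleOrder.isUnitLead_smul {r : (σ →₀ ℕ) × ι → (σ →₀ ℕ) × ι → Prop}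
    (hr : IsModuleOrder r) {g : ι → MvPolynomial σ R} {v : (σ →₀ ℕ) × ι} (hg : IsUnitLead r g v)
    (t : σ →₀ ℕ) (c : R) {s : (σ →₀ ℕ) × ι} (hs : vecCoeff (monomial t c • g) s ≠ 0)
    (hne : s ≠ (t + v.1, v.2)) : r s (t + v.1, v.2) := by
  obtain ⟨s', hs', rfl⟩ := vecCoeff_monomial_smul_ne_zero hs
  refine hr.add t (hg.2 s' hs' ?_)
  rintro rfl
  exact hne rfl

/-- Cancelling the lead terms of two vectors. -/
lemma IsLead.cancel {r : (σ →₀ ℕ) × ι → (σ →₀ ℕ) × ι → Prop}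
    {g h : ι → MvPolynomial σ R} {v : (σ →₀ ℕ) × ι} 
    (hg : ∀ s, vecCoeff g s ≠ 0 → s ≠ v → r s v) (hh : ∀ s, vecCoeff h s ≠ 0 → s ≠ v → r s v)
    (hv : vecCoeff g v = vecCoeff h v) {s : (σ →₀ ℕ) × ι} (hs : vecCoeff (g - h) s ≠ 0) :
    (vecCoeff g s ≠ 0 ∨ vecCoeff h s ≠ 0) ∧ r s v := by
  rw [vecCoeff_sub] at hs
  have hne : s ≠ v := by
    rintro rfl
    exact hs (by rw [hv, sub_self])
  by_cases h1 : vecCoeff g s = 0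
  · have h2 : vecCoeff h s ≠ 0 := fun h2 => hs (by rw [h1, h2, sub_self])
    exact ⟨Or.inr h2, hh s h2 hne⟩
  · exact ⟨Or.inl h1, hg s h1 hne⟩

lemma vecCoeff_smul_single_ne_zero [DecidableEq κ] {t : σ →₀ ℕ} {c : R} {l : κ}
    {s : (σ →₀ ℕ) × κ}
    (h : vecCoeff (monomial t c • (Pi.single l 1 : κ → MvPolynomial σ R)) s ≠ 0) : s = (t, l) := by
  obtain ⟨s', hs', rfl⟩ := vecCoeff_monomial_smul_ne_zero h
  obtain ⟨u, k⟩ := s'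
  by_cases hk : k = l
  · subst hk
    have : (0 : σ →₀ ℕ) = u := by
      by_contra hu
      classical
      apply hs'
      simp [vecCoeff, MvPolynomial.coeff_one, hu]
    simp [← this]
  · exact absurd (by simp [vecCoeff, hk]) hs'

lemma vecCoeff_smul_single [DecidableEq κ] (t : σ →₀ ℕ) (c : R) (l : κ) :
    vecCoeff (monomial t c • (Pi.single l 1 : κ → MvPolynomial σ R)) (t, l) = c := by
  classical
  simp [vecCoeff, MvPolynomial.coeff_monomial]

variable [Fintype κ]

lemma mulVec_monomial_smul_single [DecidableEq κ] (d : Matrix ι κ (MvPolynomial σ R))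
    (p : MvPolynomial σ R) (l : κ) :
    d.mulVec (p • Pi.single l 1) = p • fun i => d i l := by
  funext i
  simp [Matrix.mulVec_smul, Matrix.mulVec_single]

/-- Division by the columns of a matrix with unit lead coefficients. The function `ω` is a grading
for which the columns are homogeneous. -/
lemma exists_preimage [Finite ι] {Γ : Type*} {r : (σ →₀ ℕ) × ι → (σ →₀ ℕ) × ι → Prop}
    (hr : IsModuleOrder r)
    (d : Matrix ι κ (MvPolynomial σ R)) (mon : κ → σ →₀ ℕ) (par : κ → ι)
    (hd : ∀ k, IsUnitLead r (fun i => d i k) (mon k, par k))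
    (ω : (σ →₀ ℕ) × ι → Γ)
    (hω : ∀ k t s, vecCoeff (fun i => d i k) s ≠ 0 → ω (t + s.1, s.2) = ω (t + mon k, par k))
    (N : Submodule (MvPolynomial σ R) (ι → MvPolynomial σ R)) (hN : ∀ k, (fun i => d i k) ∈ N)
    (hlead : ∀ g ∈ N, ∀ v, IsLead r g v → ∃ k, par k = v.2 ∧ mon k ≤ v.1) :
    ∀ g ∈ N, ∃ w : κ → MvPolynomial σ R, d.mulVec w = g ∧ ∀ t, vecCoeff w t ≠ 0 →
      ∃ s, vecCoeff g s ≠ 0 ∧ (pushMonomial mon par t = s ∨ r (pushMonomial mon par t) s) ∧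
        ω (pushMonomial mon par t) = ω s := by
  classical
  -- Well-founded induction on the lead monomial: subtracting the multiple of a column with the same
  -- lead term lowers it. The bound on the pushed support of `w` later protects the lead term of a
  -- syzygy, and the `ω` clause gives its homogeneity.
  have main : ∀ v, ∀ g ∈ N, IsLead r g v → ∃ w : κ → MvPolynomial σ R, d.mulVec w = g ∧
      ∀ t, vecCoeff w t ≠ 0 →
      ∃ s, vecCoeff g s ≠ 0 ∧ (pushMonomial mon par t = s ∨ r (pushMonomial mon par t) s) ∧
        ω (pushMonomial mon par t) = ω s := by
    intro v
    induction v using hr.wf.induction with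
    | _ v ih =>
    intro g hg hv
    obtain ⟨k, hk, hkv⟩ := hlead g hg v hv
    obtain ⟨c, hc⟩ := (hd k).1
    have hv' : (v.1 - mon k + (mon k, par k).1, (mon k, par k).2) = v :=
      Prod.ext (tsub_add_cancel_of_le hkv) hk
    set h : ι → MvPolynomial σ R :=
      monomial (v.1 - mon k) (vecCoeff g v * ↑c⁻¹) • fun i => d i k with hh
    have hhv : vecCoeff h v = vecCoeff g v := by
      conv_lhs => rw [← hv']
      rw [hh, vecCoeff_monomial_smul_add, ← hc, mul_assoc, Units.inv_mul, mul_one]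
    have hhs : ∀ s, vecCoeff h s ≠ 0 → s ≠ v → r s v := by
      intro s hs hne
      have := hr.isUnitLead_smul (hd k) (v.1 - mon k) _ hs
      rw [hv'] at this
      exact this hne
    have hhω : ∀ s, vecCoeff h s ≠ 0 → ω s = ω v := by
      intro s hs
      obtain ⟨s', hs', rfl⟩ := vecCoeff_monomial_smul_ne_zero hs
      rw [hω k _ s' hs']
      exact congrArg ω hv'
    have hpush : pushMonomial mon par (v.1 - mon k, k) = v := hv'
    have hcan := fun s => IsLead.cancel (s := s) hv.2 hhs hhv.symm
    have hmem : g - h ∈ N := N.sub_mem hg (N.smul_mem _ (hN k))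
    obtain ⟨w, hw, hwt⟩ : ∃ w : κ → MvPolynomial σ R, d.mulVec w = g - h ∧
        ∀ t, vecCoeff w t ≠ 0 → ∃ s, vecCoeff (g - h) s ≠ 0 ∧
          (pushMonomial mon par t = s ∨ r (pushMonomial mon par t) s) ∧
          ω (pushMonomial mon par t) = ω s := by
      by_cases h0 : g - h = 0
      · exact ⟨0, by simp [h0], fun t ht => absurd (vecCoeff_zero t) ht⟩
      · obtain ⟨v', hv''⟩ := exists_isLead hr h0
        exact ih v' (hcan v' hv''.1).2 _ hmem hv''
    refine ⟨w + monomial (v.1 - mon k) (vecCoeff g v * ↑c⁻¹) • Pi.single k 1, ?_, ?_⟩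
    · rw [Matrix.mulVec_add, hw, mulVec_monomial_smul_single, ← hh, sub_add_cancel]
    · intro t ht
      by_cases hwt0 : vecCoeff w t = 0
      · rw [vecCoeff_add, hwt0, zero_add] at ht
        rw [vecCoeff_smul_single_ne_zero ht, hpush]
        exact ⟨v, hv.1, Or.inl rfl, rfl⟩
      · obtain ⟨s, hs, hts, hωs⟩ := hwt t hwt0
        obtain ⟨hs', hsv⟩ := hcan s hs
        by_cases hgs : vecCoeff g s = 0
        · refine ⟨v, hv.1, Or.inr ?_, hωs.trans (hhω s (hs'.resolve_left (not_not.2 hgs)))⟩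
          rcases hts with rfl | hts
          · exact hsv
          · exact hr.trans hts hsv
        · exact ⟨s, hgs, hts, hωs⟩
  intro g hg
  by_cases h0 : g = 0
  · exact ⟨0, by simp [h0], fun t ht => absurd (vecCoeff_zero t) ht⟩
  · obtain ⟨v, hv⟩ := exists_isLead hr h0
    exact main v g hg hv

/-- If the lead monomial of an element of the kernel is `u • e_k`, then its image is cancelled by
the image of a monomial `t • e_i` with `i` before `k`. -/
lemma exists_before_of_mulVec_eq_zero {r : (σ →₀ ℕ) × ι → (σ →₀ ℕ) × ι → Prop}
    (hr : IsModuleOrder r) (o : LinearOrder κ) (d : Matrix ι κ (MvPolynomial σ R))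
    (mon : κ → σ →₀ ℕ) (par : κ → ι)
    (hd : ∀ k, IsUnitLead r (fun i => d i k) (mon k, par k)) {z : κ → MvPolynomial σ R}
    (hz : d.mulVec z = 0) {v : (σ →₀ ℕ) × κ}
    (hv : IsLead (inducedOrder r o.lt mon par) z v) :
    ∃ i, o.lt i v.2 ∧ par i = par v.2 ∧ mon i ≤ v.1 + mon v.2 := by
  classical
  by_contra! hcon
  obtain ⟨u, k⟩ := v
  have h0 : coeff (u + mon k) (d.mulVec z (par k)) = 0 := by rw [hz]; simp
  -- Any other contribution to this coefficient comes from a monomial of `z` below `u • e_k`. Either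
  -- its image lies strictly below, or it ties and its index is before `k`, which `hcon` forbids. So
  -- a nonzero coefficient times a unit would have to vanish.
  have h1 : coeff (u + mon k) (d.mulVec z (par k)) =
      coeff u (z k) * coeff (mon k) (d (par k) k) := by
    have hterm : ∀ (i : κ) (s t : σ →₀ ℕ), s + t = u + mon k →
        coeff s (d (par k) i) * coeff t (z i) ≠ 0 → i = k ∧ t = u := by
      intro i s t hst hne
      have hs := left_ne_zero_of_mul hne
      have ht := right_ne_zero_of_mul hne
      by_contra hik
      have hne' : (t, i) ≠ (u, k) := fun h => hik ⟨congrArg Prod.snd h, congrArg Prod.fst h⟩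
      have key : ∀ {x}, (s, par k) = (mon i, par i) ∨ r (s, par k) (mon i, par i) →
          r (t + mon i, par i) x → r (u + mon k, par k) x := by
        intro x h hx
        have hst' : u + mon k = t + s := by rw [← hst, add_comm]
        rcases h with h | h
        · obtain ⟨h, h'⟩ := Prod.mk.inj h
          rwa [hst', h, h']
        · rw [hst']
          exact hr.trans (hr.add t h) hx
      have hsi : (s, par k) = (mon i, par i) ∨ r (s, par k) (mon i, par i) := by
        by_cases h : (s, par k) = (mon i, par i)
        · exact Or.inl h
        · exact Or.inr ((hd i).2 (s, par k) hs h)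
      rcases hv.2 (t, i) ht hne' with h | ⟨h, h'⟩
      · exact hr.irrefl _ (key hsi h)
      · obtain ⟨h1, h2⟩ := Prod.mk.inj h
        have h3 : mon i ≤ u + mon k := by
          have h1' : t + mon i = u + mon k := h1
          rw [← h1']
          exact le_add_self
        exact hcon i h' h2 h3
    rw [Matrix.mulVec, dotProduct, coeff_sum, Finset.sum_eq_single k]
    · rw [coeff_mul, Finset.sum_eq_single (mon k, u)]
      · rw [mul_comm]
      · rintro ⟨s, t⟩ hst hne
        by_contra h
        obtain ⟨-, rfl⟩ := hterm k s t (by simpa using hst) h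
        apply hne
        have : s + t = t + mon k := by simpa using hst
        rw [add_comm] at this
        rw [add_left_cancel this]
      · intro h
        exact absurd (by simp [add_comm]) h
    · intro i _ hik
      rw [coeff_mul]
      refine Finset.sum_eq_zero fun x hx => ?_
      by_contra h
      exact hik (hterm i x.1 x.2 (by simpa using hx) h).1
    · simp
  rw [h1] at h0
  obtain ⟨c, hc⟩ := (hd k).1
  have hc' : coeff (mon k) (d (par k) k) = c := hc.symm
  rw [hc', Units.mul_left_eq_zero] at h0
  exact hv.1 h0

/-- Existence of a syzygy with a given lead monomial. -/
lemma exists_syzygy [Finite ι] {Γ : Type*} {r : (σ →₀ ℕ) × ι → (σ →₀ ℕ) × ι → Prop}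
    (hr : IsModuleOrder r) (o : LinearOrder κ)
    (d : Matrix ι κ (MvPolynomial σ R)) (mon : κ → σ →₀ ℕ) (par : κ → ι)
    (hd : ∀ k, IsUnitLead r (fun i => d i k) (mon k, par k))
    (ω : (σ →₀ ℕ) × ι → Γ)
    (hω : ∀ k t s, vecCoeff (fun i => d i k) s ≠ 0 → ω (t + s.1, s.2) = ω (t + mon k, par k))
    (N : Submodule (MvPolynomial σ R) (ι → MvPolynomial σ R)) (hN : ∀ k, (fun i => d i k) ∈ N)
    (hlead : ∀ g ∈ N, ∀ v, IsLead r g v → ∃ k, par k = v.2 ∧ mon k ≤ v.1)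
    {i k : κ} (hik : o.lt i k) (hpar : par i = par k) {u : σ →₀ ℕ} (hu : mon i ≤ u + mon k) :
    ∃ z : κ → MvPolynomial σ R, d.mulVec z = 0 ∧
      IsUnitLead (inducedOrder r o.lt mon par) z (u, k) ∧
      ∀ t, vecCoeff z t ≠ 0 → ω (pushMonomial mon par t) = ω (pushMonomial mon par (u, k)) := by
  classical
  obtain ⟨ci, hci⟩ := (hd i).1
  obtain ⟨ck, hck⟩ := (hd k).1
  set v : (σ →₀ ℕ) × ι := (u + mon k, par k) with hv
  set t := u + mon k - mon i with ht
  have hti : (t + (mon i, par i).1, (mon i, par i).2) = v :=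
    Prod.ext (tsub_add_cancel_of_le hu) hpar
  set g : ι → MvPolynomial σ R := monomial u (1 : R) • fun j => d j k with hg
  set h : ι → MvPolynomial σ R := monomial t (↑ck * ↑ci⁻¹ : R) • fun j => d j i with hh
  have hgv : vecCoeff g v = ck := by
    rw [hg, hv]
    exact (vecCoeff_monomial_smul_add u 1 _ (mon k, par k)).trans (by rw [one_mul, hck])
  have hhv : vecCoeff h v = ck := by
    conv_lhs => rw [← hti]
    rw [hh, vecCoeff_monomial_smul_add, ← hci, mul_assoc, Units.inv_mul, mul_one]
  have hgs : ∀ s, vecCoeff g s ≠ 0 → s ≠ v → r s v :=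
    fun s hs hne => hr.isUnitLead_smul (hd k) u _ hs hne
  have hhs : ∀ s, vecCoeff h s ≠ 0 → s ≠ v → r s v := by
    intro s hs hne
    have := hr.isUnitLead_smul (hd i) t _ hs
    rw [hti] at this
    exact this hne
  have hgω : ∀ s, vecCoeff g s ≠ 0 → ω s = ω v := by
    intro s hs
    obtain ⟨s', hs', rfl⟩ := vecCoeff_monomial_smul_ne_zero hs
    exact hω k _ s' hs'
  have hhω : ∀ s, vecCoeff h s ≠ 0 → ω s = ω v := by
    intro s hs
    obtain ⟨s', hs', rfl⟩ := vecCoeff_monomial_smul_ne_zero hs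
    rw [hω i _ s' hs']
    exact congrArg ω hti
  have hcan := fun s => IsLead.cancel (s := s) hgs hhs (hgv.trans hhv.symm)
  -- `g - h` is the S-vector of the columns `k` and `i`; its terms at `v` cancel, so division yields
  -- a `w` whose support pushes strictly below `v`. The syzygy is the difference of the two
  -- monomials minus `w`.
  obtain ⟨w, hw, hwt⟩ := exists_preimage hr d mon par hd ω hω N hN hlead (g - h)
    (N.sub_mem (N.smul_mem _ (hN k)) (N.smul_mem _ (hN i)))
  have hwr : ∀ s, vecCoeff w s ≠ 0 → r (pushMonomial mon par s) v := by
    intro s hs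
    obtain ⟨s', hs', h', -⟩ := hwt s hs
    rcases h' with h' | h'
    · exact h' ▸ (hcan s' hs').2
    · exact hr.trans h' (hcan s' hs').2
  have hwω : ∀ s, vecCoeff w s ≠ 0 → ω (pushMonomial mon par s) = ω v := by
    intro s hs
    obtain ⟨s', hs', -, h'⟩ := hwt s hs
    exact h'.trans ((hcan s' hs').1.elim (hgω s') (hhω s'))
  have hki : k ≠ i := by
    rintro rfl
    exact @lt_irrefl _ o.toPreorder _ hik
  set A : κ → MvPolynomial σ R := monomial u (1 : R) • Pi.single k 1 with hA
  set B : κ → MvPolynomial σ R := monomial t (↑ck * ↑ci⁻¹ : R) • Pi.single i 1 with hB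
  have hsupp : ∀ s, vecCoeff (A - B - w) s ≠ 0 →
      s = (u, k) ∨ s = (t, i) ∨ vecCoeff w s ≠ 0 := by
    intro s hs
    by_contra! hcon
    rw [vecCoeff_sub, vecCoeff_sub, hcon.2.2,
      not_not.1 (mt vecCoeff_smul_single_ne_zero hcon.1),
      not_not.1 (mt vecCoeff_smul_single_ne_zero hcon.2.1)] at hs
    simp at hs
  refine ⟨A - B - w, ?_, ⟨?_, ?_⟩, ?_⟩
  · rw [Matrix.mulVec_sub, Matrix.mulVec_sub, hw, hA, hB, mulVec_monomial_smul_single,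
      mulVec_monomial_smul_single, sub_self]
  · have h1 : vecCoeff w (u, k) = 0 := by
      by_contra h1
      exact hr.irrefl _ (hwr _ h1)
    have h2 : vecCoeff B (u, k) = 0 := by
      by_contra h2
      exact hki (congrArg Prod.snd (vecCoeff_smul_single_ne_zero h2))
    rw [vecCoeff_sub, vecCoeff_sub, h1, h2, hA, vecCoeff_smul_single]
    simp
  · intro s hs hne
    rcases hsupp s hs with h' | h' | h'
    · exact absurd h' hne
    -- The monomial on `e_i` also pushes to `v`; it loses only by the tie-break, since `i` is before
    -- `k`.
    · exact Or.inr ⟨h' ▸ hti, h' ▸ hik⟩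
    · exact Or.inl (hwr s h')
  · intro s hs
    rcases hsupp s hs with h' | h' | h'
    · rw [h']
    · rw [h']
      exact congrArg ω hti
    · exact hwω s h'

end ModuleOrder

/-! ### The combinatorial frame of a Schreyer resolution -/

section Paths

variable {σ : Type} (m : MonomialOrder σ)

/-- The order in which the generators of a monomial ideal are sorted. -/
def MonomialBefore (n g : σ →₀ ℕ) : Prop :=
  n.degree < g.degree ∨ n.degree = g.degree ∧ g ≺[m] n

/-- The minimal generators of `(n ∈ S : n before g) : g`. -/
def colonGens (S : Set (σ →₀ ℕ)) (g : σ →₀ ℕ) : Set (σ →₀ ℕ) :=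
  {u | Minimal (fun u => ∃ n ∈ S, MonomialBefore m n g ∧ n ≤ u + g) u}

/-- Iterated colon ideals along a list of monomials, whose last entry comes first. -/
def pathGens (S : Set (σ →₀ ℕ)) : List (σ →₀ ℕ) → Set (σ →₀ ℕ)
  | [] => S
  | g :: l => colonGens m (pathGens S l) g

/-- Every monomial of the list is a generator of the corresponding iterated colon ideal. -/
def IsPath (S : Set (σ →₀ ℕ)) : List (σ →₀ ℕ) → Prop
  | [] => True
  | g :: l => g ∈ pathGens m S l ∧ IsPath S l

/-- The index set of the basis of the `p`-th term of a Schreyer resolution of an ideal whose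
initial ideal has the minimal generators `S`. -/
abbrev Path (S : Set (σ →₀ ℕ)) (p : ℕ) : Type := {l : List (σ →₀ ℕ) // l.length = p ∧ IsPath m S l}

variable {m} {S : Set (σ →₀ ℕ)} {p : ℕ}

/-- The default value of `headI` is never reached, since the list has length `p + 1`. -/
def pathMon (k : Path m S (p + 1)) : σ →₀ ℕ := k.1.headI

def pathPar (k : Path m S (p + 1)) : Path m S p :=
  ⟨k.1.tail, by
    obtain ⟨l, hl, h⟩ := k
    cases l with
    | nil => simp at hl
    | cons g l => exact ⟨by simpa using hl, h.2⟩⟩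

lemma path_eq_cons (k : Path m S (p + 1)) : k.1 = pathMon k :: (pathPar k).1 := by
  obtain ⟨l, hl, h⟩ := k
  cases l with
  | nil => simp at hl
  | cons g l => rfl

lemma pathMon_mem (k : Path m S (p + 1)) : pathMon k ∈ pathGens m S (pathPar k).1 := by
  have := k.2.2
  rw [path_eq_cons k] at this
  exact this.1

lemma path_ext {k l : Path m S (p + 1)} (h1 : pathMon k = pathMon l) (h2 : pathPar k = pathPar l) :
    k = l := by
  apply Subtype.ext
  rw [path_eq_cons k, path_eq_cons l, h1, h2]

/-- Extending a path. -/
def pathCons (k : Path m S p) (g : σ →₀ ℕ) (hg : g ∈ pathGens m S k.1) : Path m S (p + 1) :=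
  ⟨g :: k.1, congrArg (· + 1) k.2.1, hg, k.2.2⟩

lemma sum_path (k : Path m S (p + 1)) : k.1.sum = pathMon k + (pathPar k).1.sum := by
  conv_lhs => rw [path_eq_cons k]
  simp

lemma exists_mem_colonGens [Finite σ] {g u : σ →₀ ℕ}
    (h : ∃ n ∈ S, MonomialBefore m n g ∧ n ≤ u + g) : ∃ v ∈ colonGens m S g, v ≤ u := by
  obtain ⟨v, hv, hmin⟩ := exists_minimal_le_of_wellFoundedLT
    (fun u => ∃ n ∈ S, MonomialBefore m n g ∧ n ≤ u + g) u h
  exact ⟨v, hmin, hv⟩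

/-- Dickson's lemma: minimal elements form an antichain, and antichains of exponent vectors in
finitely many variables are finite. -/
instance finite_colonGens [Finite σ] (g : σ →₀ ℕ) : Finite (colonGens m S g) :=
  (WellQuasiOrderedLE.finite_of_isAntichain (setOfPred_minimal_antichain _)).to_subtype

instance finite_pathGens [Finite σ] [hS : Finite S] (l : List (σ →₀ ℕ)) :
    Finite (pathGens m S l) := by
  cases l with
  | nil => exact hS
  | cons g l => exact finite_colonGens g

instance finite_path [Finite σ] [Finite S] : Finite (Path m S p) := by
  induction p with
  | zero =>
    have : Subsingleton (Path m S 0) := ⟨fun k l => Subtype.ext (by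
      rw [List.length_eq_zero_iff.1 k.2.1, List.length_eq_zero_iff.1 l.2.1])⟩
    infer_instance
  | succ p ih =>
    refine Finite.of_injective (β := Σ k : Path m S p, pathGens m S k.1)
      (fun k => ⟨pathPar k, pathMon k, pathMon_mem k⟩) fun k l h => ?_
    have h1 : pathPar k = pathPar l := congrArg Sigma.fst h
    have h2 : pathMon k = pathMon l := congrArg (fun x => (x.2 : σ →₀ ℕ)) h
    exact path_ext h2 h1

variable (m) in
/-- The sorting key of a monomial. -/
def sortKey (g : σ →₀ ℕ) : ℕ ×ₗ m.synᵒᵈ := toLex (g.degree, OrderDual.toDual (m.toSyn g))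

lemma sortKey_injective : Function.Injective (sortKey m) := by
  intro g h hgh
  have : (toLex.symm (sortKey m g)).2 = (toLex.symm (sortKey m h)).2 := by rw [hgh]
  exact m.toSyn.injective this

lemma sortKey_lt {g h : σ →₀ ℕ} : sortKey m g < sortKey m h ↔ MonomialBefore m g h := by
  rw [sortKey, sortKey, Prod.Lex.toLex_lt_toLex]
  rfl

variable (m S p) in
/-- The paths are sorted lexicographically. -/
@[reducible] def pathOrder : LinearOrder (Path m S p) :=
  LinearOrder.lift' (fun k => k.1.map (sortKey m)) fun _ _ h =>
    Subtype.ext (List.map_injective_iff.2 sortKey_injective h)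

/-- Siblings share their tail, so the lexicographic comparison is decided by the heads. Only
siblings are ever compared, both in the colon ideals and in the tie-breaks of the induced order. -/
lemma path_lt_iff {k l : Path m S (p + 1)} (h : pathPar k = pathPar l) :
    (pathOrder m S (p + 1)).lt k l ↔ MonomialBefore m (pathMon k) (pathMon l) := by
  change k.1.map (sortKey m) < l.1.map (sortKey m) ↔ _
  rw [path_eq_cons k, path_eq_cons l, h, List.map_cons, List.map_cons, List.cons_lt_cons_iff,
    sortKey_lt]
  simp

instance unique_path_zero : Unique (Path m S 0) where
  default := ⟨[], rfl, trivial⟩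
  uniq k := Subtype.ext (List.length_eq_zero_iff.1 k.2.1)

variable (m S) in
/-- The induced monomial orders on the terms of a Schreyer resolution. -/
def pathLt : ∀ p, (σ →₀ ℕ) × Path m S p → (σ →₀ ℕ) × Path m S p → Prop
  | 0 => fun v w => v.1 ≺[m] w.1
  | p + 1 => inducedOrder (pathLt p) (pathOrder m S (p + 1)).lt pathMon pathPar

lemma isModuleOrder_zero {ι : Type} [Subsingleton ι] :
    IsModuleOrder fun v w : (σ →₀ ℕ) × ι => v.1 ≺[m] w.1 where
  wf := InvImage.wf (fun v : (σ →₀ ℕ) × ι => m.toSyn v.1) m.wellFoundedLT_syn.wf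
  trans h k := lt_trans h k
  tri u v := by
    rcases lt_trichotomy (m.toSyn u.1) (m.toSyn v.1) with h | h | h
    · exact Or.inl h
    · exact Or.inr (Or.inl (Prod.ext (m.toSyn.injective h) (Subsingleton.elim _ _)))
    · exact Or.inr (Or.inr h)
  add c u v h := by
    simpa using h

lemma isModuleOrder_pathLt [Finite σ] [Finite S] (p : ℕ) : IsModuleOrder (pathLt m S p) := by
  induction p with
  | zero => exact isModuleOrder_zero
  | succ p ih => exact ih.induced (pathOrder m S (p + 1)) pathMon pathPar

end Paths

/-! ### Schreyer resolutions and their frames -/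

section Schreyer

variable {σ : Type} {R : Type*} [CommRing R] {m : MonomialOrder σ} {F : GradedFreeComplex σ R}
  {I : Ideal (MvPolynomial σ R)}

/-- The conditions on the frame of a Schreyer resolution. -/
structure IsSchreyerFrame (m : MonomialOrder σ) (F : GradedFreeComplex σ R)
    (I : Ideal (MvPolynomial σ R)) (S : SchreyerFrame F) : Prop where
  card_zero : Nat.card (F.ι 0) = 1
  deg_zero : ∀ i, F.deg 0 i = 0
  mem : ∀ i k, F.d 0 i k ∈ I
  span_eq : Ideal.span (Set.range fun k => monomial (S.mon 0 k) (1 : R)) = initialIdeal m I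
  antichain : ∀ k l, S.mon 0 k ≤ S.mon 0 l → k = l
  lead : ∀ p k, IsUnitLead (S.lt m p) (fun i => F.d p i k) (S.mon p k, S.par p k)
  before_iff : ∀ p k l, S.par p k = S.par p l →
    (S.before k l ↔ MonomialBefore m (S.mon p k) (S.mon p l))
  bijOn : ∀ p, Set.BijOn (fun l : F.ι (p + 2) => (S.par (p + 1) l, S.mon (p + 1) l)) Set.univ
      {q | Minimal (fun u => monomial u (1 : R) ∈ S.colonIdeal p q.1) q.2}

lemma isSchreyerResolution_iff :
    IsSchreyerResolution m F I ↔ ∃ S : SchreyerFrame F, IsSchreyerFrame m F I S := by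
  constructor
  · rintro ⟨S, ⟨h1, h2⟩, ⟨h3, h4, h5⟩, h6, h7, h8⟩
    exact ⟨S, h1, h2, h3, h4, h5, fun p k => ⟨(h6 p k).1, fun s hs hne =>
      (h6 p k).2 s.2 s.1 (mem_support_iff.2 hs) hne⟩, h7, h8⟩
  · rintro ⟨S, h⟩
    exact ⟨S, ⟨h.card_zero, h.deg_zero⟩, ⟨h.mem, h.span_eq, h.antichain⟩, fun p k =>
      ⟨(h.lead p k).1, fun i u hu hne => (h.lead p k).2 (u, i) (mem_support_iff.1 hu) hne⟩,
      h.before_iff, h.bijOn⟩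

lemma monomial_mem_span_iff [Nontrivial R] {T : Set (σ →₀ ℕ)} {u : σ →₀ ℕ} {c : R} (hc : c ≠ 0) :
    monomial u c ∈ Ideal.span ((fun s => monomial s (1 : R)) '' T) ↔ ∃ s ∈ T, s ≤ u := by
  classical
  rw [mem_ideal_span_monomial_image]
  simp [support_monomial, hc]

lemma SchreyerFrame.mem_colonIdeal [Nontrivial R] (S : SchreyerFrame F) (p : ℕ) (k : F.ι (p + 1))
    (u : σ →₀ ℕ) : monomial u (1 : R) ∈ S.colonIdeal p k ↔
      ∃ i, S.before i k ∧ S.par p i = S.par p k ∧ S.mon p i ≤ u + S.mon p k := by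
  have h : {f | ∃ i, S.before i k ∧ S.par p i = S.par p k ∧ f = monomial (S.mon p i) (1 : R)} =
      (fun s => monomial s (1 : R)) '' (S.mon p '' {i | S.before i k ∧ S.par p i = S.par p k}) := by
    ext f
    constructor
    · rintro ⟨i, h1, h2, rfl⟩
      exact ⟨_, ⟨i, ⟨h1, h2⟩, rfl⟩, rfl⟩
    · rintro ⟨_, ⟨i, ⟨h1, h2⟩, rfl⟩, rfl⟩
      exact ⟨i, h1, h2, rfl⟩
  rw [SchreyerFrame.colonIdeal, h, Submodule.mem_colon_singleton, smul_eq_mul, monomial_mul,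
    one_mul, monomial_mem_span_iff one_ne_zero]
  simp [and_assoc]

lemma SchreyerFrame.isModuleOrder_lt [Subsingleton (F.ι 0)] (S : SchreyerFrame F) (p : ℕ) :
    IsModuleOrder (S.lt m p) := by
  induction p with
  | zero => exact isModuleOrder_zero
  | succ p ih => exact ih.induced (S.order (p + 1)) (S.mon p) (S.par p)

/-- The list of the lead monomials along the ancestors of a basis element. -/
def SchreyerFrame.path (S : SchreyerFrame F) : ∀ p, F.ι p → List (σ →₀ ℕ)
  | 0, _ => []
  | p + 1, k => S.mon p k :: S.path p (S.par p k)

namespace IsSchreyerFrame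

variable {S : SchreyerFrame F} (h : IsSchreyerFrame m F I S)

include h

lemma subsingleton : Subsingleton (F.ι 0) :=
  Finite.card_le_one_iff_subsingleton.1 h.card_zero.le

/-- Two antichains of monomials generating the same ideal coincide: a monomial of one is divisible
by one of the other and conversely, and the antichain property closes the loop. -/
lemma children_zero [Nontrivial R] {G : Set (σ →₀ ℕ)} (hG : IsAntichain (· ≤ ·) G)
    (hin : initialIdeal m I = Ideal.span ((fun s => monomial s (1 : R)) '' G)) :
    Set.range (S.mon 0) = G := by
  have hspan := h.span_eq.trans hin
  have hr : (Set.range fun k => monomial (S.mon 0 k) (1 : R)) =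
      (fun s => monomial s (1 : R)) '' Set.range (S.mon 0) := by
    rw [← Set.range_comp]
    rfl
  rw [hr] at hspan
  have hr' : ∀ u ∈ Set.range (S.mon 0), ∃ g ∈ G, g ≤ u := fun u hu =>
    (monomial_mem_span_iff (one_ne_zero (α := R))).1
      (hspan ▸ Ideal.subset_span ⟨u, hu, rfl⟩)
  have hg' : ∀ u ∈ G, ∃ g ∈ Set.range (S.mon 0), g ≤ u := fun u hu =>
    (monomial_mem_span_iff (one_ne_zero (α := R))).1
      (hspan ▸ Ideal.subset_span ⟨u, hu, rfl⟩)
  ext u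
  constructor
  · rintro ⟨k, rfl⟩
    obtain ⟨g, hg, hgk⟩ := hr' _ ⟨k, rfl⟩
    obtain ⟨_, ⟨l, rfl⟩, hl⟩ := hg' g hg
    obtain rfl := h.antichain l k (hl.trans hgk)
    exact le_antisymm hl hgk ▸ hg
  · intro hu
    obtain ⟨_, ⟨k, rfl⟩, hk⟩ := hg' u hu
    obtain ⟨g, hg, hgk⟩ := hr' _ ⟨k, rfl⟩
    obtain rfl : g = u := hG.eq hg hu (hgk.trans hk)
    exact ⟨k, le_antisymm hk hgk⟩

/-- Induction on `p`: the colon ideal of `k` sees only the monomials of the earlier siblings of `k`,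
which by induction are read off from the path of their common parent. This is why the frame depends
on the initial ideal alone. -/
lemma children [Nontrivial R] {G : Set (σ →₀ ℕ)} (hG : IsAntichain (· ≤ ·) G)
    (hin : initialIdeal m I = Ideal.span ((fun s => monomial s (1 : R)) '' G)) (p : ℕ) :
    ∀ (k : F.ι p) (u : σ →₀ ℕ),
      u ∈ pathGens m G (S.path p k) ↔ ∃ l, S.par p l = k ∧ S.mon p l = u := by
  induction p with
  | zero =>
    intro k u
    change u ∈ G ↔ _
    rw [← h.children_zero hG hin]
    have := h.subsingleton
    simp [Subsingleton.elim _ k]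
  | succ p ih =>
    intro k u
    have hb := h.bijOn p
    have h1 : (∃ l, S.par (p + 1) l = k ∧ S.mon (p + 1) l = u) ↔
        (k, u) ∈ {q : F.ι (p + 1) × (σ →₀ ℕ) |
          Minimal (fun u => monomial u (1 : R) ∈ S.colonIdeal p q.1) q.2} := by
      rw [← hb.image_eq]
      simp
    rw [h1]
    have h2 : (fun u => ∃ n ∈ pathGens m G (S.path p (S.par p k)),
        MonomialBefore m n (S.mon p k) ∧ n ≤ u + S.mon p k) =
        fun u => monomial u (1 : R) ∈ S.colonIdeal p k := by
      funext u
      rw [S.mem_colonIdeal]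
      apply propext
      constructor
      · rintro ⟨n, hn, hb, hle⟩
        obtain ⟨i, hi, rfl⟩ := (ih _ _).1 hn
        exact ⟨i, (h.before_iff p i k hi).2 hb, hi, hle⟩
      · rintro ⟨i, hi, hp, hle⟩
        exact ⟨_, (ih _ _).2 ⟨i, hp, rfl⟩, (h.before_iff p i k hp).1 hi, hle⟩
    rw [Set.mem_ofPred_eq, ← h2]
    rfl

lemma siblings_injective (p : ℕ) {k l : F.ι (p + 1)} (hpar : S.par p k = S.par p l)
    (hmon : S.mon p k = S.mon p l) : k = l := by
  cases p with
  | zero => exact h.antichain k l hmon.le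
  | succ p => exact (h.bijOn p).injOn trivial trivial (Prod.ext hpar hmon)

/-- A Schreyer resolution is indexed by the paths of its initial ideal. -/
theorem exists_equiv_path [Nontrivial R] {G : Set (σ →₀ ℕ)} (hG : IsAntichain (· ≤ ·) G)
    (hin : initialIdeal m I = Ideal.span ((fun s => monomial s (1 : R)) '' G)) (p : ℕ) :
    ∃ e : F.ι p ≃ Path m G p, ∀ k, F.deg p k = ((e k).1.sum.degree : ℕ) := by
  have hpath : ∀ k, (S.path p k).length = p ∧ IsPath m G (S.path p k) := by
    induction p with
    | zero => exact fun k => ⟨rfl, trivial⟩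
    | succ p ih =>
      exact fun k => ⟨by simp [SchreyerFrame.path, (ih _).1],
        (h.children hG hin p _ _).2 ⟨k, rfl, rfl⟩, (ih _).2⟩
  have hinj : Function.Injective (S.path p) := by
    clear hpath
    induction p with
    | zero =>
      intro k l _
      exact h.subsingleton.elim k l
    | succ p ih =>
      intro k l hkl
      obtain ⟨h1, h2⟩ := List.cons.inj hkl
      exact h.siblings_injective p (ih h2) h1
  have hsurj : ∀ l : List (σ →₀ ℕ), l.length = p → IsPath m G l → ∃ k, S.path p k = l := by
    clear hpath hinj
    induction p with
    | zero =>
      intro l hl _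
      have : Nonempty (F.ι 0) := (Nat.card_pos_iff.1 (h.card_zero ▸ one_pos)).1
      exact ⟨Classical.arbitrary _, (List.length_eq_zero_iff.1 hl).symm⟩
    | succ p ih =>
      intro l hl hp
      cases l with
      | nil => simp at hl
      | cons g l =>
        obtain ⟨k, rfl⟩ := ih l (by simpa using hl) hp.2
        obtain ⟨k', rfl, rfl⟩ := (h.children hG hin p _ _).1 hp.1
        exact ⟨k', rfl⟩
  refine ⟨Equiv.ofBijective (fun k => ⟨S.path p k, hpath k⟩)
    ⟨fun k l hkl => hinj (congrArg Subtype.val hkl), fun l => ?_⟩, ?_⟩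
  · obtain ⟨k, hk⟩ := hsurj l.1 l.2.1 l.2.2
    exact ⟨k, Subtype.ext hk⟩
  · change ∀ k, F.deg p k = ((S.path p k).sum.degree : ℕ)
    clear hpath hinj hsurj
    induction p with
    | zero =>
      intro k
      simp [SchreyerFrame.path, h.deg_zero]
    | succ p ih =>
      intro k
      -- The lead coefficient is a unit, so homogeneity of the differential applies at the lead
      -- monomial and the degree grows by that of `mon` at each step.
      have hne : (F.d p (S.par p k) k).coeff (S.mon p k) ≠ 0 := (h.lead p k).1.ne_zero
      rw [← F.homogeneous p _ k _ (mem_support_iff.2 hne), ih]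
      simp [SchreyerFrame.path]

end IsSchreyerFrame

end Schreyer

/-! ### Exactness of Schreyer resolutions -/

section Exactness

variable {σ : Type} {R : Type*} [CommRing R] {m : MonomialOrder σ}

lemma exists_le_of_isLead [Nontrivial R] {ι : Type} {I : Ideal (MvPolynomial σ R)}
    {G : Set (σ →₀ ℕ)}
    (hin : initialIdeal m I = Ideal.span ((fun s => monomial s (1 : R)) '' G))
    {g : ι → MvPolynomial σ R} (hg : ∀ i, g i ∈ I) {v : (σ →₀ ℕ) × ι}
    (hv : IsLead (fun v w : (σ →₀ ℕ) × ι => v.1 ≺[m] w.1) g v) : ∃ u ∈ G, u ≤ v.1 := by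
  have hne : coeff v.1 (g v.2) ≠ 0 := hv.1
  have hg0 : g v.2 ≠ 0 := fun h => hne (by rw [h, coeff_zero])
  have hdeg : m.degree (g v.2) = v.1 := by
    by_contra h
    have h1 := hv.2 (m.degree (g v.2), v.2) (m.coeff_degree_ne_zero_iff.2 hg0)
      (fun h' => h (congrArg Prod.fst h'))
    exact absurd (m.le_degree (mem_support_iff.2 hne)) (not_le.2 h1)
  have hmem : m.leadingTerm (g v.2) ∈ initialIdeal m I :=
    Ideal.subset_span ⟨_, hg v.2, rfl⟩
  rw [hin, MonomialOrder.leadingTerm, hdeg] at hmem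
  refine (monomial_mem_span_iff ?_).1 hmem
  rw [MonomialOrder.leadingCoeff, hdeg]
  exact hne

variable {F : GradedFreeComplex σ R} {I : Ideal (MvPolynomial σ R)} {S : SchreyerFrame F}

namespace IsSchreyerFrame

lemma exists_le_of_isLead_of_mem [Nontrivial R] (h : IsSchreyerFrame m F I S)
    {g : F.ι 0 → MvPolynomial σ R} (hg : ∀ i, g i ∈ I) {v : (σ →₀ ℕ) × F.ι 0}
    (hv : IsLead (S.lt m 0) g v) : ∃ k, S.par 0 k = v.2 ∧ S.mon 0 k ≤ v.1 := by
  have hin : initialIdeal m I =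
      Ideal.span ((fun s => monomial s (1 : R)) '' Set.range (S.mon 0)) := by
    rw [← h.span_eq, ← Set.range_comp]
    rfl
  obtain ⟨_, ⟨k, rfl⟩, hk⟩ := exists_le_of_isLead hin hg hv
  exact ⟨k, h.subsingleton.elim _ _, hk⟩

/-- The Gröbner basis property of the next differential: cancellation of the lead term places `v.1`
in the colon ideal of `v.2`, and each minimal generator of that ideal is the monomial of a child of
`v.2`. -/
lemma exists_le_of_isLead_of_mulVec_eq_zero [Finite σ] [Nontrivial R]
    (h : IsSchreyerFrame m F I S) {p : ℕ}
    {z : F.ι (p + 1) → MvPolynomial σ R} (hz : (F.d p).mulVec z = 0) {v : (σ →₀ ℕ) × F.ι (p + 1)}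
    (hv : IsLead (S.lt m (p + 1)) z v) : ∃ k, S.par (p + 1) k = v.2 ∧ S.mon (p + 1) k ≤ v.1 := by
  have := h.subsingleton
  have hcol := (S.mem_colonIdeal p v.2 v.1).2 (exists_before_of_mulVec_eq_zero
    (S.isModuleOrder_lt p) (S.order (p + 1)) (F.d p) (S.mon p) (S.par p) (h.lead p) hz hv)
  obtain ⟨u, hu, hmin⟩ := exists_minimal_le_of_wellFoundedLT
    (fun u => monomial u (1 : R) ∈ S.colonIdeal p v.2) v.1 hcol
  obtain ⟨k, -, hk⟩ := (h.bijOn p).surjOn (show (v.2, u) ∈ {q : F.ι (p + 1) × (σ →₀ ℕ) |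
    Minimal (fun u => monomial u (1 : R) ∈ S.colonIdeal p q.1) q.2} from hmin)
  obtain ⟨h1, h2⟩ := Prod.mk.inj hk
  exact ⟨k, h1, h2 ▸ hu⟩

/-- At every spot the columns lie in the kernel, and their lead monomials divide that of any kernel
element, so division by them leaves no remainder. Homogeneity plays no role, hence the trivial
grading passed to `exists_preimage`. -/
theorem isResolution [Finite σ] [Nontrivial R] (h : IsSchreyerFrame m F I S) :
    F.IsResolution I := by
  classical
  have hsub := h.subsingleton
  have hne : Nonempty (F.ι 0) := (Nat.card_pos_iff.1 (h.card_zero ▸ one_pos)).1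
  obtain ⟨i₀⟩ := hne
  refine ⟨(Algebra.linearMap (MvPolynomial σ R) (MvPolynomial σ R ⧸ I)).comp
    (LinearMap.proj i₀), fun i => ⟨1, ?_, ?_⟩, ?_, ?_, ?_⟩
  · intro u hu
    have : u = 0 := by
      by_contra hu'
      rw [mem_support_iff, MvPolynomial.coeff_one, if_neg (Ne.symm hu')] at hu
      exact hu rfl
    simp [this, h.deg_zero]
  · obtain rfl := hsub.elim i i₀
    simp
  · intro y
    obtain ⟨x, rfl⟩ := Ideal.Quotient.mk_surjective y
    exact ⟨fun _ => x, rfl⟩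
  · intro y
    have hy : (Algebra.linearMap (MvPolynomial σ R) (MvPolynomial σ R ⧸ I)).comp
        (LinearMap.proj i₀) y = 0 ↔ y i₀ ∈ I := Ideal.Quotient.eq_zero_iff_mem
    rw [hy]
    constructor
    · intro hy
      obtain ⟨w, hw, -⟩ := exists_preimage (S.isModuleOrder_lt 0) (F.d 0) (S.mon 0) (S.par 0)
        (h.lead 0) (fun _ => ()) (fun _ _ _ _ => rfl) (Submodule.pi Set.univ fun _ => I)
        (fun k i _ => h.mem i k) (fun g hg v hv => h.exists_le_of_isLead_of_mem
          (fun i => hg i trivial) hv) y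
        (fun i _ => hsub.elim i₀ i ▸ hy)
      exact ⟨w, hw⟩
    · rintro ⟨w, rfl⟩
      rw [Matrix.mulVecLin_apply, Matrix.mulVec, dotProduct]
      exact I.sum_mem fun k _ => I.mul_mem_right _ (h.mem _ _)
  · intro p y
    constructor
    · intro hy
      obtain ⟨w, hw, -⟩ := exists_preimage (S.isModuleOrder_lt (p + 1)) (F.d (p + 1))
        (S.mon (p + 1)) (S.par (p + 1))
        (h.lead (p + 1)) (fun _ => ()) (fun _ _ _ _ => rfl) (LinearMap.ker (F.d p).mulVecLin)
        (fun k => by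
          have := congrArg (fun A => fun i => A i k) (F.d_mul_d p)
          exact this)
        (fun g hg v hv => h.exists_le_of_isLead_of_mulVec_eq_zero hg hv) y hy
      exact ⟨w, hw⟩
    · rintro ⟨w, rfl⟩
      rw [Matrix.mulVecLin_apply, Matrix.mulVecLin_apply, Matrix.mulVec_mulVec, F.d_mul_d,
        Matrix.zero_mulVec]

end IsSchreyerFrame

end Exactness

/-! ### Existence of Schreyer resolutions -/

section Existence

/-- Dependent choice along the natural numbers. -/
lemma exists_seq_of_step {α : ℕ → Type*} (P : ∀ p, α p → Prop) (Q : ∀ p, α p → α (p + 1) → Prop)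
    (h0 : ∃ x, P 0 x) (hs : ∀ p x, P p x → ∃ y, P (p + 1) y ∧ Q p x y) :
    ∃ f : ∀ p, α p, ∀ p, P p (f p) ∧ Q p (f p) (f (p + 1)) := by
  let g : ∀ p, {x : α p // P p x} := fun p => Nat.rec ⟨h0.choose, h0.choose_spec⟩
    (fun p x => ⟨(hs p x.1 x.2).choose, (hs p x.1 x.2).choose_spec.1⟩) p
  exact ⟨fun p => (g p).1, fun p => ⟨(g p).2, (hs p (g p).1 (g p).2).choose_spec.2⟩⟩

variable {σ : Type} {R : Type*} [CommRing R] {m : MonomialOrder σ} {G : Set (σ →₀ ℕ)}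
  {Γ : Type*} [AddCommMonoid Γ] (W : (σ →₀ ℕ) →+ Γ)

/-- A differential of a Schreyer resolution from which the construction can be continued. -/
structure IsSchreyerStage (p : ℕ) (d : Matrix (Path m G p) (Path m G (p + 1)) (MvPolynomial σ R)) :
    Prop where
  lead : ∀ k, IsUnitLead (pathLt m G p) (fun i => d i k) (pathMon k, pathPar k)
  homogeneous : ∀ k s, vecCoeff (fun i => d i k) s ≠ 0 → W (s.1 + s.2.1.sum) = W k.1.sum
  divisible : ∃ N : Submodule (MvPolynomial σ R) (Path m G p → MvPolynomial σ R),
    (∀ k, (fun i => d i k) ∈ N) ∧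
      ∀ g ∈ N, ∀ v, IsLead (pathLt m G p) g v → ∃ k, pathPar k = v.2 ∧ pathMon k ≤ v.1

instance [Finite σ] [Finite G] (p : ℕ) : Fintype (Path m G p) := Fintype.ofFinite _

/-- The last monomial of a path of length `p + 2` is a minimal element of a colon ideal, so some
earlier sibling of the parent divides the corresponding product; `exists_syzygy` turns this into a
column. The kernel of `d` becomes the next submodule `N`. -/
lemma IsSchreyerStage.exists_next [Finite σ] [Finite G] {p : ℕ}
    {d : Matrix (Path m G p) (Path m G (p + 1)) (MvPolynomial σ R)} (hd : IsSchreyerStage W p d) :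
    ∃ d' : Matrix (Path m G (p + 1)) (Path m G (p + 2)) (MvPolynomial σ R),
      IsSchreyerStage W (p + 1) d' ∧ d * d' = 0 := by
  obtain ⟨N, hN, hlead⟩ := hd.divisible
  have key : ∀ l : Path m G (p + 2), ∃ z : Path m G (p + 1) → MvPolynomial σ R,
      d.mulVec z = 0 ∧ IsUnitLead (pathLt m G (p + 1)) z (pathMon l, pathPar l) ∧
      ∀ t, vecCoeff z t ≠ 0 → W (t.1 + t.2.1.sum) = W l.1.sum := by
    intro l
    obtain ⟨n, hn, hb, hle⟩ : ∃ n ∈ pathGens m G (pathPar (pathPar l)).1,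
        MonomialBefore m n (pathMon (pathPar l)) ∧ n ≤ pathMon l + pathMon (pathPar l) := by
      have := pathMon_mem l
      rw [path_eq_cons (pathPar l)] at this
      exact (show Minimal (fun u => ∃ n ∈ pathGens m G (pathPar (pathPar l)).1,
        MonomialBefore m n (pathMon (pathPar l)) ∧ n ≤ u + pathMon (pathPar l)) (pathMon l)
        from this).prop
    let i : Path m G (p + 1) := pathCons _ n hn
    have hpar : pathPar i = pathPar (pathPar l) := Subtype.ext rfl
    have hmon : pathMon i = n := rfl
    obtain ⟨z, hz, hz', hz''⟩ := exists_syzygy (isModuleOrder_pathLt p) (pathOrder m G (p + 1)) d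
      pathMon pathPar hd.lead (fun v => W (v.1 + v.2.1.sum))
      (fun k t s hs => by
        change W (t + s.1 + s.2.1.sum) = W (t + pathMon k + (pathPar k).1.sum)
        rw [add_assoc, add_assoc, map_add, map_add W t, hd.homogeneous k s hs, sum_path k])
      N hN hlead ((path_lt_iff (k := i) hpar).2 hb) hpar hle
    refine ⟨z, hz, hz', fun t ht => ?_⟩
    have := hz'' t ht
    change W (t.1 + pathMon t.2 + (pathPar t.2).1.sum) = W (pathMon l + pathMon (pathPar l) +
      (pathPar (pathPar l)).1.sum) at this
    rwa [add_assoc, ← sum_path, add_assoc, ← sum_path, ← sum_path] at this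
  choose z hz hlead' hhom using key
  refine ⟨fun i l => z l i, ⟨hlead', hhom, LinearMap.ker d.mulVecLin, hz, ?_⟩, ?_⟩
  · intro g hg v hv
    obtain ⟨i, hi, hpar, hle⟩ := exists_before_of_mulVec_eq_zero (isModuleOrder_pathLt p)
      (pathOrder m G (p + 1)) d pathMon pathPar hd.lead hg hv
    have hgen : pathGens m G v.2.1 = colonGens m (pathGens m G (pathPar v.2).1) (pathMon v.2) := by
      rw [path_eq_cons v.2]
      rfl
    obtain ⟨u, hu, hle'⟩ := exists_mem_colonGens (m := m) (S := pathGens m G (pathPar v.2).1)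
      ⟨pathMon i, hpar ▸ pathMon_mem i, (path_lt_iff hpar).1 hi, hle⟩
    exact ⟨pathCons v.2 u (hgen ▸ hu), Subtype.ext rfl, hle'⟩
  · ext1 i l
    exact congrFun (hz l) i

/-- Schreyer resolutions exist for ideals with a normalized Gröbner basis which is homogeneous for
the grading `W`; their differentials can be chosen homogeneous for `W`. -/
theorem exists_isSchreyerResolution [Finite σ] [Nontrivial R] {I : Ideal (MvPolynomial σ R)}
    (hG : IsAntichain (· ≤ ·) G)
    (hin : initialIdeal m I = Ideal.span ((fun s => monomial s (1 : R)) '' G))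
    (hW : ∀ u v, W u = W v → u.degree = v.degree)
    (hgen : ∀ g ∈ G, ∃ f ∈ I, IsUnit (coeff g f) ∧
      ∀ u ∈ f.support, W u = W g ∧ (u ≠ g → u ≺[m] g)) :
    ∃ F : GradedFreeComplex σ R, IsSchreyerResolution m F I ∧
      ∃ e : ∀ p, F.ι p ≃ Path m G p, ∀ p i k, ∀ u ∈ (F.d p i k).support,
        W (u + (e p i).1.sum) = W (e (p + 1) k).1.sum := by
  have : Finite G := (WellQuasiOrderedLE.finite_of_isAntichain hG).to_subtype
  choose! f hf hunit hlt using hgen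
  obtain ⟨d, hd⟩ := exists_seq_of_step
    (α := fun p => Matrix (Path m G p) (Path m G (p + 1)) (MvPolynomial σ R))
    -- The clause for `p = 0` records that the first differential has its entries in `I`; it is
    -- vacuous afterwards.
    (fun p d => IsSchreyerStage W p d ∧ ∀ i k, p = 0 → d i k ∈ I)
    (fun p d d' => d * d' = 0)
    (by
      have hmem : ∀ k : Path m G 1, pathMon k ∈ G := fun k => by
        have := pathMon_mem k
        rwa [Subsingleton.elim (pathPar k) default] at this
      have hsum : ∀ k : Path m G 1, k.1.sum = pathMon k := fun k => by
        rw [sum_path, Subsingleton.elim (pathPar k) default]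
        exact add_zero _
      refine ⟨fun _ k => f (pathMon k), ⟨fun k => ⟨hunit _ (hmem k), fun s hs hne => ?_⟩,
        fun k s hs => ?_, Submodule.pi Set.univ fun _ => I, fun k _ _ => hf _ (hmem k), ?_⟩,
        fun i k _ => hf _ (hmem k)⟩
      · refine (hlt _ (hmem k) s.1 (mem_support_iff.2 hs)).2 fun h => hne (Prod.ext h ?_)
        exact Subsingleton.elim _ _
      · rw [hsum, Subsingleton.elim s.2 default]
        refine Eq.trans ?_ (hlt _ (hmem k) s.1 (mem_support_iff.2 hs)).1
        exact congrArg W (add_zero _)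
      · intro g hg v hv
        obtain ⟨u, hu, hle⟩ := exists_le_of_isLead hin (fun i => hg i trivial) hv
        refine ⟨pathCons v.2 u ?_, Subsingleton.elim _ _, hle⟩
        rw [Subsingleton.elim v.2 default]
        exact hu)
    (fun p d hd => by
      obtain ⟨d', h1, h2⟩ := hd.1.exists_next
      exact ⟨d', ⟨h1, fun _ _ h => absurd h (Nat.succ_ne_zero p)⟩, h2⟩)
  let F : GradedFreeComplex σ R :=
    { ι := fun p => Path m G p
      fintype := inferInstance
      deg := fun p k => (k.1.sum.degree : ℕ)
      d := d
      homogeneous := fun p i k u hu => by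
        have := hW _ _ ((hd p).1.1.homogeneous k (u, i) (mem_support_iff.1 hu))
        rw [← this]
        simp
      d_mul_d := fun p => (hd p).2 }
  let S : SchreyerFrame F :=
    { order := fun p => pathOrder m G p
      mon := fun p k => pathMon k
      par := fun p k => pathPar k }
  have hS : ∀ p, S.lt m p = pathLt m G p := by
    intro p
    induction p with
    | zero => rfl
    | succ p ih =>
      change inducedOrder (S.lt m p) _ _ _ = inducedOrder (pathLt m G p) _ _ _
      rw [ih]
      rfl
  have hbefore : ∀ p (k l : F.ι (p + 1)), S.par p k = S.par p l →
      (S.before k l ↔ MonomialBefore m (S.mon p k) (S.mon p l)) := fun p k l h => path_lt_iff h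
  refine ⟨F, isSchreyerResolution_iff.2 ⟨S, ⟨?_, ?_, ?_, ?_, ?_, ?_, hbefore, ?_⟩⟩,
    fun p => Equiv.refl _, fun p i k u hu =>
      (hd p).1.1.homogeneous k (u, i) (mem_support_iff.1 hu)⟩
  · exact Nat.card_unique (α := Path m G 0)
  · intro i
    change ((Subtype.val i).sum.degree : ℤ) = 0
    rw [show i = (default : Path m G 0) from Subsingleton.elim (α := Path m G 0) _ _]
    rfl
  · exact fun i k => (hd 0).1.2 i k rfl
  · rw [hin]
    congr 1
    ext x
    constructor
    · rintro ⟨k, rfl⟩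
      refine ⟨pathMon k, ?_, rfl⟩
      have := pathMon_mem k
      rwa [Subsingleton.elim (pathPar k) default] at this
    · rintro ⟨u, hu, rfl⟩
      exact ⟨pathCons (default : Path m G 0) u hu, rfl⟩
  · intro k l hkl
    have hmem : ∀ k : Path m G 1, pathMon k ∈ G := fun k => by
      have := pathMon_mem k
      rwa [Subsingleton.elim (pathPar k) default] at this
    exact path_ext (hG.eq (hmem k) (hmem l) hkl) (Subsingleton.elim _ _)
  · intro p k
    rw [hS]
    exact (hd p).1.1.lead k
  · intro p
    have hcol : ∀ k : Path m G (p + 1), {u | Minimal (fun u => monomial u (1 : R) ∈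
        S.colonIdeal p k) u} = pathGens m G k.1 := by
      intro k
      rw [path_eq_cons k]
      have h2 : (fun u => ∃ n ∈ pathGens m G (pathPar k).1,
          MonomialBefore m n (pathMon k) ∧ n ≤ u + pathMon k) =
          fun u => monomial u (1 : R) ∈ S.colonIdeal p k := by
        funext u
        rw [S.mem_colonIdeal]
        apply propext
        constructor
        · rintro ⟨n, hn, hb, hle⟩
          exact ⟨pathCons _ n hn, (hbefore p (pathCons _ n hn) k rfl).2 hb, rfl, hle⟩
        · rintro ⟨i, hi, hp, hle⟩
          have hp' : pathPar i = pathPar k := hp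
          exact ⟨_, hp' ▸ pathMon_mem i, (hbefore p i k hp).1 hi, hle⟩
      rw [← h2]
      rfl
    refine ⟨fun l _ => ?_, fun k _ l _ h => ?_, fun q hq => ?_⟩
    · have := pathMon_mem l
      rw [← hcol] at this
      exact this
    · obtain ⟨h1, h2⟩ := Prod.mk.inj h
      exact path_ext h2 h1
    · have hq' : q.2 ∈ pathGens m G (Subtype.val q.1) := by
        rw [← hcol]
        exact hq
      exact ⟨pathCons q.1 q.2 hq', trivial, rfl⟩

end Existence

/-! ### Comparison of graded free resolutions -/

section Comparison

variable {σ : Type} {R : Type*} [CommRing R]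

/-! ### Homogeneous components and homogeneous matrices. -/

section Homogeneous

variable {ι κ μ : Type}

/-- The homogeneous component of degree `n` of an element of a graded free module whose basis has
the degrees `deg`. -/
def gradedPart (deg : ι → ℤ) (n : ℤ) (z : ι → MvPolynomial σ R) : ι → MvPolynomial σ R :=
  fun i => ∑ u ∈ (z i).support with (u.degree : ℤ) + deg i = n, monomial u (coeff u (z i))

lemma coeff_gradedPart (deg : ι → ℤ) (n : ℤ) (z : ι → MvPolynomial σ R) (i : ι) (u : σ →₀ ℕ) :
    coeff u (gradedPart deg n z i) = if (u.degree : ℤ) + deg i = n then coeff u (z i) else 0 := by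
  classical
  simp only [gradedPart, coeff_sum, coeff_monomial, Finset.sum_ite_eq', Finset.mem_filter,
    mem_support_iff]
  by_cases h : coeff u (z i) = 0 <;> simp [h]

/-- All entries are homogeneous, of the degrees for which the matrix describes a map of degree
zero. -/
def IsHomogeneousMatrix (deg : ι → ℤ) (deg' : κ → ℤ) (A : Matrix ι κ (MvPolynomial σ R)) : Prop :=
  ∀ i k, ∀ u ∈ (A i k).support, (u.degree : ℤ) + deg i = deg' k

lemma gradedPart_mulVec [Fintype κ] {deg : ι → ℤ} {deg' : κ → ℤ}
    {A : Matrix ι κ (MvPolynomial σ R)} (hA : IsHomogeneousMatrix deg deg' A) (n : ℤ)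
    (z : κ → MvPolynomial σ R) :
    gradedPart deg n (A.mulVec z) = A.mulVec (gradedPart deg' n z) := by
  classical
  funext i
  ext u
  simp only [coeff_gradedPart, Matrix.mulVec, dotProduct, coeff_sum, coeff_mul]
  have hterm : ∀ k, ∀ x ∈ Finset.HasAntidiagonal.antidiagonal u,
      coeff x.1 (A i k) * (if (x.2.degree : ℤ) + deg' k = n then coeff x.2 (z k) else 0) =
        if (u.degree : ℤ) + deg i = n then coeff x.1 (A i k) * coeff x.2 (z k) else 0 := by
    intro k x hx
    by_cases h0 : coeff x.1 (A i k) = 0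
    · simp [h0]
    · have h1 := hA i k x.1 (mem_support_iff.2 h0)
      have h2 : (u.degree : ℤ) = x.1.degree + x.2.degree := by
        rw [← Finset.HasAntidiagonal.mem_antidiagonal.1 hx]
        simp
      have h3 : (x.2.degree : ℤ) + deg' k = n ↔ (u.degree : ℤ) + deg i = n := by
        rw [h2, ← h1]
        constructor <;> intro h <;> linarith
      simp only [h3, mul_ite, mul_zero]
  rw [Finset.sum_congr rfl fun k _ => Finset.sum_congr rfl (hterm k)]
  split_ifs with h
  · rfl
  · simp

lemma gradedPart_eq_self_iff {deg : ι → ℤ} {n : ℤ} {z : ι → MvPolynomial σ R} :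
    gradedPart deg n z = z ↔ ∀ i, ∀ u ∈ (z i).support, (u.degree : ℤ) + deg i = n := by
  constructor
  · intro h i u hu
    by_contra hne
    have := coeff_gradedPart deg n z i u
    rw [if_neg hne, h] at this
    exact mem_support_iff.1 hu this
  · intro h
    funext i
    ext u
    rw [coeff_gradedPart]
    split_ifs with hu
    · rfl
    · by_contra hne
      exact hu (h i u (mem_support_iff.2 (Ne.symm hne)))

lemma isHomogeneousMatrix_iff {deg : ι → ℤ} {deg' : κ → ℤ} {A : Matrix ι κ (MvPolynomial σ R)} :
    IsHomogeneousMatrix deg deg' A ↔ ∀ k, gradedPart deg (deg' k) (A.col k) = A.col k := by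
  simp only [gradedPart_eq_self_iff]
  exact ⟨fun h k i => h i k, fun h i k => h k i⟩

lemma IsHomogeneousMatrix.mul [Fintype κ] {deg : ι → ℤ} {deg' : κ → ℤ} {deg'' : μ → ℤ}
    {A : Matrix ι κ (MvPolynomial σ R)} {B : Matrix κ μ (MvPolynomial σ R)}
    (hA : IsHomogeneousMatrix deg deg' A) (hB : IsHomogeneousMatrix deg' deg'' B) :
    IsHomogeneousMatrix deg deg'' (A * B) := by
  rw [isHomogeneousMatrix_iff] at hB ⊢
  intro k
  have : (A * B).col k = A.mulVec (B.col k) := rfl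
  rw [this, gradedPart_mulVec hA, hB]

lemma exists_mul_eq [Fintype κ] {A : Matrix ι κ (MvPolynomial σ R)}
    {B : Matrix ι μ (MvPolynomial σ R)} (h : ∀ k, B.col k ∈ Set.range A.mulVec) :
    ∃ C : Matrix κ μ (MvPolynomial σ R), A * C = B := by
  choose c hc using h
  refine ⟨fun i k => c k i, ?_⟩
  ext1 i k
  exact congrFun (hc k) i

/-- A preimage of a homogeneous column may be replaced by its component of the right degree, because
a homogeneous matrix commutes with taking components. -/
lemma exists_homogeneous_mul_eq [Fintype κ] {deg : ι → ℤ} {deg' : κ → ℤ} {deg'' : μ → ℤ}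
    {A : Matrix ι κ (MvPolynomial σ R)} {B : Matrix ι μ (MvPolynomial σ R)}
    (hA : IsHomogeneousMatrix deg deg' A) (hB : IsHomogeneousMatrix deg deg'' B)
    (h : ∀ k, B.col k ∈ Set.range A.mulVec) :
    ∃ C : Matrix κ μ (MvPolynomial σ R), IsHomogeneousMatrix deg' deg'' C ∧ A * C = B := by
  choose c hc using h
  refine ⟨fun i k => gradedPart deg' (deg'' k) (c k) i, fun i k u hu => ?_, ?_⟩
  · by_contra hne
    exact mem_support_iff.1 hu (by rw [coeff_gradedPart, if_neg hne])
  · ext1 i k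
    have h1 := gradedPart_mulVec hA (deg'' k) (c k)
    rw [hc, isHomogeneousMatrix_iff.1 hB] at h1
    exact (congrFun h1 i).symm

end Homogeneous

/-- Every homogeneous component of an element of the ideal is in the ideal. -/
def IsHomogeneousIdeal (J : Ideal (MvPolynomial σ R)) : Prop :=
  ∀ q : Unit → MvPolynomial σ R, q () ∈ J → ∀ n, gradedPart 0 n q () ∈ J

namespace GradedFreeComplex

variable {F F' : GradedFreeComplex σ R} {J : Ideal (MvPolynomial σ R)}

lemma isHomogeneousMatrix_d (F : GradedFreeComplex σ R) (p : ℕ) :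
    IsHomogeneousMatrix (F.deg p) (F.deg (p + 1)) (F.d p) := F.homogeneous p

/-- Lifting the augmentation from the quotient to polynomials makes it a homogeneous one-row matrix,
so that the same matrix lemmas apply to it as to the differentials; equalities become congruences
modulo `J`. -/
lemma IsResolution.exists_augmentation (h : F.IsResolution J) :
    ∃ a : Matrix Unit (F.ι 0) (MvPolynomial σ R), IsHomogeneousMatrix 0 (F.deg 0) a ∧
      (∀ q, ∃ z, a.mulVec z () - q ∈ J) ∧
      ∀ z, a.mulVec z () ∈ J ↔ z ∈ Set.range (F.d 0).mulVec := by
  classical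
  obtain ⟨ε, h1, h2, h3, -⟩ := h
  choose f hf hε using h1
  have hε' : ∀ z, ε z = Ideal.Quotient.mk J (∑ i, f i * z i) := by
    intro z
    have hz : z = ∑ i, z i • (Pi.single i 1 : F.ι 0 → MvPolynomial σ R) := by
      funext i
      simp [Finset.sum_apply, Pi.single_apply]
    conv_lhs => rw [hz]
    rw [map_sum, map_sum]
    refine Finset.sum_congr rfl fun i _ => ?_
    have h1 : ε (Pi.single i 1) = Ideal.Quotient.mk J (f i) := by convert hε i
    rw [map_smul ε (z i), h1, mul_comm, map_mul]
    rfl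
  refine ⟨fun _ i => f i, fun _ i u hu => by simpa using hf i u hu, fun q => ?_, fun z => ?_⟩
  · obtain ⟨z, hz⟩ := h2 (Ideal.Quotient.mk J q)
    exact ⟨z, Ideal.Quotient.eq.1 ((hε' z).symm.trans hz)⟩
  · have := h3 z
    rw [hε', Ideal.Quotient.eq_zero_iff_mem] at this
    exact this

lemma IsResolution.mem_range (h : F.IsResolution J) {p : ℕ} {z : F.ι (p + 1) → MvPolynomial σ R}
    (hz : (F.d p).mulVec z = 0) : z ∈ Set.range (F.d (p + 1)).mulVec := by
  obtain ⟨ε, -, -, -, h4⟩ := h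
  exact (h4 p z).1 hz

/-- Lifting the identity of `R[X]/J` to a homogeneous map of complexes. -/
lemma IsResolution.exists_lift (h' : F'.IsResolution J) (hJ : IsHomogeneousIdeal J)
    {a : Matrix Unit (F.ι 0) (MvPolynomial σ R)} (ha : IsHomogeneousMatrix 0 (F.deg 0) a)
    (had : ∀ z, a.mulVec ((F.d 0).mulVec z) () ∈ J)
    {a' : Matrix Unit (F'.ι 0) (MvPolynomial σ R)} (ha' : IsHomogeneousMatrix 0 (F'.deg 0) a')
    (hsurj : ∀ q, ∃ z, a'.mulVec z () - q ∈ J)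
    (hex : ∀ z, a'.mulVec z () ∈ J → z ∈ Set.range (F'.d 0).mulVec) :
    ∃ f : ∀ p, Matrix (F'.ι p) (F.ι p) (MvPolynomial σ R),
      (∀ p, IsHomogeneousMatrix (F'.deg p) (F.deg p) (f p)) ∧
      (∀ p, f p * F.d p = F'.d p * f (p + 1)) ∧
      ∀ z, a'.mulVec ((f 0).mulVec z) () - a.mulVec z () ∈ J := by
  obtain ⟨f, hf⟩ := exists_seq_of_step
    (α := fun p => Matrix (F'.ι p) (F.ι p) (MvPolynomial σ R))
    (fun p f => IsHomogeneousMatrix (F'.deg p) (F.deg p) f ∧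
      (∀ k, (f * F.d p).col k ∈ Set.range (F'.d p).mulVec) ∧
      (∀ hp : p = 0, ∀ z : F.ι 0 → MvPolynomial σ R,
        a'.mulVec (Matrix.mulVec (hp ▸ f) z) () - a.mulVec z () ∈ J))
    (fun p f f' => f * F.d p = F'.d p * f')
    (by
      -- Preimages modulo `J` of the entries of `a`, afterwards cut down to the right degree.
      -- Homogeneity of `J` ensures that the components are still preimages modulo `J`.
      choose c hc using fun k => hsurj (a () k)
      set f : Matrix (F'.ι 0) (F.ι 0) (MvPolynomial σ R) :=
        fun i k => gradedPart (F'.deg 0) (F.deg 0 k) (c k) i with hf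
      have hcol : ∀ k, a'.mulVec (f.col k) () - a () k ∈ J := by
        intro k
        have h1 := hJ (fun _ => a'.mulVec (c k) () - a () k) (hc k) (F.deg 0 k)
        have h2 : gradedPart 0 (F.deg 0 k) (fun _ : Unit => a'.mulVec (c k) () - a () k) =
            gradedPart 0 (F.deg 0 k) (a'.mulVec (c k)) - gradedPart 0 (F.deg 0 k) (a.col k) := by
          funext i
          ext u
          simp only [Pi.sub_apply, coeff_sub, coeff_gradedPart]
          split_ifs <;> simp
        rw [h2, gradedPart_mulVec ha', isHomogeneousMatrix_iff.1 ha] at h1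
        exact h1
      have hz : ∀ z, a'.mulVec (f.mulVec z) () - a.mulVec z () ∈ J := by
        intro z
        have : a'.mulVec (f.mulVec z) () - a.mulVec z () =
            ∑ k, (a'.mulVec (f.col k) () - a () k) * z k := by
          rw [Matrix.mulVec_mulVec]
          simp only [Matrix.mulVec, dotProduct, sub_mul, Finset.sum_sub_distrib]
          rfl
        rw [this]
        exact J.sum_mem fun k _ => J.mul_mem_right _ (hcol k)
      refine ⟨f, fun i k u hu => ?_, fun k => hex _ ?_, fun _ => hz⟩
      · by_contra hne
        exact mem_support_iff.1 hu (by rw [hf, coeff_gradedPart, if_neg hne])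
      · classical
        have h1 := hz ((F.d 0).mulVec (Pi.single k 1))
        have h2 := J.add_mem h1 (had (Pi.single k 1))
        have h3 : (f * F.d 0).col k = f.mulVec ((F.d 0).mulVec (Pi.single k 1)) := by
          rw [Matrix.mulVec_mulVec, Matrix.mulVec_single_one]
        rwa [sub_add_cancel, ← h3] at h2)
    (fun p f hf => by
      obtain ⟨f', hf', hff'⟩ := exists_homogeneous_mul_eq (F'.isHomogeneousMatrix_d p)
        (hf.1.mul (F.isHomogeneousMatrix_d p)) hf.2.1
      refine ⟨f', ⟨hf', fun k => h'.mem_range ?_, fun hp => absurd hp (Nat.succ_ne_zero p)⟩,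
        hff'.symm⟩
      have : (F'.d p).mulVec ((f' * F.d (p + 1)).col k) =
          (F'.d p * (f' * F.d (p + 1))).col k := rfl
      rw [this, ← Matrix.mul_assoc, hff', Matrix.mul_assoc, F.d_mul_d, Matrix.mul_zero]
      rfl)
  exact ⟨f, fun p => (hf p).1.1, fun p => (hf p).2, (hf 0).1.2.2 rfl⟩

/-- A self-map of a minimal resolution which is homotopic to zero has no constant terms. -/
lemma IsResolution.constantCoeff_eq_zero (h : F.IsResolution J) (hmin : F.IsMinimal)
    (ψ : ∀ p, Matrix (F.ι p) (F.ι p) (MvPolynomial σ R))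
    (hψ : ∀ p, ψ p * F.d p = F.d p * ψ (p + 1))
    (h0 : ∀ k, (ψ 0).col k ∈ Set.range (F.d 0).mulVec) (p : ℕ) :
    (ψ p).map constantCoeff = 0 := by
  -- `s` is a null-homotopy, built by lifting through the exact complex: ψ_0 = d s_0 and ψ_{p+1} = d
  -- s_{p+1} + s_p d. Every summand has a factor `d`, whose constant terms vanish by minimality.
  obtain ⟨s, hs⟩ := exists_seq_of_step
    (α := fun p => Matrix (F.ι (p + 1)) (F.ι p) (MvPolynomial σ R))
    (fun p s => (∀ k, (ψ (p + 1) - s * F.d p).col k ∈ Set.range (F.d (p + 1)).mulVec) ∧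
      (p = 0 → (ψ p).map constantCoeff = 0))
    (fun p s s' => ψ (p + 1) - s * F.d p = F.d (p + 1) * s')
    (by
      obtain ⟨s, hs⟩ := exists_mul_eq h0
      refine ⟨s, fun k => h.mem_range ?_, fun _ => ?_⟩
      · have : (F.d 0).mulVec ((ψ 1 - s * F.d 0).col k) =
            (F.d 0 * (ψ 1 - s * F.d 0)).col k := rfl
        rw [this, Matrix.mul_sub, ← Matrix.mul_assoc, hs, ← hψ, sub_self]
        rfl
      · have h1 : (F.d 0).map constantCoeff = 0 := by
          ext1 i k
          exact hmin 0 i k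
        rw [← hs, Matrix.map_mul, h1, Matrix.zero_mul])
    (fun p s hs => by
      obtain ⟨s', hs'⟩ := exists_mul_eq hs.1
      refine ⟨s', ⟨fun k => h.mem_range ?_, fun hp => absurd hp (Nat.succ_ne_zero p)⟩, hs'.symm⟩
      have : (F.d (p + 1)).mulVec ((ψ (p + 2) - s' * F.d (p + 1)).col k) =
          (F.d (p + 1) * (ψ (p + 2) - s' * F.d (p + 1))).col k := rfl
      rw [this, Matrix.mul_sub, ← Matrix.mul_assoc, hs', ← hψ, Matrix.sub_mul, Matrix.mul_assoc s,
        F.d_mul_d, Matrix.mul_zero, sub_zero, sub_self]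
      rfl)
  have hd : ∀ p, (F.d p).map constantCoeff = 0 := fun p => by
    ext1 i k
    exact hmin p i k
  cases p with
  | zero => exact (hs 0).1.2 rfl
  | succ p =>
    have h1 : ψ (p + 1) = F.d (p + 1) * s (p + 1) + s p * F.d p :=
      eq_add_of_sub_eq (hs p).2
    rw [h1, Matrix.map_add _ (map_add _), Matrix.map_mul, Matrix.map_mul, hd, hd,
      Matrix.zero_mul, Matrix.mul_zero, add_zero]

open Classical in
/-- The constant terms of the comparison maps between two resolutions. -/
theorem IsResolution.exists_comparison (hJ : IsHomogeneousIdeal J) (h : F.IsResolution J)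
    (h' : F'.IsResolution J) :
    ∃ (A : ∀ p, Matrix (F'.ι p) (F.ι p) R) (B : ∀ p, Matrix (F.ι p) (F'.ι p) R),
      (∀ p i k, A p i k ≠ 0 → F'.deg p i = F.deg p k) ∧
      (∀ p i k, B p i k ≠ 0 → F.deg p i = F'.deg p k) ∧
      (∀ p, A p * (F.d p).map constantCoeff = (F'.d p).map constantCoeff * A (p + 1)) ∧
      (F.IsMinimal → ∀ p, B p * A p = 1) ∧ (F'.IsMinimal → ∀ p, A p * B p = 1) := by
  obtain ⟨a, ha, hsurj, hex⟩ := h.exists_augmentation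
  obtain ⟨a', ha', hsurj', hex'⟩ := h'.exists_augmentation
  obtain ⟨f, hf, hfd, hfa⟩ := h'.exists_lift hJ ha (fun z => (hex _).2 ⟨z, rfl⟩) ha' hsurj'
    (fun z => (hex' z).1)
  obtain ⟨g, hg, hgd, hga⟩ := h.exists_lift hJ ha' (fun z => (hex' _).2 ⟨z, rfl⟩) ha hsurj
    (fun z => (hex z).1)
  have hconst : ∀ {ι κ : Type} {deg : ι → ℤ} {deg' : κ → ℤ} {A : Matrix ι κ (MvPolynomial σ R)}
      (_ : IsHomogeneousMatrix deg deg' A) (i k), A.map constantCoeff i k ≠ 0 →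
      deg i = deg' k := by
    intro ι κ deg deg' A hA i k hne
    have := hA i k 0 (mem_support_iff.2 hne)
    simpa using this
  -- The composite `g f - 1` lifts the zero map of the quotient, hence is null-homotopic, and has no
  -- constant terms once `F₁` is minimal.
  have hone : ∀ (F₁ F₂ : GradedFreeComplex σ R) (f : ∀ p, Matrix (F₂.ι p) (F₁.ι p) _)
      (g : ∀ p, Matrix (F₁.ι p) (F₂.ι p) _) (a : Matrix Unit (F₁.ι 0) (MvPolynomial σ R))
      (a' : Matrix Unit (F₂.ι 0) (MvPolynomial σ R)), F₁.IsResolution J → F₁.IsMinimal →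
      (∀ p, f p * F₁.d p = F₂.d p * f (p + 1)) → (∀ p, g p * F₂.d p = F₁.d p * g (p + 1)) →
      (∀ z, a'.mulVec ((f 0).mulVec z) () - a.mulVec z () ∈ J) →
      (∀ z, a.mulVec ((g 0).mulVec z) () - a'.mulVec z () ∈ J) →
      (∀ z, a.mulVec z () ∈ J ↔ z ∈ Set.range (F₁.d 0).mulVec) →
      ∀ p, (g p).map constantCoeff * (f p).map constantCoeff = 1 := by
    intro F₁ F₂ f g a a' h₁ hmin hfd hgd hfa hga hex p
    have h1 := h₁.constantCoeff_eq_zero hmin (fun p => g p * f p - 1) (fun p => by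
      rw [Matrix.sub_mul, Matrix.mul_assoc, hfd, ← Matrix.mul_assoc, hgd, Matrix.mul_sub,
        Matrix.mul_assoc, Matrix.one_mul, Matrix.mul_one]) (fun k => (hex _).1 (by
      have h2 := J.add_mem (hga ((f 0).mulVec (Pi.single k 1))) (hfa (Pi.single k 1))
      have h3 : a.mulVec ((g 0 * f 0 - 1).col k) () =
          a.mulVec ((g 0).mulVec ((f 0).mulVec (Pi.single k 1))) () -
            a'.mulVec ((f 0).mulVec (Pi.single k 1)) () +
          (a'.mulVec ((f 0).mulVec (Pi.single k 1)) () - a.mulVec (Pi.single k 1) ()) := by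
        rw [sub_add_sub_cancel, ← Matrix.mulVec_single_one, Matrix.sub_mulVec, Matrix.one_mulVec,
          Matrix.mulVec_sub, ← Matrix.mulVec_mulVec]
        rfl
      rwa [h3])) p
    rw [Matrix.map_sub _ (map_sub _), Matrix.map_mul, Matrix.map_one _ (map_zero _) (map_one _)]
      at h1
    exact sub_eq_zero.1 h1
  refine ⟨fun p => (f p).map constantCoeff, fun p => (g p).map constantCoeff,
    fun p => hconst (hf p), fun p => hconst (hg p), fun p => ?_,
    fun hmin => hone F F' f g a a' h hmin hfd hgd hfa hga hex,
    fun hmin => hone F' F g f a' a h' hmin hgd hfd hga hfa hex'⟩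
  rw [← Matrix.map_mul, ← Matrix.map_mul, hfd]

/-- A resolution with the same ranks as a minimal one is minimal. -/
theorem IsResolution.isMinimal_of_card_eq (hJ : IsHomogeneousIdeal J) (h : F.IsResolution J)
    (h' : F'.IsMinimalResolution J) (hcard : ∀ p, Nat.card (F.ι p) = Nat.card (F'.ι p)) :
    F.IsMinimal := by
  classical
  obtain ⟨A, B, -, -, hA, -, hAB⟩ := h.exists_comparison hJ h'.1
  -- Equal ranks make the one-sided inverse two-sided. Writing d_0 and d_0' for the constant parts,
  -- d_0 = B A d_0 = B d_0' A = 0.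
  have hBA : ∀ p, B p * A p = 1 := fun p => by
    have hc : Fintype.card (F'.ι p) = Fintype.card (F.ι p) := by
      rw [← Nat.card_eq_fintype_card, ← Nat.card_eq_fintype_card, hcard]
    exact (Matrix.mul_eq_one_comm_of_card_eq _ _ _ hc).1 (by convert hAB h'.2 p)
  intro p i k
  have h1 : (F'.d p).map constantCoeff = 0 := by
    ext1 i k
    exact h'.2 p i k
  have h2 : (F.d p).map constantCoeff = 0 := by
    rw [← Matrix.one_mul ((F.d p).map _), ← hBA, Matrix.mul_assoc, hA, h1, Matrix.zero_mul,
      Matrix.mul_zero]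
  exact congrFun (congrFun h2 i) k

/-- Minimal graded free resolutions have the same terms. -/
theorem IsMinimalResolution.exists_equiv [Nontrivial R] (hJ : IsHomogeneousIdeal J)
    (h : F.IsMinimalResolution J) (h' : F'.IsMinimalResolution J) (p : ℕ) :
    ∃ e : F.ι p ≃ F'.ι p, ∀ i, F'.deg p (e i) = F.deg p i := by
  classical
  obtain ⟨A, B, hA, hB, -, hBA, hAB⟩ := h.1.exists_comparison hJ h'.1
  -- The constant matrices only join basis elements of equal degree, so a product equal to 1
  -- restricts to the blocks of each degree. Mutually inverse blocks over a nontrivial commutative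
  -- ring are square, which counts the basis elements degree by degree.
  have key : ∀ {ι κ : Type} [Fintype ι] [Fintype κ] {deg : ι → ℤ} {deg' : κ → ℤ}
      {A : Matrix ι κ R} {B : Matrix κ ι R} (_ : ∀ i k, A i k ≠ 0 → deg i = deg' k) (j : ℤ),
      A * B = 1 → A.submatrix (fun i : {i // deg i = j} => i.1) (fun k : {k // deg' k = j} => k.1) *
        B.submatrix (fun k : {k // deg' k = j} => k.1) (fun i : {i // deg i = j} => i.1) = 1 := by
    intro ι κ _ _ deg deg' A B hA j hAB
    ext1 i i'
    have h1 := congrFun (congrFun hAB i.1) i'.1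
    rw [Matrix.mul_apply] at h1 ⊢
    rw [Matrix.one_apply] at h1 ⊢
    simp only [Subtype.ext_iff, Matrix.submatrix_apply]
    rw [← h1]
    refine Fintype.sum_of_injective Subtype.val Subtype.val_injective _ _ (fun k hk => ?_)
      fun k => rfl
    by_cases h0 : A i.1 k = 0
    · simp [h0]
    · exact absurd ⟨⟨k, (hA i.1 k h0).symm.trans i.2⟩, rfl⟩ hk
  have hcard : ∀ j, Nonempty ({i // F.deg p i = j} ≃ {i // F'.deg p i = j}) := by
    intro j
    have := Matrix.square_of_invertible _ _ (key (hA p) j (by convert hAB h'.2 p))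
      (key (hB p) j (by convert hBA h.2 p))
    exact ⟨(Fintype.equivOfCardEq this).symm⟩
  exact ⟨Equiv.ofFiberEquiv fun j => (hcard j).some, fun i => Equiv.ofFiberEquiv_map _ i⟩

end GradedFreeComplex

end Comparison

/-! ### Comparison of monomials of degree two -/

section Pairs

variable {σ : Type} [LinearOrder σ] [Fintype σ]

/-- The exponent vector of the variable `X v`. -/
abbrev ex (v : σ) : σ →₀ ℕ := Finsupp.single v 1

lemma pair_lt_of_lt {k l v w : σ} (hkl : k ≤ l) (hvw : v ≤ w) (h : w < l ∨ w = l ∧ v < k) :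
    (ex k + ex l) ≺[degRevLex σ] (ex v + ex w) := by
  rw [degRevLex_lt_iff]
  right
  refine ⟨by simp, ?_⟩
  rcases h with h | ⟨rfl, h⟩
  · refine ⟨l, ?_, fun j hj => ?_⟩
    · simp [Finsupp.single_apply, h.ne, (hvw.trans_lt h).ne]
    · simp [(hkl.trans_lt hj).ne, hj.ne, (h.trans hj).ne,
        (hvw.trans_lt (h.trans hj)).ne]
  · refine ⟨k, ?_, fun j hj => ?_⟩
    · simp [Finsupp.single_apply, h.ne]
    · simp [Finsupp.single_apply, hj.ne, (h.trans hj).ne]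

/-- Among quadrics the sort order compares the later variable first and then the other one. This
turns every question about earlier generators into arithmetic of positions. -/
lemma monomialBefore_pair_iff {k l v w : σ} (hkl : k ≤ l) (hvw : v ≤ w) :
    MonomialBefore (degRevLex σ) (ex k + ex l) (ex v + ex w) ↔ l < w ∨ l = w ∧ k < v := by
  have hdeg : ∀ k l : σ, (ex k + ex l).degree = 2 := fun k l => by simp
  simp only [MonomialBefore, hdeg, lt_irrefl, false_or, true_and]
  constructor
  · intro h
    by_contra hcon
    have h' : w < l ∨ w = l ∧ (v < k ∨ v = k) := by
      rcases lt_trichotomy l w with h1 | h1 | h1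
      · exact absurd (Or.inl h1) hcon
      · rcases lt_trichotomy k v with h2 | h2 | h2
        · exact absurd (Or.inr ⟨h1, h2⟩) hcon
        · exact Or.inr ⟨h1.symm, Or.inr h2.symm⟩
        · exact Or.inr ⟨h1.symm, Or.inl h2⟩
      · exact Or.inl h1
    rcases h' with h' | ⟨rfl, h' | rfl⟩
    · exact lt_asymm h (pair_lt_of_lt hkl hvw (Or.inl h'))
    · exact lt_asymm h (pair_lt_of_lt hkl hvw (Or.inr ⟨rfl, h'⟩))
    · exact lt_irrefl _ h
  · exact pair_lt_of_lt hvw hkl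

omit [LinearOrder σ] [Fintype σ] in
lemma pair_le_of_ne {v w : σ} (hvw : v ≠ w) {u : σ →₀ ℕ} (hv : u v ≠ 0) (hw : u w ≠ 0) :
    ex v + ex w ≤ u := by
  classical
  intro s
  simp only [Finsupp.add_apply, Finsupp.single_apply]
  split_ifs with h1 h2 h2
  · exact absurd (h1.trans h2.symm) hvw
  · subst h1; omega
  · subst h2; omega
  · omega

omit [LinearOrder σ] [Fintype σ] in
lemma pair_le_of_two_le {v : σ} {u : σ →₀ ℕ} (hv : 2 ≤ u v) : ex v + ex v ≤ u := by
  classical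
  intro s
  simp only [Finsupp.add_apply, Finsupp.single_apply]
  split_ifs with h1
  · subst h1; omega
  · omega

end Pairs

/-! ### The variables of the carpet -/

section Variables

variable {a b : ℕ}

/-- The position of a variable in the list `x_0, …, x_a, y_0, …, y_b`. -/
def pos (v : Var a b) : ℕ := Sum.elim (fun i : Fin (a + 1) => i.val) (fun j => a + 1 + j.val) (ofLex v)

@[simp] lemma pos_inl (i : Fin (a + 1)) : pos (Sum.inlₗ i : Var a b) = i := rfl

@[simp] lemma pos_inr (j : Fin (b + 1)) : pos (Sum.inrₗ j : Var a b) = a + 1 + j := rfl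

lemma var_cases {P : Var a b → Prop} (hx : ∀ i, P (Sum.inlₗ i)) (hy : ∀ j, P (Sum.inrₗ j))
    (v : Var a b) : P v := by
  obtain ⟨v, rfl⟩ := toLex.surjective v
  cases v with
  | inl i => exact hx i
  | inr j => exact hy j

lemma pos_strictMono : StrictMono (pos : Var a b → ℕ) := by
  intro v w h
  induction v using var_cases with
  | hx i =>
    induction w using var_cases with
    | hx j =>
      have : i < j := Sum.Lex.inl_lt_inl_iff.1 h
      exact this
    | hy j =>
      have := i.2
      simp only [pos_inl, pos_inr]
      omega
  | hy i =>
    induction w using var_cases with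
    | hx j => exact absurd h Sum.Lex.not_inr_lt_inl
    | hy j =>
      have : i < j := Sum.Lex.inr_lt_inr_iff.1 h
      simpa using this

lemma pos_lt_iff {v w : Var a b} : pos v < pos w ↔ v < w := pos_strictMono.lt_iff_lt

lemma pos_le_iff {v w : Var a b} : pos v ≤ pos w ↔ v ≤ w := pos_strictMono.le_iff_le

lemma pos_inj {v w : Var a b} : pos v = pos w ↔ v = w := pos_strictMono.injective.eq_iff

lemma pos_lt (v : Var a b) : pos v < a + b + 2 := by
  induction v using var_cases with
  | hx i => have := i.2; simp only [pos_inl]; omega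
  | hy i => have := i.2; simp only [pos_inr]; omega

lemma exists_pos_eq {n : ℕ} (hn : n < a + b + 2) : ∃ v : Var a b, pos v = n := by
  by_cases h : n < a + 1
  · exact ⟨Sum.inlₗ ⟨n, h⟩, rfl⟩
  · refine ⟨Sum.inrₗ ⟨n - (a + 1), by omega⟩, ?_⟩
    simp only [pos_inr]
    omega

/-- The exponents of the monomials `X v * X w`, `v ≤ w`, where the positions of the variables
satisfy the relation `Q`. -/
def quad (a b : ℕ) (Q : ℕ → ℕ → Prop) : Set (Var a b →₀ ℕ) :=
  {e | ∃ v w : Var a b, v ≤ w ∧ Q (pos v) (pos w) ∧ e = ex v + ex w}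

/-- The positions of the variables in the generators of the initial ideal of the carpet. -/
def QF (a b k l : ℕ) : Prop :=
  (1 ≤ k ∧ k ≤ l ∧ l + 1 ≤ a) ∨ (2 ≤ k ∧ k ≤ a ∧ a + 1 ≤ l ∧ l + 1 ≤ a + b) ∨
    (a + 2 ≤ k ∧ k ≤ l ∧ l ≤ a + b)

/-- The positions of the variables in the generators of `J_G`. -/
def QG (a b k l : ℕ) : Prop := QF a b k l ∧ k ≠ a + b

/-- The positions of the variables in the generators of `J_H`. -/
def QH (a k l : ℕ) : Prop := (1 ≤ k ∧ k ≤ l ∧ l + 1 ≤ a) ∨ (2 ≤ k ∧ k ≤ a ∧ l = a + 1)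

lemma degree_of_mem_quad {Q : ℕ → ℕ → Prop} {e : Var a b →₀ ℕ} (he : e ∈ quad a b Q) :
    e.degree = 2 := by
  obtain ⟨v, w, -, -, rfl⟩ := he
  simp

lemma eq_of_le_of_degree_eq {σ : Type} [Fintype σ] {e e' : σ →₀ ℕ} (h : e ≤ e')
    (hd : e.degree = e'.degree) : e = e' := by
  have h1 : e' = e + (e' - e) := (add_tsub_cancel_of_le h).symm
  have h2 : (e' - e).degree = 0 := by
    have := congrArg Finsupp.degree h1
    rw [map_add] at this
    omega
  rw [(Finsupp.degree_eq_zero_iff _).1 h2, add_zero] at h1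
  exact h1.symm

lemma isAntichain_quad (Q : ℕ → ℕ → Prop) : IsAntichain (· ≤ ·) (quad a b Q) := by
  intro e he e' he' hne hle
  exact hne (eq_of_le_of_degree_eq hle ((degree_of_mem_quad he).trans (degree_of_mem_quad he').symm))

end Variables

/-! ### The Gröbner basis of the carpet ideal -/

section StandardMonomials

/-- The exponent sequence of a monomial in `x_0, …, x_N` which is divisible by none of the
`x_i x_j`, `1 ≤ i ≤ j < N`. -/
structure IsStandardSeq (N : ℕ) (f : Fin (N + 1) → ℕ) : Prop where
  ne : ∀ i j, 1 ≤ i.val → i < j → j.val < N → f i = 0 ∨ f j = 0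
  le : ∀ i, 1 ≤ i.val → i.val < N → f i ≤ 1

/-- A standard monomial is x_0^p x_N^q times at most one inner variable x_k, so its weight is N q +
k with k < N. The value k = 0 encodes the absence of an inner variable, which is why `c` vanishes
there. -/
lemma IsStandardSeq.exists_eq {N : ℕ} (hN : 2 ≤ N) {f : Fin (N + 1) → ℕ} (hf : IsStandardSeq N f) :
    ∃ (k : Fin (N + 1)) (p q c : ℕ), k.val < N ∧ c = (if k.val = 0 then 0 else 1) ∧
      (∀ i, f i = (if i = 0 then p else 0) + (if i = Fin.last N then q else 0) +
        if i = k then c else 0) ∧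
      ∑ i, f i = p + q + c ∧ ∑ i, i.val * f i = N * q + k := by
  have hl : (0 : Fin (N + 1)) ≠ Fin.last N := by
    intro h
    have := congrArg Fin.val h
    simp at this
    omega
  obtain ⟨k, c, hk, hc, hfk⟩ : ∃ (k : Fin (N + 1)) (c : ℕ), k.val < N ∧
      c = (if k.val = 0 then 0 else 1) ∧ ∀ i, 1 ≤ i.val → i.val < N → f i = if i = k then c else 0 := by
    by_cases h : ∃ k : Fin (N + 1), 1 ≤ k.val ∧ k.val < N ∧ f k ≠ 0
    · obtain ⟨k, h1, h2, h3⟩ := h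
      refine ⟨k, 1, h2, by rw [if_neg (by omega)], fun i hi1 hi2 => ?_⟩
      split_ifs with hik
      · subst hik
        have := hf.le i hi1 hi2
        omega
      · rcases lt_or_gt_of_ne hik with hlt | hlt
        · exact (hf.ne i k hi1 hlt h2).resolve_right h3
        · exact (hf.ne k i h1 hlt hi2).resolve_left h3
    · push Not at h
      exact ⟨0, 0, by simp; omega, by simp, fun i hi1 hi2 => by simp [h i hi1 hi2]⟩
  have hfi : ∀ i, f i = (if i = 0 then f 0 else 0) + (if i = Fin.last N then f (Fin.last N) else 0) +
      if i = k then c else 0 := by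
    intro i
    by_cases h0 : i = 0
    · subst h0
      rw [if_pos rfl, if_neg hl]
      split_ifs with h
      · subst h
        simp [hc]
      · rfl
    · by_cases h1 : i = Fin.last N
      · subst h1
        have : Fin.last N ≠ k := by
          rintro rfl
          simp at hk
        simp [h0, this]
      · have h2 : 1 ≤ i.val := by
          by_contra h2
          exact h0 (Fin.ext (by rw [Fin.val_zero]; omega))
        have h3 : i.val < N := by
          by_contra h3
          exact h1 (Fin.ext (by rw [Fin.val_last]; omega))
        simp [h0, h1, hfk i h2 h3]
  refine ⟨k, f 0, f (Fin.last N), c, hk, hc, hfi, ?_, ?_⟩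
  · rw [Finset.sum_congr rfl fun i _ => hfi i]
    simp only [Finset.sum_add_distrib, Finset.sum_ite_eq', Finset.mem_univ, if_true]
  · rw [Finset.sum_congr rfl fun i _ => congrArg (i.val * ·) (hfi i)]
    simp only [mul_add, mul_ite, mul_zero, Finset.sum_add_distrib, Finset.sum_ite_eq',
      Finset.mem_univ, if_true, Fin.val_last, Fin.val_zero, zero_mul, zero_add]
    rw [hc]
    split_ifs with h <;> simp [h]

/-- Euclidean division of the weight by N recovers k and q; the degree then gives p. -/
lemma IsStandardSeq.ext {N : ℕ} (hN : 2 ≤ N) {f g : Fin (N + 1) → ℕ} (hf : IsStandardSeq N f)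
    (hg : IsStandardSeq N g) (h1 : ∑ i, f i = ∑ i, g i)
    (h2 : ∑ i, i.val * f i = ∑ i, i.val * g i) : f = g := by
  obtain ⟨k, p, q, c, hk, hc, hf, hf1, hf2⟩ := hf.exists_eq hN
  obtain ⟨k', p', q', c', hk', hc', hg, hg1, hg2⟩ := hg.exists_eq hN
  rw [hf2, hg2] at h2
  rw [hf1, hg1] at h1
  have hkk : k.val = k'.val := by
    have := congrArg (· % N) h2
    simpa [Nat.mod_eq_of_lt hk, Nat.mod_eq_of_lt hk'] using this
  have hqq : q = q' := by
    rw [hkk] at h2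
    exact Nat.eq_of_mul_eq_mul_left (by omega) (Nat.add_right_cancel h2)
  obtain rfl := Fin.ext hkk
  obtain rfl : c = c' := hc.trans hc'.symm
  obtain rfl : p = p' := by omega
  funext i
  rw [hf, hg, hqq]

/-- Only x_0 and x_1 can occur, and x_1 at most once. -/
lemma IsStandardSeq.weight_le_one {N : ℕ} (hN : 2 ≤ N) {f : Fin (N + 1) → ℕ}
    (hf : IsStandardSeq N f) (h : ∀ i, 2 ≤ i.val → f i = 0) : ∑ i, i.val * f i ≤ 1 := by
  obtain ⟨k, p, q, c, hk, hc, hfi, -, hf2⟩ := hf.exists_eq hN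
  have hq : q = 0 := by
    have h1 := hfi (Fin.last N)
    rw [h _ (by simpa using hN)] at h1
    simp at h1
    omega
  rw [hf2, hq, mul_zero, zero_add]
  by_contra hk2
  have h1 := hfi k
  rw [h k (by omega)] at h1
  rw [if_neg (by omega)] at hc
  simp at h1
  omega

/-- Only x_N and at most one factor x_{N-1} can occur, so the weight misses its maximal value by at
most one. -/
lemma IsStandardSeq.le_weight {N : ℕ} (hN : 2 ≤ N) {f : Fin (N + 1) → ℕ}
    (hf : IsStandardSeq N f) (h : ∀ i, i.val + 2 ≤ N → f i = 0) :
    N * ∑ i, f i ≤ ∑ i, i.val * f i + 1 := by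
  obtain ⟨k, p, q, c, hk, hc, hfi, hf1, hf2⟩ := hf.exists_eq hN
  have hp : p = 0 := by
    have h1 := hfi 0
    rw [h _ (by simpa using hN)] at h1
    simp at h1
    omega
  rw [hf1, hf2, hp, zero_add, mul_add]
  by_cases hk0 : k.val = 0
  · rw [hc, if_pos hk0]
    omega
  · rw [if_neg hk0] at hc
    have : N ≤ k.val + 1 := by
      by_contra hk2
      have h1 := hfi k
      rw [h k (by omega)] at h1
      simp at h1
      omega
    rw [hc, mul_one]
    omega

lemma weight_le {N : ℕ} (f : Fin (N + 1) → ℕ) : ∑ i, i.val * f i ≤ N * ∑ i, f i := by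
  rw [Finset.mul_sum]
  exact Finset.sum_le_sum fun i _ => Nat.mul_le_mul_right _ (by omega)

variable {a b : ℕ}

/-- The total degree in `x_0, …, x_a`. -/
def xDeg (u : Var a b →₀ ℕ) : ℕ := ∑ i, u (Sum.inlₗ i)

/-- The total degree in `y_0, …, y_b`. -/
def yDeg (u : Var a b →₀ ℕ) : ℕ := ∑ j, u (Sum.inrₗ j)

/-- The sum of the indices of the `x`-variables. -/
def xWeight (u : Var a b →₀ ℕ) : ℕ := ∑ i : Fin (a + 1), i.val * u (Sum.inlₗ i)

/-- The sum of the indices of the `y`-variables. -/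
def yWeight (u : Var a b →₀ ℕ) : ℕ := ∑ j : Fin (b + 1), j.val * u (Sum.inrₗ j)

/-- The monomial is not divisible by any of the lead monomials. -/
def IsStandard (u : Var a b →₀ ℕ) : Prop := ∀ e ∈ quad a b (QF a b), ¬ e ≤ u

lemma IsStandard.eq_zero_or {u : Var a b →₀ ℕ} (hu : IsStandard u) {v w : Var a b} (hvw : v < w)
    (hQ : QF a b (pos v) (pos w)) : u v = 0 ∨ u w = 0 := by
  by_contra! h
  exact hu _ ⟨v, w, hvw.le, hQ, rfl⟩ (pair_le_of_ne hvw.ne h.1 h.2)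

lemma IsStandard.le_one {u : Var a b →₀ ℕ} (hu : IsStandard u) {v : Var a b}
    (hQ : QF a b (pos v) (pos v)) : u v ≤ 1 := by
  by_contra! h
  exact hu _ ⟨v, v, le_rfl, hQ, rfl⟩ (pair_le_of_two_le h)

lemma IsStandard.x {u : Var a b →₀ ℕ} (hu : IsStandard u) :
    IsStandardSeq a fun i => u (Sum.inlₗ i) where
  ne i j h1 h2 h3 := hu.eq_zero_or (Sum.Lex.inl_lt_inl_iff.2 h2) (Or.inl (by
    simp only [pos_inl]
    have : i.val < j.val := h2
    omega))
  le i h1 h2 := hu.le_one (Or.inl (by simp only [pos_inl]; omega))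

lemma IsStandard.y {u : Var a b →₀ ℕ} (hu : IsStandard u) :
    IsStandardSeq b fun i => u (Sum.inrₗ i) where
  ne i j h1 h2 h3 := hu.eq_zero_or (Sum.Lex.inr_lt_inr_iff.2 h2) (Or.inr (Or.inr (by
    simp only [pos_inr]
    have : i.val < j.val := h2
    omega)))
  le i h1 h2 := hu.le_one (Or.inr (Or.inr (by simp only [pos_inr]; omega)))

lemma IsStandard.xy {u : Var a b →₀ ℕ} (hu : IsStandard u) :
    (∀ i : Fin (a + 1), 2 ≤ i.val → u (Sum.inlₗ i) = 0) ∨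
      ∀ j : Fin (b + 1), j.val + 2 ≤ b → u (Sum.inrₗ j) = 0 := by
  by_contra! h
  obtain ⟨⟨i, hi, hi'⟩, j, hj, hj'⟩ := h
  have := hu.eq_zero_or (v := Sum.inlₗ i) (w := Sum.inrₗ j) (Sum.Lex.inl_lt_inr _ _)
    (Or.inr (Or.inl (by
      have := i.2
      simp only [pos_inl, pos_inr]
      omega)))
  exact this.elim hi' hj'

lemma IsStandard.eq_of_weights (ha : 2 ≤ a) (hb : 2 ≤ b) {u u' : Var a b →₀ ℕ} (hu : IsStandard u)
    (hu' : IsStandard u') (hx : xDeg u = xDeg u') (hy : yDeg u = yDeg u')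
    (hw : xWeight u + yWeight u = xWeight u' + yWeight u') (hJ : yWeight u = yWeight u') :
    u = u' := by
  have h1 := hu.x.ext ha hu'.x hx (by unfold xWeight at hw; omega)
  have h2 := hu.y.ext hb hu'.y hy hJ
  ext v
  induction v using var_cases with
  | hx i => exact congrFun h1 i
  | hy j => exact congrFun h2 j

/-- By `IsStandard.xy`, either the x-weight of `u'` is at most 1, or its y-weight is within 1 of the
maximum for its y-degree. In both cases little y-weight can be gained while the total weight is
fixed. Applied in both directions, this leaves at most two y-weights for standard monomials with the
same image exponent. -/
lemma IsStandard.yWeight_le (ha : 2 ≤ a) (hb : 2 ≤ b) {u u' : Var a b →₀ ℕ}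
    (hu' : IsStandard u') (hy : yDeg u = yDeg u')
    (hw : xWeight u + yWeight u = xWeight u' + yWeight u') : yWeight u ≤ yWeight u' + 1 := by
  have h3 : yWeight u ≤ b * yDeg u := weight_le _
  rcases hu'.xy with h | h
  · have h1 : xWeight u' ≤ 1 := hu'.x.weight_le_one ha h
    omega
  · have h2 : b * yDeg u' ≤ yWeight u' + 1 := hu'.y.le_weight hb h
    rw [hy] at h3
    omega

end StandardMonomials

/-! ### The parametrization over the dual numbers and the initial ideals. -/

section Groebner

variable {R : Type*} [CommRing R] {a b : ℕ}

lemma prod_monomial {σ κ : Type*} {A : Type*} [CommSemiring A] (s : Finset κ) (f : κ → σ →₀ ℕ)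
    (c : κ → A) : ∏ i ∈ s, monomial (f i) (c i) = monomial (∑ i ∈ s, f i) (∏ i ∈ s, c i) := by
  classical
  induction s using Finset.induction_on with
  | empty => rfl
  | insert i s hi ih => rw [Finset.prod_insert hi, ih, monomial_mul, Finset.sum_insert hi,
      Finset.prod_insert hi]

lemma prod_var {M : Type*} [CommMonoid M] (f : Var a b → M) :
    ∏ v, f v = (∏ i, f (Sum.inlₗ i)) * ∏ j, f (Sum.inrₗ j) := by
  rw [← Equiv.prod_comp toLex f, Fintype.prod_sum_type]

variable (R) in
/-- The element `1 + ε` of the dual numbers. -/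
def onePlusEps : DualNumber R := 1 + DualNumber.eps

lemma onePlusEps_sub_one_sq : (onePlusEps R - 1) * (onePlusEps R - 1) = 0 := by
  rw [onePlusEps, add_sub_cancel_left, DualNumber.eps_mul_eps]

lemma fst_onePlusEps : (onePlusEps R).fst = 1 := by
  simp [onePlusEps]

lemma snd_onePlusEps : (onePlusEps R).snd = 1 := by
  simp [onePlusEps]

variable (R a b) in
/-- The parametrization `x_i ↦ U t^i`, `y_j ↦ V t^j (1 + ε)^j` of the carpet. -/
def carpetHom : MvPolynomial (Var a b) R →ₐ[R] MvPolynomial (Fin 3) (DualNumber R) :=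
  aeval fun v => Sum.elim
    (fun i : Fin (a + 1) => monomial (Finsupp.single 0 1 + Finsupp.single 2 i.val) 1)
    (fun j : Fin (b + 1) => monomial (Finsupp.single 1 1 + Finsupp.single 2 j.val)
      (onePlusEps R ^ j.val)) (ofLex v)

lemma carpetHom_xVar (i : Fin (a + 1)) : carpetHom R a b (xVar R i) =
    monomial (Finsupp.single 0 1 + Finsupp.single 2 i.val) 1 := by
  rw [carpetHom, xVar, aeval_X]
  rfl

lemma carpetHom_yVar (j : Fin (b + 1)) : carpetHom R a b (yVar R j) =
    monomial (Finsupp.single 1 1 + Finsupp.single 2 j.val) (onePlusEps R ^ j.val) := by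
  rw [carpetHom, yVar, aeval_X]
  rfl

/-- The exponent of the image of a monomial. -/
def carpetDeg (u : Var a b →₀ ℕ) : Fin 3 →₀ ℕ :=
  Finsupp.single 0 (xDeg u) + Finsupp.single 1 (yDeg u) + Finsupp.single 2 (xWeight u + yWeight u)

lemma carpetDeg_eq_iff {u u' : Var a b →₀ ℕ} : carpetDeg u = carpetDeg u' ↔
    xDeg u = xDeg u' ∧ yDeg u = yDeg u' ∧
      xWeight u + yWeight u = xWeight u' + yWeight u' := by
  constructor
  · intro h
    have h0 := DFunLike.congr_fun h 0
    have h1 := DFunLike.congr_fun h 1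
    have h2 := DFunLike.congr_fun h 2
    simp [carpetDeg] at h0 h1 h2
    exact ⟨h0, h1, h2⟩
  · rintro ⟨h0, h1, h2⟩
    rw [carpetDeg, carpetDeg, h0, h1, h2]

lemma carpetHom_monomial (u : Var a b →₀ ℕ) (c : R) : carpetHom R a b (monomial u c) =
    monomial (carpetDeg u) (algebraMap R (DualNumber R) c * onePlusEps R ^ yWeight u) := by
  rw [carpetHom, aeval_monomial, Finsupp.prod_fintype _ _ (fun _ => pow_zero _), prod_var]
  have h1 : ∀ i : Fin (a + 1), (Sum.elim
      (fun i : Fin (a + 1) => monomial (Finsupp.single 0 1 + Finsupp.single 2 i.val) 1)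
      (fun j : Fin (b + 1) => monomial (Finsupp.single 1 1 + Finsupp.single 2 j.val)
        (onePlusEps R ^ j.val)) (ofLex (Sum.inlₗ i)) : MvPolynomial (Fin 3) (DualNumber R)) ^
      u (Sum.inlₗ i) = monomial (u (Sum.inlₗ i) • (Finsupp.single 0 1 + Finsupp.single 2 i.val))
        1 := fun i => by
    change (monomial _ 1) ^ _ = _
    rw [monomial_pow, one_pow]
  have h2 : ∀ j : Fin (b + 1), (Sum.elim
      (fun i : Fin (a + 1) => monomial (Finsupp.single 0 1 + Finsupp.single 2 i.val) 1)
      (fun j : Fin (b + 1) => monomial (Finsupp.single 1 1 + Finsupp.single 2 j.val)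
        (onePlusEps R ^ j.val)) (ofLex (Sum.inrₗ j)) : MvPolynomial (Fin 3) (DualNumber R)) ^
      u (Sum.inrₗ j) = monomial (u (Sum.inrₗ j) • (Finsupp.single 1 1 + Finsupp.single 2 j.val))
        (onePlusEps R ^ (j.val * u (Sum.inrₗ j))) := fun j => by
    change (monomial _ _) ^ _ = _
    rw [monomial_pow, pow_mul]
  rw [Finset.prod_congr rfl fun i _ => h1 i, Finset.prod_congr rfl fun j _ => h2 j, prod_monomial,
    prod_monomial, monomial_mul, Finset.prod_const_one, one_mul, Finset.prod_pow_eq_pow_sum]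
  have h3 : algebraMap R (MvPolynomial (Fin 3) (DualNumber R)) c =
      monomial 0 (algebraMap R (DualNumber R) c) := rfl
  have h4 : ∑ i : Fin (a + 1), u (Sum.inlₗ i) • (Finsupp.single 0 1 + Finsupp.single 2 i.val) +
      ∑ j : Fin (b + 1), u (Sum.inrₗ j) • (Finsupp.single 1 1 + Finsupp.single 2 j.val) =
      (carpetDeg u : Fin 3 →₀ ℕ) := by
    ext i
    fin_cases i <;>
      simp [carpetDeg, xDeg, yDeg, xWeight, yWeight, mul_comm]
  rw [h3, monomial_mul, zero_add, h4]
  rfl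

lemma coeff_carpetHom (f : MvPolynomial (Var a b) R) (δ : Fin 3 →₀ ℕ) :
    coeff δ (carpetHom R a b f) = ∑ u ∈ f.support with carpetDeg u = δ,
      algebraMap R (DualNumber R) (coeff u f) * onePlusEps R ^ yWeight u := by
  classical
  conv_lhs => rw [f.as_sum]
  simp only [map_sum, carpetHom_monomial, coeff_sum, coeff_monomial, Finset.sum_filter]

/-- The parametrization is injective on the span of the standard monomials. -/
lemma eq_zero_of_carpetHom_eq_zero (ha : 2 ≤ a) (hb : 2 ≤ b) {r : MvPolynomial (Var a b) R}
    (hr : ∀ u ∈ r.support, IsStandard u) (h0 : carpetHom R a b r = 0) : r = 0 := by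
  classical
  by_contra hne
  obtain ⟨u₀, hu₀⟩ := support_nonempty.2 hne
  set s := r.support.filter fun u => carpetDeg u = carpetDeg u₀ with hs
  have hmem : ∀ u ∈ s, u ∈ r.support ∧ carpetDeg u = carpetDeg u₀ := fun u hu =>
    Finset.mem_filter.1 hu
  have hsum := coeff_carpetHom r (carpetDeg u₀)
  rw [h0, coeff_zero, ← hs] at hsum
  -- Since (1 + ε)^n = 1 + n ε, one coefficient of the image yields two equations, from its constant
  -- part and from its ε-part.
  have h1 : ∑ u ∈ s, coeff u r = 0 := by
    have := congrArg TrivSqZeroExt.fst hsum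
    rw [TrivSqZeroExt.fst_sum] at this
    simpa [fst_onePlusEps, TrivSqZeroExt.algebraMap_eq_inl'] using this.symm
  have h2 : ∑ u ∈ s, coeff u r * yWeight u = 0 := by
    have := congrArg TrivSqZeroExt.snd hsum
    rw [TrivSqZeroExt.snd_sum] at this
    simpa [fst_onePlusEps, snd_onePlusEps, TrivSqZeroExt.algebraMap_eq_inl'] using this.symm
  have hinj : ∀ u ∈ s, ∀ u' ∈ s, yWeight u = yWeight u' → u = u' := by
    intro u hu u' hu' hJ
    obtain ⟨h3, h4, h5⟩ := carpetDeg_eq_iff.1 ((hmem u hu).2.trans (hmem u' hu').2.symm)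
    exact (hr u (hmem u hu).1).eq_of_weights ha hb (hr u' (hmem u' hu').1) h3 h4 h5 hJ
  have hle : ∀ u ∈ s, ∀ u' ∈ s, yWeight u ≤ yWeight u' + 1 := by
    intro u hu u' hu'
    obtain ⟨-, h4, h5⟩ := carpetDeg_eq_iff.1 ((hmem u hu).2.trans (hmem u' hu').2.symm)
    exact IsStandard.yWeight_le ha hb (hr u' (hmem u' hu').1) h4 h5
  have hu₀s : u₀ ∈ s := Finset.mem_filter.2 ⟨hu₀, rfl⟩
  apply mem_support_iff.1 hu₀
  -- Pairwise distinct weights with pairwise differences at most 1 leave at most two monomials, of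
  -- consecutive weights n and n + 1. The system with rows (1, 1) and (n, n + 1) has determinant 1,
  -- so it forces zero coefficients in every characteristic.
  by_cases hex : ∃ u₁ ∈ s, u₁ ≠ u₀
  · obtain ⟨u₁, hu₁, hne₁⟩ := hex
    have hs' : s = {u₀, u₁} := by
      ext u
      rw [Finset.mem_insert, Finset.mem_singleton]
      constructor
      · intro hu
        by_contra! hcon
        have e1 := mt (hinj u hu u₀ hu₀s) hcon.1
        have e2 := mt (hinj u hu u₁ hu₁) hcon.2
        have e3 := mt (hinj u₁ hu₁ u₀ hu₀s) hne₁
        have := hle u hu u₀ hu₀s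
        have := hle u hu u₁ hu₁
        have := hle u₁ hu₁ u₀ hu₀s
        have := hle u₁ hu₁ u hu
        have := hle u₀ hu₀s u hu
        have := hle u₀ hu₀s u₁ hu₁
        omega
      · rintro (rfl | rfl)
        · exact hu₀s
        · exact hu₁
    rw [hs', Finset.sum_pair hne₁.symm] at h1 h2
    have e3 := mt (hinj u₁ hu₁ u₀ hu₀s) hne₁
    have e4 := hle u₁ hu₁ u₀ hu₀s
    have e5 := hle u₀ hu₀s u₁ hu₁
    rcases (by omega : yWeight u₁ = yWeight u₀ + 1 ∨ yWeight u₀ = yWeight u₁ + 1) with h | h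
    · rw [h] at h2
      push_cast at h2
      linear_combination ((yWeight u₀ : R) + 1) * h1 - h2
    · rw [h] at h2
      push_cast at h2
      linear_combination h2 - (yWeight u₁ : R) * h1
  · push Not at hex
    have hs' : s = {u₀} := Finset.eq_singleton_iff_unique_mem.2 ⟨hu₀s, hex⟩
    rwa [hs', Finset.sum_singleton] at h1

/-- In a minor both products have the same image. In a mixed form the three products share one
exponent, and their coefficients add up to a multiple of 1 - 2(1 + ε) + (1 + ε)² = ε² = 0. -/
lemma carpetHom_eq_zero {f : MvPolynomial (Var a b) R} (hf : f ∈ carpetIdeal R a b) :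
    carpetHom R a b f = 0 := by
  have : carpetIdeal R a b ≤ RingHom.ker (carpetHom R a b) := by
    refine sup_le (sup_le ?_ ?_) ?_
    · refine Ideal.span_le.2 ?_
      rintro f ⟨c, rfl⟩
      rw [SetLike.mem_coe, RingHom.mem_ker, Matrix.det_fin_two]
      simp only [MX, Matrix.submatrix_apply, Matrix.of_apply, Matrix.cons_val_zero,
        Matrix.cons_val_one, id, map_sub, map_mul, carpetHom_xVar, monomial_mul, Fin.val_castSucc,
        Fin.val_succ]
      rw [sub_eq_zero]
      congr 2
      rw [Finsupp.single_add, Finsupp.single_add]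
      abel
    · refine Ideal.span_le.2 ?_
      rintro f ⟨c, rfl⟩
      rw [SetLike.mem_coe, RingHom.mem_ker, Matrix.det_fin_two]
      simp only [MY, Matrix.submatrix_apply, Matrix.of_apply, Matrix.cons_val_zero,
        Matrix.cons_val_one, id, map_sub, map_mul, carpetHom_yVar, monomial_mul, Fin.val_castSucc,
        Fin.val_succ]
      rw [sub_eq_zero]
      congr 1
      · rw [Finsupp.single_add, Finsupp.single_add]
        congr 1
        abel
      · ring
    · refine Ideal.span_le.2 ?_
      rintro f ⟨i, j, hi, hj, rfl⟩
      rw [SetLike.mem_coe, RingHom.mem_ker]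
      simp only [map_add, map_sub, map_mul, carpetHom_xVar, carpetHom_yVar, map_ofNat, mul_assoc,
        monomial_mul, one_mul]
      have h1 : (Finsupp.single 0 1 + Finsupp.single 2 (i + 2) +
          (Finsupp.single 1 1 + Finsupp.single 2 j) : Fin 3 →₀ ℕ) =
          Finsupp.single 0 1 + Finsupp.single 1 1 + Finsupp.single 2 (i + j + 2) := by
        simp only [Finsupp.single_add]
        abel
      have h2 : (Finsupp.single 0 1 + Finsupp.single 2 (i + 1) +
          (Finsupp.single 1 1 + Finsupp.single 2 (j + 1)) : Fin 3 →₀ ℕ) =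
          Finsupp.single 0 1 + Finsupp.single 1 1 + Finsupp.single 2 (i + j + 2) := by
        rw [show i + j + 2 = (i + 1) + (j + 1) by ring]
        simp only [Finsupp.single_add]
        abel
      have h3 : (Finsupp.single 0 1 + Finsupp.single 2 i +
          (Finsupp.single 1 1 + Finsupp.single 2 (j + 2)) : Fin 3 →₀ ℕ) =
          Finsupp.single 0 1 + Finsupp.single 1 1 + Finsupp.single 2 (i + j + 2) := by
        simp only [Finsupp.single_add]
        abel
      rw [h1, h2, h3, two_mul, ← map_add, ← map_sub, ← map_add]
      refine (congrArg (monomial _) ?_).trans (map_zero _)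
      linear_combination onePlusEps R ^ j * onePlusEps_sub_one_sq (R := R)
  exact this hf

lemma xVar_mul_xVar (i j : Fin (a + 1)) : (xVar R i * xVar R j : MvPolynomial (Var a b) R) =
    monomial (ex (Sum.inlₗ i) + ex (Sum.inlₗ j)) 1 := by
  simp [xVar, X, monomial_mul]

lemma xVar_mul_yVar (i : Fin (a + 1)) (j : Fin (b + 1)) :
    (xVar R i * yVar R j : MvPolynomial (Var a b) R) =
      monomial (ex (Sum.inlₗ i) + ex (Sum.inrₗ j)) 1 := by
  simp [xVar, yVar, X, monomial_mul]

lemma yVar_mul_yVar (i j : Fin (b + 1)) : (yVar R i * yVar R j : MvPolynomial (Var a b) R) =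
    monomial (ex (Sum.inrₗ i) + ex (Sum.inrₗ j)) 1 := by
  simp [yVar, X, monomial_mul]

/-- Every monomial `x_i x_j`, `x_i y_j`, `y_i y_j` in question is the lead monomial of an element of
the carpet ideal. -/
lemma exists_lead_of_mem_quad [Nontrivial R] {e : Var a b →₀ ℕ} (he : e ∈ quad a b (QF a b)) :
    ∃ f ∈ carpetIdeal R a b, coeff e f = 1 ∧
      ∀ u ∈ f.support, u.degree = e.degree ∧ (u ≠ e → u ≺[degRevLex (Var a b)] e) := by
  classical
  -- One shape covers both kinds of generators: a mixed form uses c₁ = 2 and c₂ = 1, a minor c₁ = 1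
  -- and c₂ = 0.
  have key : ∀ (e₁ e₂ : Var a b →₀ ℕ) (c₁ c₂ : R), e₁.degree = e.degree → e₂.degree = e.degree →
      e₁ ≺[degRevLex (Var a b)] e → e₂ ≺[degRevLex (Var a b)] e →
      monomial e 1 - monomial e₁ c₁ + monomial e₂ c₂ ∈ carpetIdeal R a b →
      ∃ f ∈ carpetIdeal R a b, coeff e f = 1 ∧
        ∀ u ∈ f.support, u.degree = e.degree ∧ (u ≠ e → u ≺[degRevLex (Var a b)] e) := by
    intro e₁ e₂ c₁ c₂ hd₁ hd₂ h₁ h₂ hmem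
    have hn₁ : e₁ ≠ e := by rintro rfl; exact lt_irrefl _ h₁
    have hn₂ : e₂ ≠ e := by rintro rfl; exact lt_irrefl _ h₂
    refine ⟨_, hmem, by simp [coeff_monomial, hn₁, hn₂], fun u hu => ?_⟩
    have : u = e ∨ u = e₁ ∨ u = e₂ := by
      by_contra! h
      rw [mem_support_iff] at hu
      simp [coeff_monomial, h.1.symm, h.2.1.symm, h.2.2.symm] at hu
    rcases this with rfl | rfl | rfl
    · exact ⟨rfl, fun h => absurd rfl h⟩
    · exact ⟨hd₁, fun _ => h₁⟩
    · exact ⟨hd₂, fun _ => h₂⟩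
  have hdeg : ∀ v w : Var a b, (ex v + ex w).degree = 2 := fun v w => by simp
  obtain ⟨v, w, hvw, hQ, rfl⟩ := he
  induction v using var_cases with
  | hx i =>
    induction w using var_cases with
    | hx j =>
      have hi := i.2
      have hj := j.2
      have hQ' : 1 ≤ i.val ∧ i.val ≤ j.val ∧ j.val + 1 ≤ a := by
        simp only [QF, pos_inl] at hQ
        omega
      let i' : Fin a := ⟨i - 1, by omega⟩
      let j' : Fin a := ⟨j, by omega⟩
      have hlt := pair_lt_of_lt (σ := Var a b) (k := Sum.inlₗ i'.castSucc) (l := Sum.inlₗ j'.succ)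
        (pos_le_iff.1 (by simp [i', j']; omega)) hvw
        (Or.inl (pos_lt_iff.1 (by simp [j'])))
      refine key _ _ 1 0 (by rw [hdeg, hdeg]) (by rw [hdeg, hdeg]) hlt hlt ?_
      rw [monomial_zero, add_zero, ← xVar_mul_xVar, ← xVar_mul_xVar]
      -- Columns `j` and `i - 1`, in this order, give x_i x_j - x_{i-1} x_{j+1} with coefficient +1
      -- on the lead monomial.
      refine Ideal.mem_sup_left (Ideal.mem_sup_left (Ideal.subset_span ⟨![j', i'], ?_⟩))
      rw [Matrix.det_fin_two]
      have h1 : i'.succ = i := Fin.ext (by simp [i']; omega)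
      have h2 : j'.castSucc = j := rfl
      simp [MX, h1, h2, mul_comm]
    | hy j =>
      have hi := i.2
      have hj := j.2
      have hQ' : 2 ≤ i.val ∧ j.val + 2 ≤ b := by
        simp only [QF, pos_inl, pos_inr] at hQ
        omega
      have hlt₁ := pair_lt_of_lt (σ := Var a b) (k := Sum.inlₗ ⟨i - 2 + 1, by omega⟩)
        (l := Sum.inrₗ ⟨j + 1, by omega⟩) (Sum.Lex.inl_lt_inr _ _).le hvw
        (Or.inl (pos_lt_iff.1 (by simp)))
      have hlt₂ := pair_lt_of_lt (σ := Var a b) (k := Sum.inlₗ ⟨i - 2, by omega⟩)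
        (l := Sum.inrₗ ⟨j + 2, by omega⟩) (Sum.Lex.inl_lt_inr _ _).le hvw
        (Or.inl (pos_lt_iff.1 (by simp)))
      refine key _ _ 2 1 (by rw [hdeg, hdeg]) (by rw [hdeg, hdeg]) hlt₁ hlt₂ ?_
      rw [← mul_one (2 : R), ← C_mul_monomial, ← xVar_mul_yVar, ← xVar_mul_yVar, ← xVar_mul_yVar]
      refine Ideal.mem_sup_right (Ideal.subset_span ⟨i - 2, j, by omega, hQ'.2, ?_⟩)
      have h1 : (⟨i - 2 + 2, by omega⟩ : Fin (a + 1)) = i := Fin.ext (by simp; omega)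
      rw [h1, mul_assoc]
      rfl
  | hy i =>
    induction w using var_cases with
    | hx j => exact absurd hvw Sum.Lex.not_inr_le_inl
    | hy j =>
      have hi := i.2
      have hj := j.2
      have hQ' : 1 ≤ i.val ∧ i.val ≤ j.val ∧ j.val + 1 ≤ b := by
        simp only [QF, pos_inr] at hQ
        omega
      let i' : Fin b := ⟨i - 1, by omega⟩
      let j' : Fin b := ⟨j, by omega⟩
      have hlt := pair_lt_of_lt (σ := Var a b) (k := Sum.inrₗ i'.castSucc) (l := Sum.inrₗ j'.succ)
        (pos_le_iff.1 (by simp [i', j']; omega)) hvw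
        (Or.inl (pos_lt_iff.1 (by simp [j'])))
      refine key _ _ 1 0 (by rw [hdeg, hdeg]) (by rw [hdeg, hdeg]) hlt hlt ?_
      rw [monomial_zero, add_zero, ← yVar_mul_yVar, ← yVar_mul_yVar]
      refine Ideal.mem_sup_left (Ideal.mem_sup_right (Ideal.subset_span ⟨![j', i'], ?_⟩))
      rw [Matrix.det_fin_two]
      have h1 : i'.succ = i := Fin.ext (by simp [i']; omega)
      have h2 : j'.castSucc = j := rfl
      simp [MY, h1, h2, mul_comm]

lemma degree_eq_of_lead {σ : Type*} (m : MonomialOrder σ) {f : MvPolynomial σ R} {e : σ →₀ ℕ}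
    (he : coeff e f ≠ 0) (hlt : ∀ u ∈ f.support, u ≠ e → u ≺[m] e) : m.degree f = e := by
  by_contra h
  have h0 : f ≠ 0 := by
    rintro rfl
    simp at he
  exact absurd (m.le_degree (mem_support_iff.2 he)) (not_le.2 (hlt _ (m.degree_mem_support h0) h))

/-- The initial ideal of the carpet ideal. -/
theorem initialIdeal_carpetIdeal [Nontrivial R] (ha : 2 ≤ a) (hb : 2 ≤ b) :
    initialIdeal (degRevLex (Var a b)) (carpetIdeal R a b) =
      Ideal.span ((fun s => monomial s (1 : R)) '' quad a b (QF a b)) := by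
  classical
  set m := degRevLex (Var a b)
  apply le_antisymm
  · refine Ideal.span_le.2 ?_
    rintro _ ⟨f, hf, rfl⟩
    rw [SetLike.mem_coe]
    by_cases hf0 : f = 0
    · rw [hf0, m.leadingTerm_zero]
      exact Ideal.zero_mem _
    -- Dividing `f` by these elements of the ideal leaves a remainder that is standard and lies in
    -- the ideal, hence is zero by the parametrization.
    let B : Set (MvPolynomial (Var a b) R) := {f | f ∈ carpetIdeal R a b ∧
      IsUnit (m.leadingCoeff f) ∧ m.degree f ∈ quad a b (QF a b)}
    obtain ⟨g, r, hfr, hdeg, hr⟩ := MonomialOrder.div_set (m := m) (B := B) (fun _ hq => hq.2.1) f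
    have hsum : Finsupp.linearCombination _ (fun q : B => (q : MvPolynomial (Var a b) R)) g ∈
        carpetIdeal R a b := by
      rw [Finsupp.linearCombination_apply]
      exact Ideal.sum_mem _ fun q _ => Ideal.mul_mem_left _ _ q.2.1
    have hrI : r ∈ carpetIdeal R a b := by
      rw [hfr] at hf
      exact (Ideal.add_mem_iff_right _ hsum).1 hf
    have hr0 : r = 0 := by
      refine eq_zero_of_carpetHom_eq_zero ha hb (fun u hu e he hle => ?_) (carpetHom_eq_zero hrI)
      obtain ⟨f', hf', h1, h2⟩ := exists_lead_of_mem_quad (R := R) he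
      have hd := degree_eq_of_lead m (h1 ▸ one_ne_zero) fun u hu => (h2 u hu).2
      refine hr u hu f' ⟨hf', ?_, hd ▸ he⟩ (hd ▸ hle)
      rw [MonomialOrder.leadingCoeff, hd, h1]
      exact isUnit_one
    rw [hr0, add_zero, Finsupp.linearCombination_apply, Finsupp.sum] at hfr
    -- The lead monomial of `f` occurs in some summand, and no summand exceeds it, so it is the lead
    -- monomial of that summand and divisible by the lead monomial of `q`.
    obtain ⟨q, -, hq⟩ : ∃ q ∈ g.support, coeff (m.degree f) (g q • (q : MvPolynomial _ R)) ≠ 0 := by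
      by_contra! hcon
      apply m.coeff_degree_ne_zero_iff.2 hf0
      refine (congrArg (coeff (m.degree f)) hfr).trans ?_
      rw [coeff_sum]
      exact Finset.sum_eq_zero hcon
    rw [smul_eq_mul, mul_comm] at hq
    have hle := m.le_degree (mem_support_iff.2 hq)
    have heq : m.degree f = m.degree ((q : MvPolynomial _ R) * g q) :=
      m.toSyn.injective (le_antisymm hle (hdeg q))
    have hg0 : g q ≠ 0 := by
      intro h
      rw [h, mul_zero, coeff_zero] at hq
      exact hq rfl
    rw [m.degree_mul_of_isRegular_left q.2.2.1.isRegular hg0] at heq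
    refine (monomial_mem_span_iff (m.leadingCoeff_ne_zero_iff.2 hf0)).2 ⟨_, q.2.2.2, ?_⟩
    rw [heq]
    exact le_self_add
  · refine Ideal.span_le.2 ?_
    rintro _ ⟨e, he, rfl⟩
    obtain ⟨f', hf', h1, h2⟩ := exists_lead_of_mem_quad (R := R) he
    have hd := degree_eq_of_lead m (h1 ▸ one_ne_zero) fun u hu => (h2 u hu).2
    refine Ideal.subset_span ⟨f', hf', ?_⟩
    rw [MonomialOrder.leadingTerm, MonomialOrder.leadingCoeff, hd, h1]

/-- A monomial ideal is its own initial ideal. -/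
lemma initialIdeal_span_monomial [Nontrivial R] {σ : Type} (m : MonomialOrder σ)
    (T : Set (σ →₀ ℕ)) :
    initialIdeal m (Ideal.span ((fun s => monomial s (1 : R)) '' T)) =
      Ideal.span ((fun s => monomial s (1 : R)) '' T) := by
  apply le_antisymm
  · refine Ideal.span_le.2 ?_
    rintro _ ⟨f, hf, rfl⟩
    by_cases hf0 : f = 0
    · rw [hf0, m.leadingTerm_zero]
      exact Ideal.zero_mem _
    · exact (monomial_mem_span_iff (m.leadingCoeff_ne_zero_iff.2 hf0)).2
        (mem_ideal_span_monomial_image.1 hf _ (m.degree_mem_support hf0))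
  · refine Ideal.span_le.2 ?_
    rintro _ ⟨e, he, rfl⟩
    refine Ideal.subset_span ⟨monomial e 1, Ideal.subset_span ⟨e, he, rfl⟩, ?_⟩
    rw [m.leadingTerm_monomial]

lemma isHomogeneousIdeal_span_monomial {σ : Type} (T : Set (σ →₀ ℕ)) :
    IsHomogeneousIdeal (Ideal.span ((fun s => monomial s (1 : R)) '' T)) := by
  intro q hq n
  rw [mem_ideal_span_monomial_image] at hq ⊢
  intro u hu
  refine hq u (mem_support_iff.2 fun h => ?_)
  rw [mem_support_iff, coeff_gradedPart, h, ite_self] at hu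
  exact hu rfl

lemma idealG_eq : idealG R a b =
    Ideal.span ((fun s => monomial s (1 : R)) '' quad a b (QG a b)) := by
  rw [idealG]
  congr 1
  ext f
  constructor
  · rintro ((⟨i, j, h1, h2, h3, rfl⟩ | ⟨i, j, h1, h2, rfl⟩) | ⟨i, j, h1, h2, h3, h4, rfl⟩)
    · have h2' : i.val ≤ j.val := h2
      refine ⟨_, ⟨Sum.inlₗ i, Sum.inlₗ j, Sum.Lex.inl_le_inl_iff.2 h2, ?_, rfl⟩,
        (xVar_mul_xVar i j).symm⟩
      simp only [QG, QF, pos_inl]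
      omega
    · have := i.2
      refine ⟨_, ⟨Sum.inlₗ i, Sum.inrₗ j, (Sum.Lex.inl_lt_inr _ _).le, ?_, rfl⟩,
        (xVar_mul_yVar i j).symm⟩
      simp only [QG, QF, pos_inl, pos_inr]
      omega
    · have h2' : i.val ≤ j.val := h2
      refine ⟨_, ⟨Sum.inrₗ i, Sum.inrₗ j, Sum.Lex.inr_le_inr_iff.2 h2, ?_, rfl⟩,
        (yVar_mul_yVar i j).symm⟩
      simp only [QG, QF, pos_inr]
      omega
  · rintro ⟨_, ⟨v, w, hvw, hQ, rfl⟩, rfl⟩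
    induction v using var_cases with
    | hx i =>
      have := i.2
      induction w using var_cases with
      | hx j =>
        have := j.2
        simp only [QG, QF, pos_inl] at hQ
        exact Or.inl (Or.inl ⟨i, j, by omega, Sum.Lex.inl_le_inl_iff.1 hvw, by omega,
          (xVar_mul_xVar i j).symm⟩)
      | hy j =>
        simp only [QG, QF, pos_inl, pos_inr] at hQ
        exact Or.inl (Or.inr ⟨i, j, by omega, by omega, (xVar_mul_yVar i j).symm⟩)
    | hy i =>
      induction w using var_cases with
      | hx j => exact absurd hvw Sum.Lex.not_inr_le_inl
      | hy j =>
        simp only [QG, QF, pos_inr] at hQ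
        exact Or.inr ⟨i, j, by omega, Sum.Lex.inr_le_inr_iff.1 hvw, by omega, by omega,
          (yVar_mul_yVar i j).symm⟩

lemma idealH_eq : idealH R a b =
    Ideal.span ((fun s => monomial s (1 : R)) '' quad a b (QH a)) := by
  rw [idealH]
  congr 1
  ext f
  constructor
  · rintro (⟨i, j, h1, h2, h3, rfl⟩ | ⟨i, h1, rfl⟩)
    · have h2' : i.val ≤ j.val := h2
      refine ⟨_, ⟨Sum.inlₗ i, Sum.inlₗ j, Sum.Lex.inl_le_inl_iff.2 h2, ?_, rfl⟩,
        (xVar_mul_xVar i j).symm⟩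
      simp only [QH, pos_inl]
      omega
    · have := i.2
      refine ⟨_, ⟨Sum.inlₗ i, Sum.inrₗ 0, (Sum.Lex.inl_lt_inr _ _).le, ?_, rfl⟩,
        (xVar_mul_yVar i 0).symm⟩
      exact Or.inr ⟨h1, Nat.lt_succ_iff.1 i.2, rfl⟩
  · rintro ⟨_, ⟨v, w, hvw, hQ, rfl⟩, rfl⟩
    induction v using var_cases with
    | hx i =>
      have := i.2
      induction w using var_cases with
      | hx j =>
        have := j.2
        simp only [QH, pos_inl] at hQ
        exact Or.inl ⟨i, j, by omega, Sum.Lex.inl_le_inl_iff.1 hvw, by omega,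
          (xVar_mul_xVar i j).symm⟩
      | hy j =>
        simp only [QH, pos_inl, pos_inr] at hQ
        obtain rfl : j = 0 := Fin.ext (by rw [Fin.val_zero]; omega)
        exact Or.inr ⟨i, by omega, (xVar_mul_yVar i 0).symm⟩
    | hy i =>
      induction w using var_cases with
      | hx j => exact absurd hvw Sum.Lex.not_inr_le_inl
      | hy j =>
        simp only [QH, pos_inr] at hQ
        omega

end Groebner

/-! ### The generating function of the paths -/

section PathSeries

variable {σ : Type} {m : MonomialOrder σ} {S : Set (σ →₀ ℕ)}

/-- The last entry of the list is the first step of the path; removing it replaces the starting set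
by its colon at that generator. -/
lemma pathGens_append (g : σ →₀ ℕ) (l : List (σ →₀ ℕ)) :
    pathGens m S (l ++ [g]) = pathGens m (colonGens m S g) l := by
  induction l with
  | nil => rfl
  | cons h l ih => rw [List.cons_append, pathGens, ih, pathGens]

lemma isPath_append (g : σ →₀ ℕ) (l : List (σ →₀ ℕ)) :
    IsPath m S (l ++ [g]) ↔ g ∈ S ∧ IsPath m (colonGens m S g) l := by
  induction l with
  | nil => rfl
  | cons h l ih =>
    rw [List.cons_append, IsPath, ih, IsPath, pathGens_append]
    tauto

/-- Splitting off the first step of a path. -/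
lemma bijective_append (p : ℕ) : Function.Bijective
    (fun x : Σ g : S, Path m (colonGens m S g) p =>
      (⟨x.2.1 ++ [x.1.1], by rw [List.length_append, x.2.2.1]; rfl,
        (isPath_append _ _).2 ⟨x.1.2, x.2.2.2⟩⟩ : Path m S (p + 1))) := by
  constructor
  · rintro ⟨⟨g, hg⟩, ⟨l, hl, hl'⟩⟩ ⟨⟨h, hh⟩, ⟨l', hl₁, hl₂⟩⟩ heq
    have h1 := List.append_inj' (congrArg Subtype.val heq) rfl
    obtain ⟨rfl, h2⟩ := h1
    obtain rfl : g = h := by simpa using h2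
    rfl
  · rintro ⟨l, hl, hl'⟩
    have hne : l ≠ [] := by
      rintro rfl
      simp at hl
    have h1 := List.dropLast_append_getLast hne
    rw [← h1, isPath_append] at hl'
    exact ⟨⟨⟨_, hl'.1⟩, ⟨l.dropLast, by simp [hl], hl'.2⟩⟩, Subtype.ext h1⟩

variable (m S) in
/-- The generating function of the degrees of the paths of length `p`. -/
def pathPoly (p : ℕ) : Polynomial ℤ := ∑ᶠ k : Path m S p, Polynomial.X ^ k.1.sum.degree

variable (m S) in
/-- The generating function of the lengths and degrees of all paths. -/
def pathSeries : PowerSeries (Polynomial ℤ) := PowerSeries.mk (pathPoly m S)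

lemma pathPoly_zero : pathPoly m S 0 = 1 := by
  rw [pathPoly, finsum_unique]
  change Polynomial.X ^ ((0 : σ →₀ ℕ).degree) = 1
  simp

lemma pathPoly_succ [Finite σ] {κ : Type*} (s : Finset κ) (f : κ → σ →₀ ℕ)
    (hf : Set.InjOn f s) (hS : S = f '' s) (p : ℕ) : pathPoly m S (p + 1) =
      ∑ i ∈ s, Polynomial.X ^ (f i).degree * pathPoly m (colonGens m S (f i)) p := by
  classical
  have hfin : Finite S := by
    rw [hS]
    infer_instance
  let e : s ≃ S := Equiv.ofBijective (fun i => ⟨f i, hS ▸ ⟨i, i.2, rfl⟩⟩)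
    ⟨fun i j h => Subtype.ext (hf i.2 j.2 (congrArg Subtype.val h)), fun g => by
      obtain ⟨g, hg⟩ := g
      rw [hS] at hg
      obtain ⟨i, hi, rfl⟩ := hg
      exact ⟨⟨i, hi⟩, rfl⟩⟩
  have : Fintype S := Fintype.ofFinite S
  rw [pathPoly, finsum_eq_sum_of_fintype,
    ← Fintype.sum_bijective _ (bijective_append p)
      (fun x => Polynomial.X ^ (x.2.1.sum + x.1.1).degree) _ (fun x => by simp),
    Fintype.sum_sigma, ← Equiv.sum_comp e, ← Finset.sum_coe_sort s]
  refine Finset.sum_congr rfl fun i _ => ?_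
  rw [pathPoly, finsum_eq_sum_of_fintype, Finset.mul_sum]
  refine Finset.sum_congr rfl fun k _ => ?_
  change Polynomial.X ^ (k.1.sum + f i).degree = _
  rw [map_add, pow_add, mul_comm]

/-- Sorting the paths by their first step gives the recursion on which the whole count rests: one
factor X for the length and one power of the polynomial variable for the degree of that step. -/
lemma pathSeries_eq [Finite σ] {κ : Type*} (s : Finset κ) (f : κ → σ →₀ ℕ)
    (hf : Set.InjOn f s) (hS : S = f '' s) : pathSeries m S =
      1 + PowerSeries.X * ∑ i ∈ s, PowerSeries.C (Polynomial.X ^ (f i).degree) *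
        pathSeries m (colonGens m S (f i)) := by
  ext1 p
  cases p with
  | zero => simp [pathSeries, pathPoly_zero]
  | succ p =>
    rw [map_add, PowerSeries.coeff_succ_X_mul, map_sum]
    simp only [PowerSeries.coeff_C_mul, pathSeries, PowerSeries.coeff_mk]
    rw [pathPoly_succ s f hf hS, PowerSeries.coeff_one, if_neg (Nat.succ_ne_zero p), zero_add]

/-- If two finite families of degrees have the same generating function, they agree up to a
bijection. -/
lemma exists_equiv_of_sum_X_pow_eq {ι κ : Type*} [Fintype ι] [Fintype κ] {f : ι → ℕ} {g : κ → ℕ}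
    (h : ∑ i, (Polynomial.X : Polynomial ℤ) ^ f i = ∑ k, Polynomial.X ^ g k) :
    ∃ e : ι ≃ κ, ∀ i, g (e i) = f i := by
  classical
  have hcard : ∀ j, Nonempty ({i // f i = j} ≃ {k // g k = j}) := by
    intro j
    have h1 := congrArg (Polynomial.coeff · j) h
    simp only [Polynomial.finsetSum_coeff, Polynomial.coeff_X_pow, Finset.sum_boole] at h1
    refine ⟨Fintype.equivOfCardEq ?_⟩
    rw [Fintype.card_subtype, Fintype.card_subtype]
    simp only [eq_comm (a := j)] at h1
    exact_mod_cast h1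
  exact ⟨Equiv.ofFiberEquiv fun j => (hcard j).some, fun i => Equiv.ofFiberEquiv_map _ i⟩

lemma coeff_sum_X_pow {ι : Type*} [Fintype ι] (f : ι → ℕ) (j : ℕ) :
    (∑ i, (Polynomial.X : Polynomial ℤ) ^ f i).coeff j = Nat.card {i // f i = j} := by
  classical
  rw [Nat.card_eq_fintype_card, Fintype.card_subtype]
  simp only [Polynomial.finsetSum_coeff, Polynomial.coeff_X_pow, Finset.sum_boole]
  simp only [eq_comm (a := j)]

end PathSeries

/-! ### Colon ideals of ideals which contain variables -/

section Variables

variable {σ : Type} [LinearOrder σ] [Fintype σ]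

-- A certificate for computing colon ideals: an antichain inside the up-set, below which every
-- element of the up-set has a divisor, is the set of its minimal elements.
omit [LinearOrder σ] [Fintype σ] in
lemma colonGens_eq {m : MonomialOrder σ} {S M : Set (σ →₀ ℕ)} {g : σ →₀ ℕ}
    (hM : IsAntichain (· ≤ ·) M)
    (h1 : ∀ u ∈ M, ∃ n ∈ S, MonomialBefore m n g ∧ n ≤ u + g)
    (h2 : ∀ n ∈ S, MonomialBefore m n g → ∀ u, n ≤ u + g → ∃ v ∈ M, v ≤ u) :
    colonGens m S g = M := by
  ext u
  constructor
  · rintro ⟨⟨n, hn, hb, hle⟩, hmin⟩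
    obtain ⟨v, hv, hvu⟩ := h2 n hn hb u hle
    rwa [← le_antisymm hvu (hmin (h1 v hv) hvu)]
  · refine fun hu => ⟨h1 u hu, fun w ⟨n, hn, hb, hle⟩ hwu => ?_⟩
    obtain ⟨v, hv, hvw⟩ := h2 n hn hb w hle
    rwa [hM.eq hv hu (hvw.trans hwu)] at hvw

-- Only generators before `g` enter its colon ideal. This lets J_G and J_H inherit the colon ideals
-- computed for the full initial ideal.
omit [LinearOrder σ] [Fintype σ] in
lemma colonGens_congr {m : MonomialOrder σ} {S S' : Set (σ →₀ ℕ)} {g : σ →₀ ℕ}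
    (h : ∀ n, MonomialBefore m n g → (n ∈ S ↔ n ∈ S')) : colonGens m S g = colonGens m S' g := by
  have : (fun u => ∃ n ∈ S, MonomialBefore m n g ∧ n ≤ u + g) =
      fun u => ∃ n ∈ S', MonomialBefore m n g ∧ n ≤ u + g := by
    funext u
    exact propext ⟨fun ⟨n, hn, hb, hle⟩ => ⟨n, (h n hb).1 hn, hb, hle⟩,
      fun ⟨n, hn, hb, hle⟩ => ⟨n, (h n hb).2 hn, hb, hle⟩⟩
  rw [colonGens, colonGens, this]

/-- The exponents of a set of variables. -/
abbrev vars (V : Finset σ) : Set (σ →₀ ℕ) := ex '' (V : Set σ)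

omit [LinearOrder σ] [Fintype σ] in
lemma ex_le_iff {v : σ} {u : σ →₀ ℕ} : ex v ≤ u ↔ u v ≠ 0 := by
  rw [Finsupp.single_le_iff]
  omega

omit [LinearOrder σ] [Fintype σ] in
lemma ex_injective : Function.Injective (ex : σ → σ →₀ ℕ) :=
  Finsupp.single_left_injective one_ne_zero

omit [LinearOrder σ] [Fintype σ] in
lemma ex_le_ex_iff {v w : σ} : ex v ≤ ex w ↔ v = w := by
  classical
  rw [ex_le_iff, Finsupp.single_apply]
  simp [eq_comm]

lemma monomialBefore_ex_iff {v w : σ} :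
    MonomialBefore (degRevLex σ) (ex v) (ex w) ↔ v < w := by
  have key : ∀ {v w : σ}, v < w → ex w ≺[degRevLex σ] ex v := fun {v w} h => by
    rw [degRevLex_lt_iff]
    refine Or.inr ⟨by simp, w, by simp [h.ne], fun j hj => ?_⟩
    simp [hj.ne, (h.trans hj).ne]
  simp only [MonomialBefore, Finsupp.degree_single, lt_irrefl, false_or, true_and]
  refine ⟨fun h => ?_, key⟩
  rcases lt_trichotomy v w with h' | rfl | h'
  · exact h'
  · exact absurd h (lt_irrefl _)
  · exact absurd h (lt_asymm (key h'))

omit [Fintype σ] in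
/-- Adding variables to an antichain which does not involve them. -/
lemma isAntichain_vars_union {V : Finset σ} {S : Set (σ →₀ ℕ)} (hS : IsAntichain (· ≤ ·) S)
    (h0 : 0 ∉ S) (hV : ∀ e ∈ S, ∀ v ∈ V, e v = 0) : IsAntichain (· ≤ ·) (vars V ∪ S) := by
  rintro _ (⟨v, hv, rfl⟩ | he) _ (⟨w, hw, rfl⟩ | he') hne hle
  · exact hne (congrArg ex (ex_le_ex_iff.1 hle))
  · exact ex_le_iff.1 hle (hV _ he' v hv)
  · rename_i e
    have h1 : e = 0 := by
      ext v
      have h2 := hle v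
      rw [Finsupp.single_apply] at h2
      split_ifs at h2 with h
      · subst h
        exact hV e he _ hw
      · simpa using h2
    exact h0 (h1 ▸ he)
  · exact hS he he' hne hle

omit [LinearOrder σ] [Fintype σ] in
lemma isAntichain_vars (V : Finset σ) : IsAntichain (· ≤ ·) (vars V) := by
  rintro _ ⟨v, hv, rfl⟩ _ ⟨w, hw, rfl⟩ hne hle
  exact hne (congrArg ex (ex_le_ex_iff.1 hle))

/-- Sorting by degree first, only variables come before a variable, and distinct variables are
coprime. -/
lemma colonGens_vars_union_of_mem {V : Finset σ} {S : Set (σ →₀ ℕ)} (hS : ∀ e ∈ S, 2 ≤ e.degree)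
    (v : σ) : colonGens (degRevLex σ) (vars V ∪ S) (ex v) = vars (V.filter (· < v)) := by
  refine colonGens_eq (isAntichain_vars _) ?_ ?_
  · rintro _ ⟨w, hw, rfl⟩
    obtain ⟨hw, hwv⟩ := Finset.mem_filter.1 hw
    exact ⟨ex w, Or.inl ⟨w, hw, rfl⟩, monomialBefore_ex_iff.2 hwv, le_self_add⟩
  · rintro _ (⟨w, hw, rfl⟩ | he) hb u hle
    · have hwv := monomialBefore_ex_iff.1 hb
      refine ⟨ex w, ⟨w, Finset.mem_coe.2 (Finset.mem_filter.2 ⟨hw, hwv⟩), rfl⟩, ?_⟩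
      rw [ex_le_iff] at hle ⊢
      simpa [Finsupp.single_apply, hwv.ne'] using hle
    · have h1 := hS _ he
      rcases hb with hb | ⟨hb, -⟩ <;> rw [Finsupp.degree_single] at hb <;> omega

/-- The variables precede every element of `S`, and being coprime to them they pass to the colon
ideal unchanged; the remaining generators are those obtained from `S` alone. -/
lemma colonGens_vars_union {V : Finset σ} {S : Set (σ →₀ ℕ)} (hS : ∀ e ∈ S, 2 ≤ e.degree)
    (hanti : IsAntichain (· ≤ ·) S) (hV : ∀ e ∈ S, ∀ v ∈ V, e v = 0) {g : σ →₀ ℕ} (hg : g ∈ S) :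
    colonGens (degRevLex σ) (vars V ∪ S) g = vars V ∪ colonGens (degRevLex σ) S g := by
  classical
  have hmin : ∀ e ∈ colonGens (degRevLex σ) S g, ∀ v ∈ V, e v = 0 := by
    rintro e ⟨⟨n, hn, hb, hle⟩, hmin⟩ v hv
    by_contra hne
    -- Erasing `v` keeps the divisibility, since no element of `S` involves `v`, and contradicts
    -- minimality of `e` unless `v` was absent.
    have h1 := hmin (y := e.erase v) ⟨n, hn, hb, fun t => ?_⟩ (fun t => ?_) v
    · simp at h1
      exact hne h1
    · by_cases ht : t = v
      · subst ht
        simp [hV n hn t hv]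
      · have := hle t
        simpa [Finsupp.erase_ne ht] using this
    · by_cases ht : t = v
      · simp [ht]
      · simp [Finsupp.erase_ne ht]
  refine colonGens_eq (isAntichain_vars_union ?_ ?_ hmin) ?_ ?_
  · exact setOfPred_minimal_antichain _
  · rintro ⟨⟨n, hn, hb, hle⟩, -⟩
    rw [zero_add] at hle
    have := hanti.eq hn hg hle
    subst this
    rcases hb with hb | ⟨-, hb⟩ <;> exact lt_irrefl _ hb
  · rintro _ (⟨v, hv, rfl⟩ | ⟨⟨n, hn, hb, hle⟩, -⟩)
    · refine ⟨ex v, Or.inl ⟨v, hv, rfl⟩, Or.inl ?_, le_self_add⟩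
      rw [Finsupp.degree_single]
      exact hS g hg
    · exact ⟨n, Or.inr hn, hb, hle⟩
  · rintro _ (⟨v, hv, rfl⟩ | hn) hb u hle
    · refine ⟨ex v, Or.inl ⟨v, hv, rfl⟩, ?_⟩
      rw [ex_le_iff] at hle ⊢
      simpa [hV g hg v hv] using hle
    · obtain ⟨e, he, heu⟩ := exists_mem_colonGens ⟨_, hn, hb, hle⟩
      exact ⟨e, Or.inr he, heu⟩

/-- The generating function of one variable in degree one of the resolution. -/
def wSeries : PowerSeries (Polynomial ℤ) := PowerSeries.X * PowerSeries.C Polynomial.X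

/-- The generating function of one quadric in degree one of the resolution. -/
def qSeries : PowerSeries (Polynomial ℤ) := PowerSeries.X * PowerSeries.C (Polynomial.X ^ 2)

-- The binomial expansion over subsets of `V`, grouped by the largest element `v`: the rest is any
-- subset of the elements before `v`.
omit [Fintype σ] in
lemma one_add_mul_sum_pow {A : Type*} [CommRing A] (w : A) (V : Finset σ) :
    1 + w * ∑ v ∈ V, (1 + w) ^ (V.filter (· < v)).card = (1 + w) ^ V.card := by
  induction V using Finset.induction_on_max with
  | empty => simp
  | insert v V hmax ih =>
    have hv : v ∉ V := fun h => lt_irrefl _ (hmax v h)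
    rw [Finset.sum_insert hv, Finset.card_insert_of_notMem hv, pow_succ, ← ih]
    have h1 : (insert v V).filter (· < v) = V := by
      ext w
      simp only [Finset.mem_filter, Finset.mem_insert]
      exact ⟨fun ⟨h, h'⟩ => h.resolve_left h'.ne, fun h => ⟨Or.inr h, hmax w h⟩⟩
    have h2 : ∀ w ∈ V, (insert v V).filter (· < w) = V.filter (· < w) := by
      intro w hw
      rw [Finset.filter_insert, if_neg (lt_asymm (hmax w hw))]
    rw [h1, Finset.sum_congr rfl fun w hw => by rw [h2 w hw], ← ih]
    ring

omit [Fintype σ] in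
lemma one_add_X_mul_sum_pow (V : Finset σ) : 1 + PowerSeries.X *
    ∑ v ∈ V, PowerSeries.C Polynomial.X * (1 + wSeries) ^ (V.filter (· < v)).card =
      (1 + wSeries) ^ V.card := by
  refine Eq.trans ?_ (one_add_mul_sum_pow wSeries V)
  rw [← Finset.mul_sum, ← mul_assoc]
  rfl

/-- The generating function of an ideal generated by variables. -/
lemma pathSeries_vars (V : Finset σ) :
    pathSeries (degRevLex σ) (vars V) = (1 + wSeries) ^ V.card := by
  induction h : V.card using Nat.strong_induction_on generalizing V with
  | _ n ih =>
    subst h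
    rw [pathSeries_eq V ex ex_injective.injOn rfl]
    refine Eq.trans ?_ (one_add_X_mul_sum_pow V)
    congr 2
    refine Finset.sum_congr rfl fun v hv => ?_
    have h1 := colonGens_vars_union_of_mem (V := V) (S := ∅) (by simp) v
    rw [Set.union_empty] at h1
    rw [h1, Finsupp.degree_single, pow_one, ih _ ?_ _ rfl]
    exact Finset.card_lt_card (Finset.filter_ssubset.2 ⟨v, hv, lt_irrefl v⟩)

/-- The generating function of an ideal generated by variables and by monomials of higher degree
which do not involve these variables. -/
lemma pathSeries_vars_union (V : Finset σ) {S : Set (σ →₀ ℕ)} {κ : Type*} (s : Finset κ)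
    (f : κ → σ →₀ ℕ) (hf : Set.InjOn f s) (hfS : S = f '' s) (hS : ∀ e ∈ S, 2 ≤ e.degree)
    (hanti : IsAntichain (· ≤ ·) S) (hV : ∀ e ∈ S, ∀ v ∈ V, e v = 0) :
    pathSeries (degRevLex σ) (vars V ∪ S) = (1 + wSeries) ^ V.card +
      PowerSeries.X * ∑ i ∈ s, PowerSeries.C (Polynomial.X ^ (f i).degree) *
        pathSeries (degRevLex σ) (vars V ∪ colonGens (degRevLex σ) S (f i)) := by
  have hmem : ∀ i ∈ s, f i ∈ S := fun i hi => hfS ▸ ⟨i, hi, rfl⟩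
  have hinj : Set.InjOn (Sum.elim ex f) (V.disjSum s : Finset (σ ⊕ κ)) := by
    have hne : ∀ v, ∀ i ∈ s, ex v ≠ f i := fun v i hi h => by
      have := hS _ (hmem i hi)
      rw [← h, Finsupp.degree_single] at this
      omega
    rintro (v | i) hv (w | j) hw h
    · exact congrArg Sum.inl (ex_injective h)
    · exact absurd h (hne v j (by simpa using hw))
    · exact absurd h.symm (hne w i (by simpa using hv))
    · exact congrArg Sum.inr (hf (by simpa using hv) (by simpa using hw) h)
  have himg : vars V ∪ S = Sum.elim ex f '' (V.disjSum s : Finset (σ ⊕ κ)) := by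
    ext e
    simp [hfS]
  rw [pathSeries_eq _ _ hinj himg, Finset.sum_disjSum, mul_add, ← add_assoc]
  refine congrArg₂ (· + ·) ((congrArg (1 + PowerSeries.X * ·) (Finset.sum_congr rfl
    fun v _ => ?_)).trans (one_add_X_mul_sum_pow V))
    (congrArg (PowerSeries.X * ·) (Finset.sum_congr rfl fun i hi => ?_))
  · rw [Sum.elim_inl, colonGens_vars_union_of_mem hS, pathSeries_vars, Finsupp.degree_single,
      pow_one]
  · rw [Sum.elim_inr, colonGens_vars_union hS hanti hV (hmem i hi)]

omit [LinearOrder σ] [Fintype σ] in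
lemma colonGens_singleton {m : MonomialOrder σ} (g : σ →₀ ℕ) : colonGens m {g} g = ∅ := by
  refine colonGens_eq (by simp) (by simp) ?_
  rintro _ rfl (hb | ⟨-, hb⟩) <;> exact absurd hb (lt_irrefl _)

omit [LinearOrder σ] [Fintype σ] in
lemma sq_apply_eq_zero {t v : σ} (h : v ≠ t) : (ex t + ex t) v = 0 := by
  simp [h.symm]

/-- The square is coprime to the variables, so the count is that of a Koszul complex tensored with
the two-term complex of one quadric. -/
lemma pathSeries_vars_union_sq {V : Finset σ} {t : σ} (ht : t ∉ V) :
    pathSeries (degRevLex σ) (vars V ∪ {ex t + ex t}) =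
      (1 + wSeries) ^ V.card * (1 + qSeries) := by
  rw [pathSeries_vars_union V {()} (fun _ => ex t + ex t) (by simp) (by simp)
    (by simp) (by simp)]
  · simp only [Finset.sum_singleton, colonGens_singleton, Set.union_empty, pathSeries_vars,
      qSeries, map_add, Finsupp.degree_single]
    ring
  · rintro _ rfl v hv
    exact sq_apply_eq_zero (by rintro rfl; exact ht hv)

end Variables

/-! ### The colon ideals of the initial ideal of the carpet -/

section Colons

variable {a b : ℕ}

/-- The variables with positions in `s`. -/
def posVars (a b : ℕ) (s : Finset ℕ) : Finset (Var a b) := Finset.univ.filter (pos · ∈ s)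

lemma mem_posVars {s : Finset ℕ} {v : Var a b} : v ∈ posVars a b s ↔ pos v ∈ s := by
  simp [posVars]

lemma card_posVars {s : Finset ℕ} (hs : ∀ n ∈ s, n < a + b + 2) : (posVars a b s).card = s.card := by
  refine Finset.card_bij (fun v _ => pos v) (fun v hv => mem_posVars.1 hv)
    (fun v _ w _ h => pos_inj.1 h) fun n hn => ?_
  obtain ⟨v, rfl⟩ := exists_pos_eq (hs n hn)
  exact ⟨v, mem_posVars.2 hn, rfl⟩

lemma posVars_union (s t : Finset ℕ) : posVars a b (s ∪ t) = posVars a b s ∪ posVars a b t := by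
  ext v
  simp [mem_posVars]

lemma posVars_empty : posVars a b ∅ = ∅ := by
  ext v
  simp [mem_posVars]

lemma ex_apply_pos (v w : Var a b) : ex v w = if pos v = pos w then 1 else 0 := by
  classical
  rw [Finsupp.single_apply]
  exact if_congr pos_inj.symm rfl rfl

/-- Divisibility is only tested at the two variables of the generator, and written with equalities
of positions, so that case splitting and linear arithmetic can finish. -/
lemma pair_le_add {k l v w : Var a b} {u : Var a b →₀ ℕ} (h : ex k + ex l ≤ u + (ex v + ex w)) :
    (1 + (if pos l = pos k then 1 else 0) ≤
      u k + ((if pos v = pos k then 1 else 0) + if pos w = pos k then 1 else 0)) ∧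
    ((if pos k = pos l then 1 else 0) + 1 ≤
      u l + ((if pos v = pos l then 1 else 0) + if pos w = pos l then 1 else 0)) := by
  have h1 := h k
  have h2 := h l
  simp only [Finsupp.add_apply, ex_apply_pos, if_true] at h1 h2
  exact ⟨h1, h2⟩

/-- If z v is a generator and z is before w, then z v is sorted before v w and divides z v w, so z
lies in the colon ideal. -/
lemma exists_before_of_pair {Q : ℕ → ℕ → Prop} {v w z : Var a b} (hvw : v ≤ w)
    (hQ : (pos z ≤ pos v ∧ Q (pos z) (pos v)) ∨ (pos v ≤ pos z ∧ Q (pos v) (pos z)))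
    (h : pos z < pos w) :
    ∃ n ∈ quad a b Q, MonomialBefore (degRevLex (Var a b)) n (ex v + ex w) ∧
      n ≤ ex z + (ex v + ex w) := by
  have hvw' := pos_le_iff.2 hvw
  rcases hQ with ⟨h1, h2⟩ | ⟨h1, h2⟩
  · refine ⟨_, ⟨z, v, pos_le_iff.1 h1, h2, rfl⟩,
      (monomialBefore_pair_iff (pos_le_iff.1 h1) hvw).2 ?_, ?_⟩
    · rw [← pos_lt_iff, ← pos_lt_iff, ← pos_inj]
      omega
    · rw [← add_assoc]
      exact le_self_add
  · refine ⟨_, ⟨v, z, pos_le_iff.1 h1, h2, rfl⟩,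
      (monomialBefore_pair_iff (pos_le_iff.1 h1) hvw).2 ?_, ?_⟩
    · rw [← pos_lt_iff, ← pos_lt_iff, ← pos_inj]
      omega
    · rw [← add_assoc, add_comm (ex v)]
      exact le_self_add

lemma before_pos_of_mem_quad {Q : ℕ → ℕ → Prop} {n : Var a b →₀ ℕ} {v w : Var a b} (hvw : v ≤ w)
    (hn : n ∈ quad a b Q) (hb : MonomialBefore (degRevLex (Var a b)) n (ex v + ex w)) :
    ∃ k l : Var a b, n = ex k + ex l ∧ Q (pos k) (pos l) ∧ pos k ≤ pos l ∧
      (pos l < pos w ∨ pos l = pos w ∧ pos k < pos v) := by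
  obtain ⟨k, l, hkl, hQ, rfl⟩ := hn
  have := (monomialBefore_pair_iff hkl hvw).1 hb
  rw [← pos_lt_iff, ← pos_lt_iff, ← pos_inj] at this
  exact ⟨k, l, rfl, hQ, pos_le_iff.2 hkl, this⟩

lemma colonGens_quad_congr {Q Q' : ℕ → ℕ → Prop} {v w : Var a b} (hvw : v ≤ w)
    (h : ∀ k l, k ≤ l → (l < pos w ∨ l = pos w ∧ k < pos v) → (Q k l ↔ Q' k l)) :
    colonGens (degRevLex (Var a b)) (quad a b Q) (ex v + ex w) =
      colonGens (degRevLex (Var a b)) (quad a b Q') (ex v + ex w) := by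
  refine colonGens_congr fun n hb => ⟨fun hn => ?_, fun hn => ?_⟩ <;>
    obtain ⟨k, l, rfl, hQ, hkl, hlt⟩ := before_pos_of_mem_quad hvw hn hb
  · exact ⟨k, l, pos_le_iff.1 hkl, (h _ _ hkl hlt).1 hQ, rfl⟩
  · exact ⟨k, l, pos_le_iff.1 hkl, (h _ _ hkl hlt).2 hQ, rfl⟩

/-- The variables x_z with 1 ≤ z < w come from the generators x_v x_z; every earlier generator
contributes a multiple of one of them. -/
lemma colonGens_xx {v w : Var a b} (hv : 1 ≤ pos v) (hvw : pos v ≤ pos w) (hw : pos w < a) :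
    colonGens (degRevLex (Var a b)) (quad a b (QF a b)) (ex v + ex w) =
      vars (posVars a b (Finset.Ico 1 (pos w))) := by
  refine colonGens_eq (isAntichain_vars _) ?_ ?_
  · rintro _ ⟨z, hz, rfl⟩
    have hz := Finset.mem_Ico.1 (mem_posVars.1 hz)
    refine exists_before_of_pair (pos_le_iff.1 hvw) ?_ hz.2
    unfold QF
    omega
  · intro n hn hb u hle
    by_contra! hcon
    have hu : ∀ z : Var a b, pos z ∈ Finset.Ico 1 (pos w) → u z = 0 := fun z hz => by
      by_contra hne
      exact hcon _ ⟨z, mem_posVars.2 hz, rfl⟩ (ex_le_iff.2 hne)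
    obtain ⟨k, l, rfl, hQ, hkl, hlt⟩ := before_pos_of_mem_quad (pos_le_iff.1 hvw) hn hb
    have h3 := hu k
    have h4 := hu l
    obtain ⟨h1, h2⟩ := pair_le_add hle
    simp only [Finset.mem_Ico] at h3 h4
    unfold QF at hQ
    split_ifs at h1 h2 <;> omega

/-- As v < a, both x_v x_z and x_v y_z are generators, so all of x_1, …, x_{a-1} and all y before
the given one appear. -/
lemma colonGens_xy {v w : Var a b} (hv : 2 ≤ pos v) (hva : pos v < a) (hw : a + 1 ≤ pos w)
    (hwb : pos w < a + b) :
    colonGens (degRevLex (Var a b)) (quad a b (QF a b)) (ex v + ex w) =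
      vars (posVars a b (Finset.Ico 1 a ∪ Finset.Ico (a + 1) (pos w))) := by
  have hvw : pos v ≤ pos w := by omega
  refine colonGens_eq (isAntichain_vars _) ?_ ?_
  · rintro _ ⟨z, hz, rfl⟩
    have hz := mem_posVars.1 hz
    simp only [Finset.mem_union, Finset.mem_Ico] at hz
    refine exists_before_of_pair (pos_le_iff.1 hvw) ?_ (by omega)
    unfold QF
    omega
  · intro n hn hb u hle
    by_contra! hcon
    have hu : ∀ z : Var a b, pos z ∈ Finset.Ico 1 a ∪ Finset.Ico (a + 1) (pos w) → u z = 0 :=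
      fun z hz => by
        by_contra hne
        exact hcon _ ⟨z, mem_posVars.2 hz, rfl⟩ (ex_le_iff.2 hne)
    obtain ⟨k, l, rfl, hQ, hkl, hlt⟩ := before_pos_of_mem_quad (pos_le_iff.1 hvw) hn hb
    have h3 := hu k
    have h4 := hu l
    obtain ⟨h1, h2⟩ := pair_le_add hle
    simp only [Finset.mem_union, Finset.mem_Ico] at h3 h4
    unfold QF at hQ
    split_ifs at h1 h2 <;> omega

lemma isAntichain_vars_union_sq {V : Finset (Var a b)} {t : Var a b} (ht : t ∉ V) :
    IsAntichain (· ≤ ·) (vars V ∪ {ex t + ex t}) := by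
  refine isAntichain_vars_union (by simp) ?_ ?_
  · intro h
    have := DFunLike.congr_fun (Set.mem_singleton_iff.1 h) t
    simp at this
  · rintro _ rfl v hv
    exact sq_apply_eq_zero fun h => ht (h ▸ hv)

lemma exists_before_sq {v w t : Var a b} (hvw : v ≤ w) (ha : 2 ≤ a) (ht : pos t = 1)
    (hw : a < pos w) : ∃ n ∈ quad a b (QF a b),
      MonomialBefore (degRevLex (Var a b)) n (ex v + ex w) ∧ n ≤ (ex t + ex t) + (ex v + ex w) := by
  refine ⟨_, ⟨t, t, le_rfl, ?_, rfl⟩, (monomialBefore_pair_iff le_rfl hvw).2 (Or.inl ?_),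
    le_self_add⟩
  · unfold QF
    omega
  · rw [← pos_lt_iff]
    omega

/-- No x_z x_a is a generator. For 2 ≤ z < a the variable x_z enters through its product with the
given y, which is sorted earlier; x_1 has no such product and enters only through x_1². -/
lemma colonGens_lastx_y (ha : 2 ≤ a) {v w t : Var a b} (hv : pos v = a) (hw : a + 1 ≤ pos w)
    (hwb : pos w < a + b) (ht : pos t = 1) :
    colonGens (degRevLex (Var a b)) (quad a b (QF a b)) (ex v + ex w) =
      vars (posVars a b (Finset.Ico 2 a ∪ Finset.Ico (a + 1) (pos w))) ∪ {ex t + ex t} := by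
  have hvw : pos v ≤ pos w := by omega
  refine colonGens_eq (isAntichain_vars_union_sq fun h => ?_) ?_ ?_
  · have := mem_posVars.1 h
    simp only [Finset.mem_union, Finset.mem_Ico] at this
    omega
  · rintro _ (⟨z, hz, rfl⟩ | rfl)
    · have hz := mem_posVars.1 hz
      simp only [Finset.mem_union, Finset.mem_Ico] at hz
      rcases hz with hz | hz
      · refine ⟨_, ⟨z, w, pos_le_iff.1 (by omega), ?_, rfl⟩,
          (monomialBefore_pair_iff (pos_le_iff.1 (by omega)) (pos_le_iff.1 hvw)).2
            (Or.inr ⟨rfl, pos_lt_iff.1 (by omega)⟩), ?_⟩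
        · unfold QF
          omega
        · rw [add_comm (ex v), ← add_assoc]
          exact le_self_add
      · refine exists_before_of_pair (pos_le_iff.1 hvw) ?_ (by omega)
        unfold QF
        omega
    · exact exists_before_sq (pos_le_iff.1 hvw) ha ht (by omega)
  · intro n hn hb u hle
    by_contra! hcon
    have hu : ∀ z : Var a b, pos z ∈ Finset.Ico 2 a ∪ Finset.Ico (a + 1) (pos w) → u z = 0 :=
      fun z hz => by
        by_contra hne
        exact hcon _ (Or.inl ⟨z, mem_posVars.2 hz, rfl⟩) (ex_le_iff.2 hne)
    have hut : ∀ z : Var a b, pos z = 1 → u z ≤ 1 := fun z hz => by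
      obtain rfl := pos_inj.1 (hz.trans ht.symm)
      by_contra hne
      exact hcon _ (Or.inr rfl) (pair_le_of_two_le (by omega))
    obtain ⟨k, l, rfl, hQ, hkl, hlt⟩ := before_pos_of_mem_quad (pos_le_iff.1 hvw) hn hb
    have h3 := hu k
    have h4 := hu l
    have h5 := hut k
    have h6 := hut l
    obtain ⟨h1, h2⟩ := pair_le_add hle
    simp only [Finset.mem_union, Finset.mem_Ico] at h3 h4
    unfold QF at hQ
    split_ifs at h1 h2 <;> omega

/-- The generators x_z y_v with z ≥ 2 and y_v y_z with z ≥ 1 give the variables. The hypothesis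
`hvb` keeps y_v different from y_{b-1}, which has no products with the x. Again x_1 enters only
through its square. -/
lemma colonGens_yy (ha : 2 ≤ a) {v w t : Var a b} (hv : a + 2 ≤ pos v) (hvw : pos v ≤ pos w)
    (hwb : pos w ≤ a + b) (hvb : pos v < a + b) (ht : pos t = 1) :
    colonGens (degRevLex (Var a b)) (quad a b (QF a b)) (ex v + ex w) =
      vars (posVars a b (Finset.Ico 2 (a + 1) ∪ Finset.Ico (a + 2) (pos w))) ∪ {ex t + ex t} := by
  refine colonGens_eq (isAntichain_vars_union_sq fun h => ?_) ?_ ?_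
  · have := mem_posVars.1 h
    simp only [Finset.mem_union, Finset.mem_Ico] at this
    omega
  · rintro _ (⟨z, hz, rfl⟩ | rfl)
    · have hz := mem_posVars.1 hz
      simp only [Finset.mem_union, Finset.mem_Ico] at hz
      refine exists_before_of_pair (pos_le_iff.1 hvw) ?_ (by omega)
      unfold QF
      omega
    · exact exists_before_sq (pos_le_iff.1 hvw) ha ht (by omega)
  · intro n hn hb u hle
    by_contra! hcon
    have hu : ∀ z : Var a b, pos z ∈ Finset.Ico 2 (a + 1) ∪ Finset.Ico (a + 2) (pos w) → u z = 0 :=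
      fun z hz => by
        by_contra hne
        exact hcon _ (Or.inl ⟨z, mem_posVars.2 hz, rfl⟩) (ex_le_iff.2 hne)
    have hut : ∀ z : Var a b, pos z = 1 → u z ≤ 1 := fun z hz => by
      obtain rfl := pos_inj.1 (hz.trans ht.symm)
      by_contra hne
      exact hcon _ (Or.inr rfl) (pair_le_of_two_le (by omega))
    obtain ⟨k, l, rfl, hQ, hkl, hlt⟩ := before_pos_of_mem_quad (pos_le_iff.1 hvw) hn hb
    have h3 := hu k
    have h4 := hu l
    have h5 := hut k
    have h6 := hut l
    obtain ⟨h1, h2⟩ := pair_le_add hle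
    simp only [Finset.mem_union, Finset.mem_Ico] at h3 h4
    unfold QF at hQ
    split_ifs at h1 h2 <;> omega

lemma apply_eq_zero_of_mem_quad {Q : ℕ → ℕ → Prop} {e : Var a b →₀ ℕ} (he : e ∈ quad a b Q)
    {z : Var a b} (hz : ∀ k l, k ≤ l → Q k l → pos z ≠ k ∧ pos z ≠ l) : e z = 0 := by
  obtain ⟨k, l, hkl, hQ, rfl⟩ := he
  obtain ⟨h1, h2⟩ := hz _ _ (pos_le_iff.2 hkl) hQ
  rw [Finsupp.add_apply, ex_apply_pos, ex_apply_pos, if_neg h1.symm, if_neg h2.symm]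

lemma zero_notMem_quad (Q : ℕ → ℕ → Prop) : 0 ∉ quad a b Q := fun h => by
  have := degree_of_mem_quad h
  simp at this

/-- Of the products with y_{b-1} only y_z y_{b-1}, 1 ≤ z ≤ b - 2, are earlier generators. The
generators not divisible by these y_z are the x_i x_j and the x_i y_0, which generate J_H; they
survive unchanged. This is the source of the Koszul factor and of H. -/
lemma colonGens_sq (hb : 2 ≤ b) {w : Var a b} (hw : pos w = a + b) :
    colonGens (degRevLex (Var a b)) (quad a b (QF a b)) (ex w + ex w) =
      vars (posVars a b (Finset.Ico (a + 2) (a + b))) ∪ quad a b (QH a) := by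
  refine colonGens_eq (isAntichain_vars_union (isAntichain_quad _) (zero_notMem_quad _) ?_) ?_ ?_
  · intro e he v hv
    refine apply_eq_zero_of_mem_quad he fun k l hkl hQ => ?_
    have := Finset.mem_Ico.1 (mem_posVars.1 hv)
    unfold QH at hQ
    omega
  · rintro _ (⟨z, hz, rfl⟩ | he)
    · have hz := Finset.mem_Ico.1 (mem_posVars.1 hz)
      refine exists_before_of_pair le_rfl ?_ (by omega)
      unfold QF
      omega
    · obtain ⟨k, l, hkl, hQ, rfl⟩ := he
      refine ⟨_, ⟨k, l, hkl, ?_, rfl⟩, (monomialBefore_pair_iff hkl le_rfl).2 (Or.inl ?_),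
        le_self_add⟩
      · unfold QF
        unfold QH at hQ
        omega
      · rw [← pos_lt_iff]
        unfold QH at hQ
        omega
  · intro n hn hb' u hle
    by_contra! hcon
    have hu : ∀ z : Var a b, pos z ∈ Finset.Ico (a + 2) (a + b) → u z = 0 :=
      fun z hz => by
        by_contra hne
        exact hcon _ (Or.inl ⟨z, mem_posVars.2 hz, rfl⟩) (ex_le_iff.2 hne)
    obtain ⟨k, l, rfl, hQ, hkl, hlt⟩ := before_pos_of_mem_quad le_rfl hn hb'
    have h3 := hu k
    have h4 := hu l
    obtain ⟨h1, h2⟩ := pair_le_add hle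
    simp only [Finset.mem_Ico] at h3 h4
    by_cases hQH : QH a (pos k) (pos l)
    · refine hcon _ (Or.inr ⟨k, l, pos_le_iff.1 hkl, hQH, rfl⟩) ?_
      by_cases hkl' : k = l
      · subst hkl'
        refine pair_le_of_two_le ?_
        rw [if_neg (c := pos w = pos k) (by unfold QH at hQH; omega)] at h1
        simpa using h1
      · refine pair_le_of_ne hkl' ?_ ?_
        · rw [if_neg (c := pos w = pos k) (by unfold QH at hQH; omega)] at h1
          omega
        · rw [if_neg (c := pos w = pos l) (by unfold QH at hQH; omega)] at h2
          omega
    · unfold QF at hQ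
      unfold QH at hQH
      split_ifs at h1 h2 <;> omega

end Colons

/-! ### The generating functions of the carpet -/

section Series

variable {a b : ℕ}

/-- The variable at a position. -/
def varAt (a b n : ℕ) : Var a b := if h : ∃ v : Var a b, pos v = n then h.choose else Sum.inlₗ 0

lemma pos_varAt {n : ℕ} (h : n < a + b + 2) : pos (varAt a b n) = n := by
  rw [varAt, dif_pos (exists_pos_eq h)]
  exact (exists_pos_eq h).choose_spec

lemma varAt_pos (v : Var a b) : varAt a b (pos v) = v := pos_inj.1 (pos_varAt (pos_lt v))

/-- The exponent vector of the product of the variables at two positions. -/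
def pairAt (a b : ℕ) (x : Σ _ : ℕ, ℕ) : Var a b →₀ ℕ := ex (varAt a b x.2) + ex (varAt a b x.1)

lemma pairAt_mk (l k : ℕ) : pairAt a b ⟨l, k⟩ = ex (varAt a b k) + ex (varAt a b l) := rfl

lemma degree_pairAt (x : Σ _ : ℕ, ℕ) : (pairAt a b x).degree = 2 := by simp [pairAt]

lemma pairAt_injOn {s : Finset (Σ _ : ℕ, ℕ)} (hs : ∀ x ∈ s, x.2 ≤ x.1 ∧ x.1 < a + b + 2) :
    Set.InjOn (pairAt a b) s := by
  rintro ⟨l, k⟩ hx ⟨l', k'⟩ hx' h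
  obtain ⟨h1, h2⟩ := hs _ hx
  obtain ⟨h1', h2'⟩ := hs _ hx'
  have key : ∀ k l k' l' : ℕ, k ≤ l → l < a + b + 2 → k' ≤ l' → l' < a + b + 2 →
      (l < l' ∨ l = l' ∧ k < k') → pairAt a b ⟨l, k⟩ ≠ pairAt a b ⟨l', k'⟩ := by
    intro k l k' l' h1 h2 h1' h2' h heq
    refine (pair_lt_of_lt (k := varAt a b k') (l := varAt a b l') (v := varAt a b k)
      (w := varAt a b l) ?_ ?_ ?_).ne (congrArg (degRevLex (Var a b)).toSyn heq.symm)
    · rw [← pos_le_iff, pos_varAt (by omega), pos_varAt h2']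
      exact h1'
    · rw [← pos_le_iff, pos_varAt (by omega), pos_varAt h2]
      exact h1
    · rw [← pos_lt_iff, ← pos_lt_iff, ← pos_inj, pos_varAt h2, pos_varAt h2', pos_varAt (by omega),
        pos_varAt (by omega)]
      exact h
  dsimp only at h1 h2 h1' h2'
  rcases lt_trichotomy l l' with hl | rfl | hl
  · exact absurd h (key _ _ _ _ h1 h2 h1' h2' (Or.inl hl))
  · rcases lt_trichotomy k k' with hk | rfl | hk
    · exact absurd h (key _ _ _ _ h1 h2 h1' h2' (Or.inr ⟨rfl, hk⟩))
    · rfl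
    · exact absurd h.symm (key _ _ _ _ h1' h2' h1 h2 (Or.inr ⟨rfl, hk⟩))
  · exact absurd h.symm (key _ _ _ _ h1' h2' h1 h2 (Or.inl hl))

lemma pathSeries_vars_union_quad {V : Finset (Var a b)} {Q : ℕ → ℕ → Prop}
    (s : Finset (Σ _ : ℕ, ℕ)) (hs : ∀ l k, ⟨l, k⟩ ∈ s ↔ k ≤ l ∧ Q k l)
    (hQ : ∀ k l, k ≤ l → Q k l → l < a + b + 2)
    (hV : ∀ v ∈ V, ∀ k l, k ≤ l → Q k l → pos v ≠ k ∧ pos v ≠ l) :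
    pathSeries (degRevLex (Var a b)) (vars V ∪ quad a b Q) = (1 + wSeries) ^ V.card +
      qSeries * ∑ x ∈ s, pathSeries (degRevLex (Var a b))
        (vars V ∪ colonGens (degRevLex (Var a b)) (quad a b Q) (pairAt a b x)) := by
  have hs' : ∀ x ∈ s, x.2 ≤ x.1 ∧ x.1 < a + b + 2 := fun x hx =>
    ⟨((hs _ _).1 hx).1, hQ _ _ ((hs _ _).1 hx).1 ((hs _ _).1 hx).2⟩
  rw [pathSeries_vars_union V s (pairAt a b) (pairAt_injOn hs') ?_
    (fun e he => (degree_of_mem_quad he).ge) (isAntichain_quad _)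
    fun e he v hv => apply_eq_zero_of_mem_quad he (hV v hv)]
  · simp only [degree_pairAt, qSeries]
    rw [← Finset.mul_sum, mul_assoc]
  · ext e
    constructor
    · rintro ⟨k, l, hkl, hkQ, rfl⟩
      refine ⟨⟨pos l, pos k⟩, (hs _ _).2 ⟨pos_le_iff.2 hkl, hkQ⟩, ?_⟩
      rw [pairAt, varAt_pos, varAt_pos]
    · rintro ⟨⟨l, k⟩, hx, rfl⟩
      obtain ⟨h1, h2⟩ := (hs l k).1 hx
      have h3 := hQ _ _ h1 h2
      refine ⟨varAt a b k, varAt a b l, ?_, ?_, rfl⟩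
      · rw [← pos_le_iff, pos_varAt (by omega), pos_varAt h3]
        exact h1
      · rw [pos_varAt (by omega), pos_varAt h3]
        exact h2

/-- The indices of the generators of `J_H`. -/
def idxH (a : ℕ) : Finset (Σ _ : ℕ, ℕ) :=
  (Finset.Ico 1 a).sigma (fun l => Finset.Ico 1 (l + 1)) ∪
    (({a + 1} : Finset ℕ).sigma (fun _ => Finset.Ico 2 a) ∪ {⟨a + 1, a⟩})

/-- The indices of the generators of `J_G`. -/
def idxG (a b : ℕ) : Finset (Σ _ : ℕ, ℕ) :=
  (Finset.Ico 1 a).sigma (fun l => Finset.Ico 1 (l + 1)) ∪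
    ((Finset.Ico (a + 1) (a + b)).sigma (fun _ => Finset.Ico 2 a) ∪
      ((Finset.Ico (a + 1) (a + b)).sigma (fun _ => {a}) ∪
        ((Finset.Ico (a + 2) (a + b)).sigma (fun l => Finset.Ico (a + 2) (l + 1)) ∪
          ({a + b} : Finset ℕ).sigma (fun _ => Finset.Ico (a + 2) (a + b)))))

lemma mem_idxH (ha : 2 ≤ a) (l k : ℕ) : (⟨l, k⟩ : Σ _ : ℕ, ℕ) ∈ idxH a ↔ k ≤ l ∧ QH a k l := by
  simp only [idxH, Finset.mem_union, Finset.mem_sigma, Finset.mem_Ico, Finset.mem_singleton,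
    Sigma.mk.injEq, heq_eq_eq, QH]
  omega

lemma mem_idxG (ha : 2 ≤ a) (l k : ℕ) :
    (⟨l, k⟩ : Σ _ : ℕ, ℕ) ∈ idxG a b ↔ k ≤ l ∧ QG a b k l := by
  simp only [idxG, Finset.mem_union, Finset.mem_sigma, Finset.mem_Ico, Finset.mem_singleton, QG, QF]
  omega

lemma sum_idxH {M : Type*} [AddCommMonoid M] (F : (Σ _ : ℕ, ℕ) → M) :
    ∑ x ∈ idxH a, F x = ∑ l ∈ Finset.Ico 1 a, ∑ k ∈ Finset.Ico 1 (l + 1), F ⟨l, k⟩ +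
      (∑ k ∈ Finset.Ico 2 a, F ⟨a + 1, k⟩ + F ⟨a + 1, a⟩) := by
  rw [idxH, Finset.sum_union, Finset.sum_union, Finset.sum_sigma, Finset.sum_sigma,
    Finset.sum_singleton, Finset.sum_singleton]
  all_goals
    rw [Finset.disjoint_left]
    rintro ⟨l, k⟩
    simp only [Finset.mem_union, Finset.mem_sigma, Finset.mem_Ico, Finset.mem_singleton,
      Sigma.mk.injEq, heq_eq_eq]
    omega

/-- The blocks follow the types of colon ideals: products of two x, products x_k y with k < a,
products x_a y, products of two y before y_{b-1}, and products with y_{b-1} other than its square.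
-/
lemma sum_idxG {M : Type*} [AddCommMonoid M] (F : (Σ _ : ℕ, ℕ) → M) :
    ∑ x ∈ idxG a b, F x = ∑ l ∈ Finset.Ico 1 a, ∑ k ∈ Finset.Ico 1 (l + 1), F ⟨l, k⟩ +
      (∑ l ∈ Finset.Ico (a + 1) (a + b), ∑ k ∈ Finset.Ico 2 a, F ⟨l, k⟩ +
        (∑ l ∈ Finset.Ico (a + 1) (a + b), F ⟨l, a⟩ +
          (∑ l ∈ Finset.Ico (a + 2) (a + b), ∑ k ∈ Finset.Ico (a + 2) (l + 1), F ⟨l, k⟩ +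
            ∑ k ∈ Finset.Ico (a + 2) (a + b), F ⟨a + b, k⟩))) := by
  rw [idxG, Finset.sum_union, Finset.sum_union, Finset.sum_union, Finset.sum_union,
    Finset.sum_sigma, Finset.sum_sigma, Finset.sum_sigma, Finset.sum_sigma, Finset.sum_sigma,
    Finset.sum_singleton]
  · simp only [Finset.sum_singleton]
  all_goals
    rw [Finset.disjoint_left]
    rintro ⟨l, k⟩
    simp only [Finset.mem_union, Finset.mem_sigma, Finset.mem_Ico, Finset.mem_singleton]
    omega

/-- The generating function for `J_H`. -/
def hSeries (a : ℕ) : PowerSeries (Polynomial ℤ) :=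
  1 + qSeries * (∑ l ∈ Finset.Ico 1 a, l • (1 + wSeries) ^ (l - 1) +
    ((a - 2) • (1 + wSeries) ^ (a - 1) + (1 + wSeries) ^ (a - 2) * (1 + qSeries)))

/-- The generating function for `J_G`. -/
def gSeries (a b : ℕ) : PowerSeries (Polynomial ℤ) :=
  1 + qSeries * (∑ l ∈ Finset.Ico 1 a, l • (1 + wSeries) ^ (l - 1) +
    (∑ l ∈ Finset.Ico (a + 1) (a + b), (a - 2) • (1 + wSeries) ^ (l - 2) +
      (∑ l ∈ Finset.Ico (a + 1) (a + b), (1 + wSeries) ^ (l - 3) * (1 + qSeries) +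
        (∑ l ∈ Finset.Ico (a + 2) (a + b), (l - (a + 1)) • ((1 + wSeries) ^ (l - 3) * (1 + qSeries)) +
          (b - 2) • ((1 + wSeries) ^ (a + b - 3) * (1 + qSeries))))))

lemma pairAt_pos {l k : ℕ} (h : k ≤ l) (hl : l < a + b + 2) :
    varAt a b k ≤ varAt a b l ∧ pos (varAt a b k) = k ∧ pos (varAt a b l) = l := by
  refine ⟨?_, pos_varAt (by omega), pos_varAt hl⟩
  rw [← pos_le_iff, pos_varAt (by omega), pos_varAt hl]
  exact h

lemma card_Ico_union {i j k l : ℕ} (h : j ≤ k) :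
    (Finset.Ico i j ∪ Finset.Ico k l).card = j - i + (l - k) := by
  rw [Finset.card_union_of_disjoint, Nat.card_Ico, Nat.card_Ico]
  rw [Finset.disjoint_left]
  intro n
  simp only [Finset.mem_Ico]
  omega

lemma pathSeries_posVars (s : Finset ℕ) (hs : ∀ n ∈ s, n < a + b + 2) :
    pathSeries (degRevLex (Var a b)) (vars (posVars a b s)) = (1 + wSeries) ^ s.card := by
  rw [pathSeries_vars, card_posVars hs]

lemma pathSeries_posVars_sq (s : Finset ℕ) (hs : ∀ n ∈ s, n < a + b + 2) {t : Var a b}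
    (ht : pos t ∉ s) : pathSeries (degRevLex (Var a b)) (vars (posVars a b s) ∪ {ex t + ex t}) =
      (1 + wSeries) ^ s.card * (1 + qSeries) := by
  rw [pathSeries_vars_union_sq fun h => ht (mem_posVars.1 h), card_posVars hs]

lemma vars_union (V W : Finset (Var a b)) : vars (V ∪ W) = vars V ∪ vars W := by
  simp [vars, Set.image_union]

/-- The variables in `s` do not occur in J_H, so they are added to each colon ideal, and the factor
(1 + w)^|s| splits off. At its own generators J_H has the same colon ideals as the full initial
ideal. -/
lemma pathSeries_quadH (ha : 2 ≤ a) (hb : 2 ≤ b) (s : Finset ℕ)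
    (hs : ∀ n ∈ s, a + 2 ≤ n ∧ n < a + b + 2) :
    pathSeries (degRevLex (Var a b)) (vars (posVars a b s) ∪ quad a b (QH a)) =
      (1 + wSeries) ^ s.card * hSeries a := by
  have hs' : ∀ n ∈ s, n < a + b + 2 := fun n hn => (hs n hn).2
  have hcard : ∀ t : Finset ℕ, (∀ n ∈ t, n ≤ a + 1) → (s ∪ t).card = s.card + t.card := by
    intro t ht
    rw [Finset.card_union_of_disjoint]
    rw [Finset.disjoint_left]
    intro n hn hn'
    have h1 := (hs n hn).1
    have h2 := ht n hn'
    omega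
  have hbd : ∀ t : Finset ℕ, (∀ n ∈ t, n ≤ a + 1) → ∀ n ∈ s ∪ t, n < a + b + 2 := by
    intro t ht n hn
    rcases Finset.mem_union.1 hn with hn | hn
    · exact hs' n hn
    · have := ht n hn
      omega
  have hcongr : ∀ l k, k ≤ l → QH a k l → colonGens (degRevLex (Var a b)) (quad a b (QH a))
      (pairAt a b ⟨l, k⟩) = colonGens (degRevLex (Var a b)) (quad a b (QF a b))
      (pairAt a b ⟨l, k⟩) := by
    intro l k hkl hQ
    obtain ⟨h1, h2, h3⟩ := pairAt_pos (a := a) (b := b) hkl (by unfold QH at hQ; omega)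
    refine colonGens_quad_congr h1 fun k' l' hkl' hlt => ?_
    rw [h2, h3] at hlt
    unfold QH at *
    unfold QF
    omega
  rw [pathSeries_vars_union_quad (idxH a) (mem_idxH ha) (fun k l hkl hQ => by unfold QH at hQ; omega)
    (fun v hv k l hkl hQ => by
      have := (hs _ (mem_posVars.1 hv)).1
      unfold QH at hQ
      omega), card_posVars hs', sum_idxH, hSeries,
    mul_add ((1 + wSeries) ^ s.card), mul_one, mul_left_comm, mul_add ((1 + wSeries) ^ s.card),
    mul_add ((1 + wSeries) ^ s.card)]
  congr 3
  · rw [Finset.mul_sum]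
    refine Finset.sum_congr rfl fun l hl => ?_
    have hl := Finset.mem_Ico.1 hl
    rw [Finset.sum_congr rfl (g := fun _ => (1 + wSeries) ^ (s.card + (l - 1))) fun k hk => ?_]
    · rw [Finset.sum_const, Nat.card_Ico, Nat.add_sub_cancel, pow_add, mul_smul_comm]
    · have hk := Finset.mem_Ico.1 hk
      obtain ⟨h1, h2, h3⟩ := pairAt_pos (a := a) (b := b) (k := k) (l := l) (by omega) (by omega)
      rw [hcongr _ _ (by omega) (by unfold QH; omega), pairAt_mk,
        colonGens_xx (by omega) (by omega) (by omega), ← vars_union, ← posVars_union,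
        pathSeries_posVars _ (hbd _ _), hcard, h3, Nat.card_Ico]
      all_goals
        intro n hn
        simp only [Finset.mem_Ico] at hn
        omega
  · congr 1
    · rw [Finset.sum_congr rfl (g := fun _ => (1 + wSeries) ^ (s.card + (a - 1))) fun k hk => ?_]
      · rw [Finset.sum_const, Nat.card_Ico, pow_add, mul_smul_comm]
      · have hk := Finset.mem_Ico.1 hk
        obtain ⟨h1, h2, h3⟩ := pairAt_pos (a := a) (b := b) (k := k) (l := a + 1) (by omega) (by omega)
        rw [hcongr _ _ (by omega) (by unfold QH; omega), pairAt_mk,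
          colonGens_xy (by omega) (by omega) (by omega) (by omega), ← vars_union, ← posVars_union,
          pathSeries_posVars _ (hbd _ _), hcard, h3, card_Ico_union (by omega), Nat.sub_self,
          add_zero]
        all_goals
          intro n hn
          simp only [Finset.mem_union, Finset.mem_Ico] at hn
          omega
    · obtain ⟨h1, h2, h3⟩ := pairAt_pos (a := a) (b := b) (k := a) (l := a + 1) (by omega) (by omega)
      rw [hcongr _ _ (by omega) (by unfold QH; omega), pairAt_mk,
        colonGens_lastx_y (t := varAt a b 1) ha (by omega) (by omega) (by omega)
        (pos_varAt (by omega)), ← Set.union_assoc, ← vars_union, ← posVars_union,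
        pathSeries_posVars_sq _ (hbd _ _), hcard, h3, card_Ico_union (by omega), Nat.sub_self,
        add_zero, pow_add, mul_assoc]
      · intro n hn
        simp only [Finset.mem_union, Finset.mem_Ico] at hn
        omega
      · rw [pos_varAt (n := 1) (by omega)]
        intro h
        simp only [Finset.mem_union, Finset.mem_Ico] at h
        rcases h with h | h
        · have := (hs _ h).1
          omega
        · omega
      · intro n hn
        simp only [Finset.mem_union, Finset.mem_Ico] at hn
        omega

/-- The contribution of the generators of `J_G` to the generating functions. -/
lemma sum_colonGens_idxG (ha : 2 ≤ a) (hb : 2 ≤ b) :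
    1 + qSeries * ∑ x ∈ idxG a b, pathSeries (degRevLex (Var a b))
      (colonGens (degRevLex (Var a b)) (quad a b (QF a b)) (pairAt a b x)) = gSeries a b := by
  rw [sum_idxG, gSeries]
  congr 3
  · refine Finset.sum_congr rfl fun l hl => ?_
    have hl := Finset.mem_Ico.1 hl
    rw [Finset.sum_congr rfl (g := fun _ => (1 + wSeries) ^ (l - 1)) fun k hk => ?_]
    · rw [Finset.sum_const, Nat.card_Ico, Nat.add_sub_cancel]
    · have hk := Finset.mem_Ico.1 hk
      obtain ⟨h1, h2, h3⟩ := pairAt_pos (a := a) (b := b) (k := k) (l := l) (by omega) (by omega)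
      rw [pairAt_mk, colonGens_xx (by omega) (by omega) (by omega), pathSeries_posVars, h3,
        Nat.card_Ico]
      intro n hn
      simp only [Finset.mem_Ico] at hn
      omega
  congr 1
  · refine Finset.sum_congr rfl fun l hl => ?_
    have hl := Finset.mem_Ico.1 hl
    rw [Finset.sum_congr rfl (g := fun _ => (1 + wSeries) ^ (l - 2)) fun k hk => ?_]
    · rw [Finset.sum_const, Nat.card_Ico]
    · have hk := Finset.mem_Ico.1 hk
      obtain ⟨h1, h2, h3⟩ := pairAt_pos (a := a) (b := b) (k := k) (l := l) (by omega) (by omega)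
      rw [pairAt_mk, colonGens_xy (by omega) (by omega) (by omega) (by omega), pathSeries_posVars, h3,
        card_Ico_union (by omega), show a - 1 + (l - (a + 1)) = l - 2 by omega]
      intro n hn
      simp only [Finset.mem_union, Finset.mem_Ico] at hn
      omega
  congr 1
  · refine Finset.sum_congr rfl fun l hl => ?_
    have hl := Finset.mem_Ico.1 hl
    obtain ⟨h1, h2, h3⟩ := pairAt_pos (a := a) (b := b) (k := a) (l := l) (by omega) (by omega)
    have ht := pos_varAt (a := a) (b := b) (n := 1) (by omega)
    rw [pairAt_mk, colonGens_lastx_y ha (by omega) (by omega) (by omega) ht, pathSeries_posVars_sq, h3,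
      card_Ico_union (by omega), show a - 2 + (l - (a + 1)) = l - 3 by omega]
    · intro n hn
      simp only [Finset.mem_union, Finset.mem_Ico] at hn
      omega
    · simp only [Finset.mem_union, Finset.mem_Ico]
      omega
  have hyy : ∀ l k, a + 2 ≤ k → k ≤ l → l ≤ a + b → k < a + b →
      pathSeries (degRevLex (Var a b))
        (colonGens (degRevLex (Var a b)) (quad a b (QF a b)) (pairAt a b ⟨l, k⟩)) =
      (1 + wSeries) ^ (l - 3) * (1 + qSeries) := by
    intro l k hk hkl hl hkb
    obtain ⟨h1, h2, h3⟩ := pairAt_pos (a := a) (b := b) (k := k) (l := l) (by omega) (by omega)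
    have ht := pos_varAt (a := a) (b := b) (n := 1) (by omega)
    rw [pairAt_mk, colonGens_yy ha (by omega) (by omega) (by omega) (by omega) ht,
      pathSeries_posVars_sq, h3, card_Ico_union (by omega),
      show a + 1 - 2 + (l - (a + 2)) = l - 3 by omega]
    · intro n hn
      simp only [Finset.mem_union, Finset.mem_Ico] at hn
      omega
    · simp only [Finset.mem_union, Finset.mem_Ico]
      omega
  congr 1
  · refine Finset.sum_congr rfl fun l hl => ?_
    have hl := Finset.mem_Ico.1 hl
    rw [Finset.sum_congr rfl fun k hk => ?_, Finset.sum_const, Nat.card_Ico,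
      show l + 1 - (a + 2) = l - (a + 1) by omega]
    have hk := Finset.mem_Ico.1 hk
    exact hyy l k (by omega) (by omega) (by omega) (by omega)
  · rw [Finset.sum_congr rfl fun k hk => ?_, Finset.sum_const, Nat.card_Ico,
      show a + b - (a + 2) = b - 2 by omega]
    have hk := Finset.mem_Ico.1 hk
    exact hyy _ k (by omega) (by omega) (by omega) (by omega)

lemma pathSeries_quad {Q : ℕ → ℕ → Prop}
    (s : Finset (Σ _ : ℕ, ℕ)) (hs : ∀ l k, ⟨l, k⟩ ∈ s ↔ k ≤ l ∧ Q k l)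
    (hQ : ∀ k l, k ≤ l → Q k l → l < a + b + 2) :
    pathSeries (degRevLex (Var a b)) (quad a b Q) =
      1 + qSeries * ∑ x ∈ s, pathSeries (degRevLex (Var a b))
        (colonGens (degRevLex (Var a b)) (quad a b Q) (pairAt a b x)) := by
  have h := pathSeries_vars_union_quad (V := (∅ : Finset (Var a b))) s hs hQ (by simp)
  simpa [vars] using h

/-- The omitted generator y_{b-1}² is the last one in the sort order, so omitting it changes no
other colon ideal. -/
lemma pathSeries_quadG (ha : 2 ≤ a) (hb : 2 ≤ b) :
    pathSeries (degRevLex (Var a b)) (quad a b (QG a b)) = gSeries a b := by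
  rw [pathSeries_quad (idxG a b) (mem_idxG ha), ← sum_colonGens_idxG ha hb]
  · congr 2
    refine Finset.sum_congr rfl fun ⟨l, k⟩ hx => ?_
    obtain ⟨hkl, hQ⟩ := (mem_idxG ha l k).1 hx
    obtain ⟨h1, h2, h3⟩ := pairAt_pos (a := a) (b := b) hkl (by unfold QG QF at hQ; omega)
    refine congrArg _ (colonGens_quad_congr h1 fun k' l' hkl' hlt => ?_)
    rw [h2, h3] at hlt
    unfold QG QF at *
    omega
  · intro k l hkl hQ
    unfold QG QF at hQ
    omega

lemma pathSeries_quadH_self (ha : 2 ≤ a) (hb : 2 ≤ b) :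
    pathSeries (degRevLex (Var a b)) (quad a b (QH a)) = hSeries a := by
  have := pathSeries_quadH ha hb ∅ (by simp)
  simpa [posVars_empty, vars] using this

/-- Compared with J_G there is one more first step, y_{b-1}², and its colon ideal is the sum of b -
2 variables and J_H. -/
lemma pathSeries_quadF (ha : 2 ≤ a) (hb : 2 ≤ b) :
    pathSeries (degRevLex (Var a b)) (quad a b (QF a b)) =
      gSeries a b + qSeries * ((1 + wSeries) ^ (b - 2) * hSeries a) := by
  have hnot : (⟨a + b, a + b⟩ : Σ _ : ℕ, ℕ) ∉ idxG a b := fun h => ((mem_idxG ha _ _).1 h).2.2 rfl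
  rw [pathSeries_quad (insert ⟨a + b, a + b⟩ (idxG a b)), Finset.sum_insert hnot,
    ← sum_colonGens_idxG ha hb]
  · have h3 := pos_varAt (a := a) (b := b) (n := a + b) (by omega)
    rw [pairAt_mk, colonGens_sq hb h3, pathSeries_quadH ha hb, Nat.card_Ico,
      show a + b - (a + 2) = b - 2 by omega, mul_add, add_assoc,
      add_comm (qSeries * ∑ x ∈ idxG a b, _)]
    intro n hn
    simp only [Finset.mem_Ico] at hn
    omega
  · intro l k
    rw [Finset.mem_insert, mem_idxG ha]
    simp only [Sigma.mk.injEq, heq_eq_eq, QG, QF]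
    omega
  · intro k l hkl hQ
    unfold QF at hQ
    omega

end Series

/-! ### The multidegrees of the basis elements -/

section Multidegrees

/-- Each step uses a variable before the previous one, so the multidegree is squarefree. -/
lemma sum_of_isPath_vars {σ : Type} [LinearOrder σ] [Fintype σ] {V : Finset σ}
    {l : List (σ →₀ ℕ)} (h : IsPath (degRevLex σ) (vars V) l) :
    (∀ v, l.sum v ≤ 1) ∧ (∀ v ∉ V, l.sum v = 0) ∧ l.sum.degree = l.length := by
  classical
  induction l using List.reverseRecOn generalizing V with
  | nil => simp
  | append_singleton l g ih =>
    rw [isPath_append] at h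
    obtain ⟨⟨v, hv, rfl⟩, h⟩ := h
    have hcol := colonGens_vars_union_of_mem (V := V) (S := ∅) (by simp) v
    rw [Set.union_empty] at hcol
    rw [hcol] at h
    obtain ⟨h1, h2, h3⟩ := ih h
    simp only [List.sum_append, List.sum_singleton, Finsupp.add_apply, map_add,
      Finsupp.degree_single, List.length_append, List.length_singleton, h3, and_true]
    refine ⟨fun w => ?_, fun w hw => ?_⟩
    · by_cases hwv : w = v
      · subst hwv
        rw [h2 w (by simp)]
        simp
      · have := h1 w
        rwa [Finsupp.single_eq_of_ne hwv, add_zero]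
    · have hwv : w ≠ v := fun h => hw (h ▸ hv)
      rw [h2 w fun hw' => hw (Finset.mem_filter.1 hw').1, Finsupp.single_eq_of_ne hwv, add_zero]

/-- The square comes after all the variables, so it can only be the first step. Whether it was used
shows in the exponent of `t`. -/
lemma sum_of_isPath_vars_union_sq {σ : Type} [LinearOrder σ] [Fintype σ] {V : Finset σ} {t : σ}
    (ht : t ∉ V) {l : List (σ →₀ ℕ)} (h : IsPath (degRevLex σ) (vars V ∪ {ex t + ex t}) l) :
    (∀ v ∉ V, v ≠ t → l.sum v = 0) ∧ ((l.sum t = 0 ∧ l.sum.degree = l.length) ∨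
      (l.sum t = 2 ∧ l.sum.degree = l.length + 1)) := by
  classical
  induction l using List.reverseRecOn with
  | nil => simp
  | append_singleton l g ih =>
    clear ih
    rw [isPath_append] at h
    obtain ⟨⟨v, hv, rfl⟩ | rfl, h⟩ := h
    · rw [colonGens_vars_union_of_mem (by simp)] at h
      obtain ⟨h1, h2, h3⟩ := sum_of_isPath_vars h
      have hmem : ∀ w ∉ V, w ∉ V.filter (· < v) := fun w hw hw' => hw (Finset.mem_filter.1 hw').1
      simp only [List.sum_append, List.sum_singleton, Finsupp.add_apply, map_add,
        Finsupp.degree_single, List.length_append, List.length_singleton, h3]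
      refine ⟨fun w hw _ => ?_, Or.inl ⟨?_, trivial⟩⟩
      · rw [h2 w (hmem w hw), Finsupp.single_eq_of_ne (by rintro rfl; exact hw hv), add_zero]
      · rw [h2 t (hmem t ht), Finsupp.single_eq_of_ne (by rintro rfl; exact ht hv), add_zero]
    · rw [colonGens_vars_union (S := {ex t + ex t}) (by simp) (by simp)
        (fun e he v hv => by
          rw [Set.mem_singleton_iff.1 he]
          exact sq_apply_eq_zero (by rintro rfl; exact ht hv)) rfl, colonGens_singleton,
        Set.union_empty] at h
      obtain ⟨h1, h2, h3⟩ := sum_of_isPath_vars h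
      simp only [List.sum_append, List.sum_singleton, Finsupp.add_apply, map_add,
        Finsupp.degree_single, List.length_append, List.length_singleton, h3]
      refine ⟨fun w hw hwt => ?_, Or.inr ⟨?_, trivial⟩⟩
      · rw [h2 w hw, Finsupp.single_eq_of_ne hwt, add_zero, add_zero]
      · rw [h2 t ht]
        simp

variable {a b : ℕ}

/-- The excess of degree over length is readable from the multidegree: it is 0 exactly when no x
occurs, and 2 exactly when moreover x_1 has exponent 2 and y_0 occurs, because x_1² is only
available after x_a y_0. -/
lemma sum_of_isPath_quadH (ha : 2 ≤ a) (hb : 2 ≤ b) {t y₀ : Var a b} (ht : pos t = 1)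
    (hy₀ : pos y₀ = a + 1) {s : Finset ℕ}
    (hs : ∀ n ∈ s, a + 2 ≤ n ∧ n < a + b) {l : List (Var a b →₀ ℕ)}
    (h : IsPath (degRevLex (Var a b)) (vars (posVars a b s) ∪ quad a b (QH a)) l) :
    (∀ v, a + b ≤ pos v → l.sum v = 0) ∧
      ((l.sum.degree = l.length ∧ ∀ v, pos v ≤ a → l.sum v = 0) ∨
        (l.sum.degree = l.length + 1 ∧ (∃ v, pos v ≤ a ∧ l.sum v ≠ 0) ∧
          (l.sum t ≤ 1 ∨ l.sum y₀ = 0)) ∨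
        (l.sum.degree = l.length + 2 ∧ (∃ v, pos v ≤ a ∧ l.sum v ≠ 0) ∧
          l.sum t = 2 ∧ l.sum y₀ ≠ 0)) := by
  induction l using List.reverseRecOn with
  | nil => simp
  | append_singleton l g ih =>
    clear ih
    rw [isPath_append] at h
    obtain ⟨⟨z, hz, rfl⟩ | hg, h⟩ := h
    · rw [colonGens_vars_union_of_mem fun e he => (degree_of_mem_quad he).ge] at h
      obtain ⟨h1, h2, h3⟩ := sum_of_isPath_vars h
      have hz := hs _ (mem_posVars.1 hz)
      have h2' : ∀ v : Var a b, (pos v ≤ a ∨ a + b ≤ pos v) → l.sum v = 0 := fun v hv => by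
        refine h2 v fun hv' => ?_
        have := hs _ (mem_posVars.1 (Finset.mem_filter.1 hv').1)
        omega
      simp only [List.sum_append, List.sum_singleton, Finsupp.add_apply, map_add, ex_apply_pos,
        Finsupp.degree_single, List.length_append, List.length_singleton, h3]
      refine ⟨fun v hv => ?_, Or.inl ⟨trivial, fun v hv => ?_⟩⟩
      · rw [h2' v (Or.inr hv), if_neg (by omega)]
      · rw [h2' v (Or.inl hv), if_neg (by omega)]
    · rw [colonGens_vars_union (fun e he => (degree_of_mem_quad he).ge) (isAntichain_quad _)
        (fun e he v hv => apply_eq_zero_of_mem_quad he fun k l hkl hQ => by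
          have := hs _ (mem_posVars.1 hv)
          unfold QH at hQ
          omega) hg] at h
      obtain ⟨v, w, hvw, hQ, rfl⟩ := hg
      rw [colonGens_quad_congr (Q' := QF a b) hvw fun k l hkl hlt => by
        have := pos_le_iff.2 hvw
        unfold QH at *
        unfold QF
        omega] at h
      have hvw' := pos_le_iff.2 hvw
      simp only [List.sum_append, List.sum_singleton, Finsupp.add_apply, map_add, ex_apply_pos,
        Finsupp.degree_single, List.length_append, List.length_singleton]
      have hx : ∃ v' : Var a b, pos v' ≤ a ∧
          l.sum v' + ((if pos v = pos v' then 1 else 0) + if pos w = pos v' then 1 else 0) ≠ 0 :=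
        ⟨v, by unfold QH at hQ; omega, by rw [if_pos rfl]; omega⟩
      simp only [hx, true_and]
      rcases hQ with hQ | ⟨hQ1, hQ2, hQ3⟩
      · rw [colonGens_xx (by omega) (by omega) (by omega), ← vars_union, ← posVars_union] at h
        obtain ⟨h1, h2, h3⟩ := sum_of_isPath_vars h
        refine ⟨fun z hz => ?_, Or.inr (Or.inl ⟨by omega, Or.inr ?_⟩)⟩
        · rw [h2 z ?_, if_neg (by omega), if_neg (by omega), add_zero, add_zero]
          simp only [mem_posVars, Finset.mem_union, Finset.mem_Ico]
          rintro (h | h)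
          · have := hs _ h
            omega
          · omega
        · rw [h2 y₀ ?_, if_neg (by omega), if_neg (by omega), add_zero, add_zero]
          simp only [mem_posVars, Finset.mem_union, Finset.mem_Ico]
          rintro (h | h)
          · have := hs _ h
            omega
          · omega
      · rcases hQ2.lt_or_eq with hva | hva
        · rw [colonGens_xy (by omega) (by omega) (by omega) (by omega), ← vars_union,
            ← posVars_union] at h
          obtain ⟨h1, h2, h3⟩ := sum_of_isPath_vars h
          refine ⟨fun z hz => ?_, Or.inr (Or.inl ⟨by omega, Or.inl ?_⟩)⟩
          · rw [h2 z ?_, if_neg (by omega), if_neg (by omega), add_zero, add_zero]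
            simp only [mem_posVars, Finset.mem_union, Finset.mem_Ico]
            rintro (h | h)
            · have := hs _ h
              omega
            · omega
          · rw [if_neg (by omega), if_neg (by omega)]
            exact h1 t
        · rw [colonGens_lastx_y ha (by omega) (by omega) (by omega) ht, ← Set.union_assoc,
            ← vars_union, ← posVars_union] at h
          obtain ⟨h1, h2⟩ := sum_of_isPath_vars_union_sq (by
            simp only [mem_posVars, Finset.mem_union, Finset.mem_Ico]
            rintro (h | h)
            · have := hs _ h
              omega
            · omega) h
          refine ⟨fun z hz => ?_, ?_⟩
          · rw [h1 z ?_ ?_, if_neg (by omega), if_neg (by omega), add_zero, add_zero]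
            · simp only [mem_posVars, Finset.mem_union, Finset.mem_Ico]
              rintro (h | h)
              · have := hs _ h
                omega
              · omega
            · rintro rfl
              omega
          · rw [if_neg (c := pos v = pos t) (by omega), if_neg (c := pos w = pos t) (by omega),
              if_neg (c := pos v = pos y₀) (by omega), if_pos (c := pos w = pos y₀) (by omega)]
            omega

/-- Exponent 2 of y_{b-1} detects the first step y_{b-1}²; the excess is then one more than that for
J_H. Otherwise the excess is 2 exactly when x_1² was used after a first step containing some y, that
is, when x_1 has exponent 2 and some y occurs. -/
lemma sum_of_isPath_quadF (ha : 2 ≤ a) (hb : 2 ≤ b) {t y₀ c : Var a b} (ht : pos t = 1)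
    (hy₀ : pos y₀ = a + 1) (hc : pos c = a + b) {l : List (Var a b →₀ ℕ)} (hl : l ≠ [])
    (h : IsPath (degRevLex (Var a b)) (quad a b (QF a b)) l) :
    (l.sum c ≤ 1 ∧
      ((l.sum.degree = l.length + 1 ∧ (l.sum t ≤ 1 ∨ ∀ v, a < pos v → l.sum v = 0)) ∨
        (l.sum.degree = l.length + 2 ∧ l.sum t = 2 ∧ ∃ v, a < pos v ∧ l.sum v ≠ 0))) ∨
    (l.sum c = 2 ∧
      ((l.sum.degree = l.length + 1 ∧ ∀ v, pos v ≤ a → l.sum v = 0) ∨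
        (l.sum.degree = l.length + 2 ∧ (∃ v, pos v ≤ a ∧ l.sum v ≠ 0) ∧
          (l.sum t ≤ 1 ∨ l.sum y₀ = 0)) ∨
        (l.sum.degree = l.length + 3 ∧ (∃ v, pos v ≤ a ∧ l.sum v ≠ 0) ∧
          l.sum t = 2 ∧ l.sum y₀ ≠ 0))) := by
  induction l using List.reverseRecOn with
  | nil => exact absurd rfl hl
  | append_singleton l g ih =>
    clear ih hl
    rw [isPath_append] at h
    obtain ⟨⟨v, w, hvw, hQ, rfl⟩, h⟩ := h
    have hvw' := pos_le_iff.2 hvw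
    simp only [List.sum_append, List.sum_singleton, Finsupp.add_apply, map_add, ex_apply_pos,
      Finsupp.degree_single, List.length_append, List.length_singleton]
    have hy : a < pos w → ∃ z : Var a b, a < pos z ∧
        l.sum z + ((if pos v = pos z then 1 else 0) + if pos w = pos z then 1 else 0) ≠ 0 :=
      fun hw => ⟨w, hw, by rw [if_pos (c := pos w = pos w) rfl]; omega⟩
    rcases hQ with hQ | hQ | hQ
    · left
      rw [colonGens_xx (by omega) (by omega) (by omega)] at h
      obtain ⟨h1, h2, h3⟩ := sum_of_isPath_vars h
      have hz : ∀ z : Var a b, a < pos z →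
          l.sum z + ((if pos v = pos z then 1 else 0) + if pos w = pos z then 1 else 0) = 0 := by
        intro z hz
        rw [h2 z, if_neg (by omega), if_neg (by omega)]
        simp only [mem_posVars, Finset.mem_Ico]
        omega
      refine ⟨?_, Or.inl ⟨by omega, Or.inr hz⟩⟩
      rw [hz c (by omega)]
      omega
    · left
      rcases hQ.2.1.lt_or_eq with hva | hva
      · rw [colonGens_xy (by omega) (by omega) (by omega) (by omega)] at h
        obtain ⟨h1, h2, h3⟩ := sum_of_isPath_vars h
        refine ⟨?_, Or.inl ⟨by omega, Or.inl ?_⟩⟩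
        · rw [if_neg (by omega), if_neg (by omega)]
          exact h1 c
        · rw [if_neg (by omega), if_neg (by omega)]
          exact h1 t
      · rw [colonGens_lastx_y ha (by omega) (by omega) (by omega) ht] at h
        obtain ⟨h1, h2⟩ := sum_of_isPath_vars_union_sq (by
          simp only [mem_posVars, Finset.mem_union, Finset.mem_Ico]
          omega) h
        refine ⟨?_, ?_⟩
        · rw [h1 c, if_neg (by omega), if_neg (by omega)]
          · omega
          · simp only [mem_posVars, Finset.mem_union, Finset.mem_Ico]
            omega
          · rintro rfl
            omega
        · simp only [hy (by omega), and_true]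
          rw [if_neg (c := pos v = pos t) (by omega), if_neg (c := pos w = pos t) (by omega)]
          omega
    · by_cases hvb : pos v = a + b
      · right
        obtain rfl : w = v := pos_inj.1 (by omega)
        rw [colonGens_sq hb hvb] at h
        obtain ⟨h1, h2⟩ := sum_of_isPath_quadH ha hb ht hy₀
          (fun n hn => Finset.mem_Ico.1 hn) h
        rw [h1 c (by omega), if_pos (by omega)]
        refine ⟨rfl, ?_⟩
        rw [if_neg (c := pos w = pos t) (by omega), if_neg (c := pos w = pos y₀) (by omega)]
        have hx : ∀ z : Var a b, pos z ≤ a →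
            l.sum z + ((if pos w = pos z then 1 else 0) + if pos w = pos z then 1 else 0) =
              l.sum z := fun z hz => by
          rw [if_neg (by omega), add_zero, add_zero]
        rcases h2 with ⟨h2, h3⟩ | ⟨h2, ⟨z, hz, h3⟩, h4⟩ | ⟨h2, ⟨z, hz, h3⟩, h4⟩
        · refine Or.inl ⟨by omega, fun z hz => ?_⟩
          rw [hx z hz]
          exact h3 z hz
        · refine Or.inr (Or.inl ⟨by omega, ⟨z, hz, ?_⟩, by omega⟩)
          rwa [hx z hz]
        · refine Or.inr (Or.inr ⟨by omega, ⟨z, hz, ?_⟩, by omega⟩)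
          rwa [hx z hz]
      · left
        rw [colonGens_yy ha (by omega) (by omega) (by omega) (by omega) ht] at h
        obtain ⟨h1, h2⟩ := sum_of_isPath_vars_union_sq (by
          simp only [mem_posVars, Finset.mem_union, Finset.mem_Ico]
          omega) h
        refine ⟨?_, ?_⟩
        · rw [h1 c, if_neg (by omega)]
          · split_ifs <;> omega
          · simp only [mem_posVars, Finset.mem_union, Finset.mem_Ico]
            omega
          · rintro rfl
            omega
        · simp only [hy (by omega), and_true]
          rw [if_neg (c := pos v = pos t) (by omega), if_neg (c := pos w = pos t) (by omega)]
          omega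

/-- Equal multidegrees would mean equal degrees and equal excess of degree over length, hence equal
lengths. -/
lemma sum_ne_of_isPath_quadF (ha : 2 ≤ a) (hb : 2 ≤ b) {l l' : List (Var a b →₀ ℕ)}
    (h : IsPath (degRevLex (Var a b)) (quad a b (QF a b)) l)
    (h' : IsPath (degRevLex (Var a b)) (quad a b (QF a b)) l') (hl : l'.length = l.length + 1) :
    l.sum ≠ l'.sum := by
  intro heq
  have ht := pos_varAt (a := a) (b := b) (n := 1) (by omega)
  have hy₀ := pos_varAt (a := a) (b := b) (n := a + 1) (by omega)
  have hc := pos_varAt (a := a) (b := b) (n := a + b) (by omega)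
  have h1' := sum_of_isPath_quadF ha hb ht hy₀ hc (by rintro rfl; simp at hl) h'
  by_cases hl0 : l = []
  · subst hl0
    rw [← heq] at h1'
    simp only [List.sum_nil, map_zero, Finsupp.coe_zero, Pi.zero_apply] at h1'
    omega
  have h1 := sum_of_isPath_quadF ha hb ht hy₀ hc hl0 h
  rw [← heq, hl] at h1'
  have hxx : ¬ ((∃ v : Var a b, pos v ≤ a ∧ l.sum v ≠ 0) ∧ ∀ v, pos v ≤ a → l.sum v = 0) :=
    fun ⟨⟨v, hv, hne⟩, h⟩ => hne (h v hv)
  have hyy : ¬ ((∃ v : Var a b, a < pos v ∧ l.sum v ≠ 0) ∧ ∀ v, a < pos v → l.sum v = 0) :=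
    fun ⟨⟨v, hv, hne⟩, h⟩ => hne (h v hv)
  -- The quantified conditions become atoms related only by `hxx` and `hyy`; what remains is
  -- propositional logic with linear arithmetic.
  generalize (∃ v : Var a b, pos v ≤ a ∧ l.sum v ≠ 0) = p1 at *
  generalize (∀ v : Var a b, pos v ≤ a → l.sum v = 0) = p2 at *
  generalize (∃ v : Var a b, a < pos v ∧ l.sum v ≠ 0) = p3 at *
  generalize (∀ v : Var a b, a < pos v → l.sum v = 0) = p4 at *
  grind

end Multidegrees

/-! ### The Schreyer resolutions of the carpet -/

section Resolutions

variable {R : Type*} [CommRing R] [Nontrivial R]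

theorem IsSchreyerResolution.isResolution {σ : Type} [Finite σ] {m : MonomialOrder σ}
    {F : GradedFreeComplex σ R} {I : Ideal (MvPolynomial σ R)} (h : IsSchreyerResolution m F I) :
    F.IsResolution I := by
  obtain ⟨S, hS⟩ := isSchreyerResolution_iff.1 h
  exact hS.isResolution

theorem IsSchreyerResolution.exists_equiv_path {σ : Type} [Finite σ] {m : MonomialOrder σ}
    {F : GradedFreeComplex σ R} {I : Ideal (MvPolynomial σ R)} (h : IsSchreyerResolution m F I)
    {G : Set (σ →₀ ℕ)} (hG : IsAntichain (· ≤ ·) G)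
    (hin : initialIdeal m I = Ideal.span ((fun s => monomial s (1 : R)) '' G)) (p : ℕ) :
    ∃ e : F.ι p ≃ Path m G p, ∀ k, F.deg p k = ((e k).1.sum.degree : ℕ) := by
  obtain ⟨S, hS⟩ := isSchreyerResolution_iff.1 h
  exact hS.exists_equiv_path hG hin p

/-- Monomial ideals have Schreyer resolutions with multigraded differentials. -/
theorem exists_isSchreyerResolution_monomial {σ : Type} [Finite σ] (m : MonomialOrder σ)
    {G : Set (σ →₀ ℕ)} (hG : IsAntichain (· ≤ ·) G) :
    ∃ F : GradedFreeComplex σ R,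
      IsSchreyerResolution m F (Ideal.span ((fun s => monomial s (1 : R)) '' G)) ∧
      ∃ e : ∀ p, F.ι p ≃ Path m G p, ∀ p i k, ∀ u ∈ (F.d p i k).support,
        u + (e p i).1.sum = (e (p + 1) k).1.sum := by
  classical
  refine exists_isSchreyerResolution (W := AddMonoidHom.id _) hG (initialIdeal_span_monomial m G)
    (fun u v h => congrArg _ h) fun g hg => ⟨monomial g 1, Ideal.subset_span ⟨g, hg, rfl⟩, ?_, ?_⟩
  · rw [coeff_monomial, if_pos rfl]
    exact isUnit_one
  · intro u hu
    obtain rfl := Finset.mem_singleton.1 (support_monomial_subset hu)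
    exact ⟨rfl, fun h => absurd rfl h⟩

variable {a b : ℕ}

theorem exists_isSchreyerResolution_carpetIdeal (ha : 2 ≤ a) (hb : 2 ≤ b) :
    ∃ F, IsSchreyerResolution (degRevLex (Var a b)) F (carpetIdeal R a b) := by
  obtain ⟨F, hF, -⟩ := exists_isSchreyerResolution (R := R) (m := degRevLex (Var a b))
    (W := (Finsupp.degree : (Var a b →₀ ℕ) →+ ℕ))
    (isAntichain_quad _) (initialIdeal_carpetIdeal ha hb) (fun u v h => h) fun g hg => by
      obtain ⟨f, hf, h1, h2⟩ := exists_lead_of_mem_quad (R := R) hg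
      exact ⟨f, hf, h1 ▸ isUnit_one, h2⟩
  exact ⟨F, hF⟩

theorem initialIdeal_carpetInitialIdeal (ha : 2 ≤ a) (hb : 2 ≤ b) :
    initialIdeal (degRevLex (Var a b)) (carpetInitialIdeal R a b) =
      Ideal.span ((fun s => monomial s (1 : R)) '' quad a b (QF a b)) := by
  rw [carpetInitialIdeal, initialIdeal_carpetIdeal ha hb, initialIdeal_span_monomial]

/-- With multigraded differentials a constant term would join two paths of consecutive lengths with
equal multidegree. -/
theorem exists_isMinimalResolution (ha : 2 ≤ a) (hb : 2 ≤ b) :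
    ∃ F, IsSchreyerResolution (degRevLex (Var a b)) F (carpetInitialIdeal R a b) ∧
      F.IsMinimalResolution (carpetInitialIdeal R a b) := by
  rw [carpetInitialIdeal, initialIdeal_carpetIdeal ha hb]
  obtain ⟨F, hF, e, he⟩ := exists_isSchreyerResolution_monomial (R := R) (degRevLex (Var a b))
    (isAntichain_quad (a := a) (b := b) (QF a b))
  refine ⟨F, hF, hF.isResolution, fun p i k => ?_⟩
  by_contra hne
  have h := he p i k 0 (mem_support_iff.2 hne)
  rw [zero_add] at h
  exact sum_ne_of_isPath_quadF ha hb (e p i).2.2 (e (p + 1) k).2.2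
    (by rw [(e p i).2.1, (e (p + 1) k).2.1]) h

/-- The syzygies of an arbitrary Schreyer resolution need not be multigraded, so the argument by
multidegrees does not apply. Its ranks are those of the multigraded one, and a resolution with
minimal ranks is minimal. -/
theorem IsSchreyerResolution.isMinimalResolution_carpetInitialIdeal (ha : 2 ≤ a) (hb : 2 ≤ b)
    {F : GradedFreeComplex (Var a b) R}
    (h : IsSchreyerResolution (degRevLex (Var a b)) F (carpetInitialIdeal R a b)) :
    F.IsMinimalResolution (carpetInitialIdeal R a b) := by
  obtain ⟨F', hF', hmin⟩ := exists_isMinimalResolution (R := R) ha hb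
  have hin := initialIdeal_carpetInitialIdeal (R := R) ha hb
  refine ⟨h.isResolution, h.isResolution.isMinimal_of_card_eq ?_ hmin fun p => ?_⟩
  · rw [carpetInitialIdeal, initialIdeal_carpetIdeal ha hb]
    exact isHomogeneousIdeal_span_monomial _
  · obtain ⟨e, -⟩ := h.exists_equiv_path (isAntichain_quad _) hin p
    obtain ⟨e', -⟩ := hF'.exists_equiv_path (isAntichain_quad _) hin p
    exact Nat.card_congr (e.trans e'.symm)

theorem exists_equiv_path_of_carpet (ha : 2 ≤ a) (hb : 2 ≤ b) {F : GradedFreeComplex (Var a b) R}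
    (h : F.IsMinimalResolution (carpetInitialIdeal R a b) ∨
      IsSchreyerResolution (degRevLex (Var a b)) F (carpetIdeal R a b)) (p : ℕ) :
    ∃ e : F.ι p ≃ Path (degRevLex (Var a b)) (quad a b (QF a b)) p,
      ∀ k, F.deg p k = ((e k).1.sum.degree : ℕ) := by
  rcases h with h | h
  · obtain ⟨F', hF', hmin⟩ := exists_isMinimalResolution (R := R) ha hb
    have hJ : IsHomogeneousIdeal (carpetInitialIdeal R a b) := by
      rw [carpetInitialIdeal, initialIdeal_carpetIdeal ha hb]
      exact isHomogeneousIdeal_span_monomial _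
    obtain ⟨e, he⟩ := h.exists_equiv hJ hmin p
    obtain ⟨e', he'⟩ := hF'.exists_equiv_path (isAntichain_quad _)
      (initialIdeal_carpetInitialIdeal (R := R) ha hb) p
    refine ⟨e.trans e', fun k => ?_⟩
    rw [← he, he', Equiv.trans_apply]
  · exact h.exists_equiv_path (isAntichain_quad _) (initialIdeal_carpetIdeal ha hb) p

end Resolutions

/-! ### Betti numbers and generating functions -/

section Betti

variable {σ : Type} [Finite σ] {m : MonomialOrder σ} {S : Set (σ →₀ ℕ)} [Finite S]
  {R : Type*} [CommRing R] {F : GradedFreeComplex σ R} {p : ℕ}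

lemma sum_X_pow_eq_pathPoly (e : F.ι p ≃ Path m S p) :
    ∑ k, (Polynomial.X : Polynomial ℤ) ^ (e k).1.sum.degree = pathPoly m S p := by
  rw [pathPoly, finsum_eq_sum_of_fintype]
  exact e.sum_comp fun k => (Polynomial.X : Polynomial ℤ) ^ k.1.sum.degree

lemma coeff_pathPoly (e : F.ι p ≃ Path m S p) (he : ∀ k, F.deg p k = ((e k).1.sum.degree : ℕ))
    (j : ℕ) : (pathPoly m S p).coeff j = F.betti p j := by
  rw [← sum_X_pow_eq_pathPoly e, coeff_sum_X_pow, GradedFreeComplex.betti]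
  simp only [he, Nat.cast_inj]

lemma exists_of_betti_ne_zero (e : F.ι p ≃ Path m S p)
    (he : ∀ k, F.deg p k = ((e k).1.sum.degree : ℕ)) {j : ℤ} (h : F.betti p j ≠ 0) :
    ∃ n : ℕ, j = n ∧ (pathPoly m S p).coeff n ≠ 0 := by
  have hne : Nonempty {i : F.ι p // F.deg p i = j} := by
    by_contra hne
    rw [not_nonempty_iff] at hne
    exact h Nat.card_of_isEmpty
  obtain ⟨i, rfl⟩ := hne
  refine ⟨_, he i, ?_⟩
  rw [coeff_pathPoly e he, ← he i]
  exact_mod_cast h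

omit [Finite σ] in
lemma betti_deg_ne_zero (F : GradedFreeComplex σ R) (p : ℕ) (i : F.ι p) :
    F.betti p (F.deg p i) ≠ 0 := by
  have : Nonempty {k : F.ι p // F.deg p k = F.deg p i} := ⟨i, rfl⟩
  exact Nat.card_pos.ne'

end Betti

/-! ### The coefficients of the generating function -/

section Coefficients

open Polynomial in
-- In length and degree, w has bidegree (1, 1) and q has bidegree (1, 2). Thus q^i A(w) is
-- concentrated in degrees p + i, which is one strand of the Betti table.
lemma coeff_qSeries_pow_mul_aeval (i p j : ℕ) (A : Polynomial ℤ) :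
    (PowerSeries.coeff p (qSeries ^ i * Polynomial.aeval wSeries A)).coeff j =
      if i ≤ p ∧ j = p + i then A.coeff (p - i) else 0 := by
  induction A using Polynomial.induction_on' with
  | add A B hA hB =>
    rw [map_add, mul_add, map_add, Polynomial.coeff_add, hA, hB, Polynomial.coeff_add]
    split_ifs <;> simp
  | monomial k c =>
    have h : qSeries ^ i * Polynomial.aeval wSeries (Polynomial.monomial k c) =
        PowerSeries.X ^ (i + k) * PowerSeries.C (Polynomial.C c * Polynomial.X ^ (2 * i + k)) := by
      rw [Polynomial.aeval_monomial, qSeries, wSeries]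
      simp only [map_mul, map_pow, mul_pow, pow_add, pow_mul, eq_intCast, map_intCast]
      ring
    rw [h, PowerSeries.coeff_X_pow_mul']
    by_cases hp : i + k ≤ p
    · rw [if_pos hp, PowerSeries.coeff_C]
      by_cases hpk : p = i + k
      · subst hpk
        rw [if_pos (Nat.sub_self _), Polynomial.coeff_C_mul_X_pow, Polynomial.coeff_monomial]
        by_cases hj : j = 2 * i + k
        · rw [if_pos hj, if_pos (by omega), if_pos (by omega)]
        · rw [if_neg hj, if_neg (by omega)]
      · rw [if_neg (by omega), Polynomial.coeff_zero, Polynomial.coeff_monomial,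
          if_neg (c := k = p - i) (by omega), ite_self]
    · rw [if_neg hp, Polynomial.coeff_zero]
      split_ifs with h
      · rw [Polynomial.coeff_monomial, if_neg (by omega)]
      · rfl

/-- The contribution of the generators `x_i x_j`. -/
def linPoly (a : ℕ) : Polynomial ℤ := ∑ l ∈ Finset.Ico 1 a, l • (1 + Polynomial.X) ^ (l - 1)

/-- The part of the generating function shared by the first and the second strand. -/
def midPoly (a b : ℕ) : Polynomial ℤ :=
  ∑ l ∈ Finset.Ico (a + 1) (a + b), (1 + Polynomial.X) ^ (l - 3) +
    (∑ l ∈ Finset.Ico (a + 2) (a + b), (l - (a + 1)) • (1 + Polynomial.X) ^ (l - 3) +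
      (b - 2) • (1 + Polynomial.X) ^ (a + b - 3))

/-- The generating function of the first strand. -/
def firstPoly (a b : ℕ) : Polynomial ℤ :=
  linPoly a + (∑ l ∈ Finset.Ico (a + 1) (a + b), (a - 2) • (1 + Polynomial.X) ^ (l - 2) +
    (midPoly a b + (1 + Polynomial.X) ^ (b - 2)))

/-- The generating function of the second strand. -/
def secondPoly (a b : ℕ) : Polynomial ℤ :=
  midPoly a b + (1 + Polynomial.X) ^ (b - 2) *
    (linPoly a + ((a - 2) • (1 + Polynomial.X) ^ (a - 1) + (1 + Polynomial.X) ^ (a - 2)))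

/-- The generating function of the third strand. -/
def thirdPoly (a b : ℕ) : Polynomial ℤ := (1 + Polynomial.X) ^ (b - 2) * (1 + Polynomial.X) ^ (a - 2)

variable {a b : ℕ}

lemma series_eq_strands : gSeries a b + qSeries * ((1 + wSeries) ^ (b - 2) * hSeries a) =
    qSeries ^ 0 * Polynomial.aeval wSeries (1 : Polynomial ℤ) +
      qSeries ^ 1 * Polynomial.aeval wSeries (firstPoly a b) +
      qSeries ^ 2 * Polynomial.aeval wSeries (secondPoly a b) +
      qSeries ^ 3 * Polynomial.aeval wSeries (thirdPoly a b) := by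
  simp only [gSeries, hSeries, firstPoly, secondPoly, thirdPoly, linPoly, midPoly, map_add, map_mul,
    map_sum, map_pow, map_natCast, map_one, Polynomial.aeval_X, nsmul_eq_mul, ← mul_assoc,
    ← Finset.sum_mul]
  ring

lemma coeff_strands (p j : ℕ) : (PowerSeries.coeff p
    (gSeries a b + qSeries * ((1 + wSeries) ^ (b - 2) * hSeries a))).coeff j =
      (if p = 0 ∧ j = 0 then 1 else 0) +
      (if 1 ≤ p ∧ j = p + 1 then (firstPoly a b).coeff (p - 1) else 0) +
      (if 2 ≤ p ∧ j = p + 2 then (secondPoly a b).coeff (p - 2) else 0) +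
      (if 3 ≤ p ∧ j = p + 3 then (thirdPoly a b).coeff (p - 3) else 0) := by
  rw [series_eq_strands]
  simp only [map_add, Polynomial.coeff_add, coeff_qSeries_pow_mul_aeval]
  congr 3
  by_cases hp : p = 0
  · subst hp
    simp
  · simp [hp, Polynomial.coeff_one]

lemma coeff_one_add_X_pow (n k : ℕ) :
    ((1 + Polynomial.X : Polynomial ℤ) ^ n).coeff k = n.choose k := by
  rw [Polynomial.coeff_one_add_X_pow]

/-- Absorption, l C(l-1, k) = (k+1) C(l, k+1), followed by the hockey-stick sum. -/
lemma coeff_linPoly (k : ℕ) : (linPoly a).coeff k = ((k + 1) * a.choose (k + 2) : ℕ) := by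
  simp only [linPoly, Polynomial.finsetSum_coeff, Polynomial.coeff_smul, coeff_one_add_X_pow]
  induction a with
  | zero => simp
  | succ n ih =>
    cases n with
    | zero => simp [Nat.choose_eq_zero_of_lt]
    | succ n =>
      rw [Finset.sum_Ico_succ_top (by omega), ih, Nat.choose_succ_succ (n + 1) (k + 1),
        Nat.add_sub_cancel, nsmul_eq_mul]
      have := Nat.add_one_mul_choose_eq n k
      rw [← Nat.cast_mul, this]
      push_cast
      ring

/-- The coefficients of `midPoly`. -/
def midCoeff (a b k : ℕ) : ℕ := ∑ j ∈ Finset.Icc 0 (b - 2), (a + j - 2).choose k +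
  ∑ j ∈ Finset.Icc 1 (b - 2), j * (a + j - 2).choose k + (b - 2) * (a - 2 + b - 1).choose k

lemma sum_Ico_eq_sum_Icc {M : Type*} [AddCommMonoid M] (hb : 2 ≤ b) (i : ℕ) (f : ℕ → M) :
    ∑ l ∈ Finset.Ico (a + 1 + i) (a + b), f l = ∑ j ∈ Finset.Icc i (b - 2), f (a + 1 + j) := by
  refine Finset.sum_nbij' (fun l => l - (a + 1)) (fun j => a + 1 + j) ?_ ?_ ?_ ?_ ?_ <;>
    intro l hl <;> simp only [Finset.mem_Ico, Finset.mem_Icc] at hl ⊢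
  · omega
  · omega
  · omega
  · omega
  · rw [show a + 1 + (l - (a + 1)) = l by omega]

lemma coeff_midPoly (ha : 2 ≤ a) (hb : 2 ≤ b) (k : ℕ) :
    (midPoly a b).coeff k = midCoeff a b k := by
  simp only [midPoly, midCoeff, Polynomial.coeff_add, Polynomial.finsetSum_coeff,
    Polynomial.coeff_smul, coeff_one_add_X_pow]
  rw [sum_Ico_eq_sum_Icc hb 0, sum_Ico_eq_sum_Icc hb 1, ← add_assoc]
  push_cast
  congr 1
  · congr 1
    · refine Finset.sum_congr rfl fun j _ => ?_
      rw [show a + 1 + j - 3 = a + j - 2 by omega]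
    · refine Finset.sum_congr rfl fun j _ => ?_
      rw [show a + 1 + j - 3 = a + j - 2 by omega, show a + 1 + j - (a + 1) = j by omega,
        nsmul_eq_mul]
  · rw [nsmul_eq_mul, show a + b - 3 = a - 2 + b - 1 by omega]

lemma coeff_firstPoly (ha : 2 ≤ a) (hb : 2 ≤ b) (k : ℕ) : (firstPoly a b).coeff k =
    ((k + 1) * a.choose (k + 2) + (∑ j ∈ Finset.Icc 0 (b - 2), (a - 2) * (a + j - 1).choose k +
      (midCoeff a b k + (b - 2).choose k)) : ℕ) := by
  simp only [firstPoly, Polynomial.coeff_add, coeff_linPoly, Polynomial.finsetSum_coeff,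
    Polynomial.coeff_smul, coeff_one_add_X_pow, coeff_midPoly ha hb]
  rw [sum_Ico_eq_sum_Icc hb 0]
  push_cast
  congr 2
  refine Finset.sum_congr rfl fun j _ => ?_
  rw [show a + 1 + j - 2 = a + j - 1 by omega, nsmul_eq_mul]

/-- The coefficients of the generating function of the second strand of `J_H`. -/
def lastCoeff (a k : ℕ) : ℕ :=
  (k + 1) * a.choose (k + 2) + ((a - 2) * (a - 1).choose k + (a - 2).choose k)

lemma coeff_secondPoly (ha : 2 ≤ a) (hb : 2 ≤ b) (k : ℕ) : (secondPoly a b).coeff k =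
    (midCoeff a b k + ∑ q ∈ Finset.Icc 0 k, (b - 2).choose q * lastCoeff a (k - q) : ℕ) := by
  simp only [secondPoly, Polynomial.coeff_add, Polynomial.coeff_mul, coeff_linPoly,
    Polynomial.coeff_smul, coeff_one_add_X_pow, coeff_midPoly ha hb]
  rw [Finset.Nat.sum_antidiagonal_eq_sum_range_succ_mk]
  push_cast
  congr 1
  refine Finset.sum_congr ?_ fun q _ => ?_
  · ext q
    simp only [Finset.mem_range, Finset.mem_Icc]
    omega
  · rw [lastCoeff, nsmul_eq_mul]
    push_cast
    ring

lemma coeff_thirdPoly (ha : 2 ≤ a) (hb : 2 ≤ b) (k : ℕ) :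
    (thirdPoly a b).coeff k = ((a + b - 4).choose k : ℕ) := by
  rw [thirdPoly, ← pow_add, coeff_one_add_X_pow, show b - 2 + (a - 2) = a + b - 4 by omega]

/-- Translates the coefficients coming from the colon ideals into the closed form of the second
strand. Pascal's rule expands everything in C(n, s), C(n, s+1), C(n, s+2), and the ratio identity
`hmul` does the rest; r = 0, 1 are separate because the last binomial then vanishes. -/
lemma choose_identity (n r : ℕ) : (n : ℤ) * (n + 1).choose r + n.choose r =
    ((n : ℤ) + 1 - r) * (n + 2).choose r + binom n ((r : ℤ) - 2) := by
  have hmul : ∀ k : ℕ, (n.choose (k + 1) : ℤ) * (k + 1) = n.choose k * ((n : ℤ) - k) := by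
    intro k
    rcases le_or_gt k n with h | h
    · have := congrArg (Nat.cast : ℕ → ℤ) (Nat.choose_succ_right_eq n k)
      push_cast [h] at this
      exact this
    · simp [Nat.choose_eq_zero_of_lt h, Nat.choose_eq_zero_of_lt (show n < k + 1 by omega)]
  match r with
  | 0 => simp [binom]
  | 1 =>
    simp [binom]
    ring
  | s + 2 =>
    rw [binom, if_pos (by push_cast; omega), show ((s + 2 : ℕ) : ℤ) - 2 = (s : ℕ) by push_cast; ring,
      Int.toNat_natCast, Nat.choose_succ_succ (n + 1), Nat.choose_succ_succ n (s + 1),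
      Nat.choose_succ_succ n s]
    have h1 := hmul s
    have h2 := hmul (s + 1)
    push_cast at *
    linear_combination h2 + h1

lemma lastCoeff_eq (ha : 2 ≤ a) (r : ℕ) : (lastCoeff a r : ℤ) =
    ((r : ℤ) + 1) * a.choose (r + 2) + ((a : ℤ) - r - 1) * a.choose r +
      binom (a - 2) ((r : ℤ) - 2) := by
  obtain ⟨n, rfl⟩ := Nat.exists_eq_add_of_le' ha
  have := choose_identity n r
  rw [lastCoeff, Nat.add_sub_cancel, show n + 2 - 1 = n + 1 by omega]
  push_cast
  linear_combination this

lemma midCoeff_eq_zero (ha : 2 ≤ a) (hb : 2 ≤ b) {k : ℕ} (hk : a + b - 3 < k) : midCoeff a b k = 0 := by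
  have h : ∀ j, j ≤ b - 2 → (a + j - 2).choose k = 0 := fun j hj =>
    Nat.choose_eq_zero_of_lt (by omega)
  rw [midCoeff, Nat.choose_eq_zero_of_lt (show a - 2 + b - 1 < k by omega),
    Finset.sum_eq_zero fun j hj => h j (Finset.mem_Icc.1 hj).2,
    Finset.sum_eq_zero fun j hj => by rw [h j (Finset.mem_Icc.1 hj).2, mul_zero], mul_zero, add_zero,
    add_zero]

lemma coeff_firstPoly_eq_zero (ha : 2 ≤ a) (hb : 2 ≤ b) {k : ℕ} (hk : a + b - 3 < k) :
    (firstPoly a b).coeff k = 0 := by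
  rw [coeff_firstPoly ha hb, midCoeff_eq_zero ha hb hk,
    Nat.choose_eq_zero_of_lt (show a < k + 2 by omega),
    Nat.choose_eq_zero_of_lt (show b - 2 < k by omega), Finset.sum_eq_zero]
  · simp
  · intro j hj
    have := Finset.mem_Icc.1 hj
    rw [Nat.choose_eq_zero_of_lt (by omega), mul_zero]

lemma coeff_secondPoly_eq_zero (ha : 2 ≤ a) (hb : 2 ≤ b) {k : ℕ} (hk : a + b - 3 < k) :
    (secondPoly a b).coeff k = 0 := by
  rw [coeff_secondPoly ha hb, midCoeff_eq_zero ha hb hk, Finset.sum_eq_zero]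
  · simp
  · intro q hq
    rcases lt_or_ge (b - 2) q with h | h
    · rw [Nat.choose_eq_zero_of_lt h, zero_mul]
    · rw [lastCoeff, Nat.choose_eq_zero_of_lt (show a < k - q + 2 by omega),
        Nat.choose_eq_zero_of_lt (show a - 1 < k - q by omega),
        Nat.choose_eq_zero_of_lt (show a - 2 < k - q by omega)]
      simp

lemma coeff_thirdPoly_eq_zero (ha : 2 ≤ a) (hb : 2 ≤ b) {k : ℕ} (hk : a + b - 4 < k) :
    (thirdPoly a b).coeff k = 0 := by
  rw [coeff_thirdPoly ha hb, Nat.choose_eq_zero_of_lt hk, Nat.cast_zero]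

lemma midCoeff_pos (ha : 2 ≤ a) (hb : 3 ≤ b) {k : ℕ} (hk : k ≤ a + b - 3) : 0 < midCoeff a b k := by
  have h : 0 < (b - 2) * (a - 2 + b - 1).choose k :=
    Nat.mul_pos (by omega) (Nat.choose_pos (by omega))
  rw [midCoeff]
  omega

/-- For b ≥ 3 the summand (b-2) C(a+b-3, k) is positive; for b = 2 the bound on a + b gives a ≥ 3
and (a-2) C(a-1, k) is positive. Both factors vanish exactly when a = b = 2. -/
lemma coeff_firstPoly_ne_zero (ha : 2 ≤ a) (hb : 2 ≤ b) (hab : 5 ≤ a + b) {k : ℕ}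
    (hk : k ≤ a + b - 3) : (firstPoly a b).coeff k ≠ 0 := by
  rw [coeff_firstPoly ha hb, Nat.cast_ne_zero]
  by_cases hb' : 3 ≤ b
  · have := midCoeff_pos ha hb' hk
    omega
  · obtain rfl : b = 2 := by omega
    have h : 0 < (a - 2) * (a + 0 - 1).choose k :=
      Nat.mul_pos (by omega) (Nat.choose_pos (by omega))
    simp only [Nat.sub_self, Finset.Icc_self, Finset.sum_singleton]
    omega

/-- As for the first strand; for b = 2 the positive summand (a-2) C(a-1, k) sits in the term q = 0.
-/
lemma coeff_secondPoly_ne_zero (ha : 2 ≤ a) (hb : 2 ≤ b) (hab : 5 ≤ a + b) {k : ℕ}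
    (hk : k ≤ a + b - 3) : (secondPoly a b).coeff k ≠ 0 := by
  rw [coeff_secondPoly ha hb, Nat.cast_ne_zero]
  by_cases hb' : 3 ≤ b
  · have := midCoeff_pos ha hb' hk
    omega
  · obtain rfl : b = 2 := by omega
    have h : 0 < (a - 2) * (a - 1).choose k := Nat.mul_pos (by omega) (Nat.choose_pos (by omega))
    have h' : (2 - 2).choose 0 * lastCoeff a (k - 0) ≤
        ∑ q ∈ Finset.Icc 0 k, (2 - 2).choose q * lastCoeff a (k - q) :=
      Finset.single_le_sum (f := fun q => (2 - 2).choose q * lastCoeff a (k - q))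
        (fun _ _ => Nat.zero_le _) (by simp)
    simp only [Nat.choose_zero_right, one_mul, Nat.sub_zero, lastCoeff] at h'
    simp only [lastCoeff]
    omega

lemma coeff_thirdPoly_ne_zero (ha : 2 ≤ a) (hb : 2 ≤ b) {k : ℕ} (hk : k ≤ a + b - 4) :
    (thirdPoly a b).coeff k ≠ 0 := by
  rw [coeff_thirdPoly ha hb, Nat.cast_ne_zero]
  exact (Nat.choose_pos hk).ne'

end Coefficients

/-! ### The Betti numbers of the carpet -/

section CarpetBetti

variable {R : Type*} [CommRing R] [Nontrivial R] {a b : ℕ} {F : GradedFreeComplex (Var a b) R}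

instance finite_quad (Q : ℕ → ℕ → Prop) : Finite (quad a b Q) :=
  (WellQuasiOrderedLE.finite_of_isAntichain (isAntichain_quad Q)).to_subtype

lemma pathPoly_eq_coeff {σ : Type} (m : MonomialOrder σ) (S : Set (σ →₀ ℕ)) (p : ℕ) :
    pathPoly m S p = PowerSeries.coeff p (pathSeries m S) := by
  rw [pathSeries, PowerSeries.coeff_mk]

lemma coeff_pathPoly_quadF (ha : 2 ≤ a) (hb : 2 ≤ b) (p j : ℕ) :
    (pathPoly (degRevLex (Var a b)) (quad a b (QF a b)) p).coeff j =
      (if p = 0 ∧ j = 0 then 1 else 0) +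
      (if 1 ≤ p ∧ j = p + 1 then (firstPoly a b).coeff (p - 1) else 0) +
      (if 2 ≤ p ∧ j = p + 2 then (secondPoly a b).coeff (p - 2) else 0) +
      (if 3 ≤ p ∧ j = p + 3 then (thirdPoly a b).coeff (p - 3) else 0) := by
  rw [pathPoly_eq_coeff, pathSeries_quadF ha hb, coeff_strands]

/-- The numbers of basis elements of `F` are those of a Schreyer resolution of the carpet. -/
def HasCarpetBasis (F : GradedFreeComplex (Var a b) R) : Prop :=
  ∀ p, ∃ e : F.ι p ≃ Path (degRevLex (Var a b)) (quad a b (QF a b)) p,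
    ∀ k, F.deg p k = ((e k).1.sum.degree : ℕ)

omit [Nontrivial R]

lemma HasCarpetBasis.betti (h : HasCarpetBasis F) (p j : ℕ) : (F.betti p j : ℤ) =
    (pathPoly (degRevLex (Var a b)) (quad a b (QF a b)) p).coeff j := by
  obtain ⟨e, he⟩ := h p
  exact (coeff_pathPoly e he j).symm

lemma HasCarpetBasis.betti_zero (h : HasCarpetBasis F) (ha : 2 ≤ a) (hb : 2 ≤ b) :
    F.betti 0 0 = 1 := by
  have := h.betti 0 0
  rw [coeff_pathPoly_quadF ha hb] at this
  simpa using this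

lemma HasCarpetBasis.betti_first (h : HasCarpetBasis F) (ha : 2 ≤ a) (hb : 2 ≤ b) (k : ℕ) :
    (F.betti (k + 1) ((k + 1 : ℕ) + 1) : ℤ) = (firstPoly a b).coeff k := by
  have := h.betti (k + 1) (k + 1 + 1)
  rw [coeff_pathPoly_quadF ha hb, if_neg (by omega), if_pos (by omega), if_neg (by omega),
    if_neg (by omega), zero_add, add_zero, add_zero, Nat.add_sub_cancel] at this
  rw [← this]
  norm_cast

lemma HasCarpetBasis.betti_second (h : HasCarpetBasis F) (ha : 2 ≤ a) (hb : 2 ≤ b) (k : ℕ) :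
    (F.betti (k + 2) ((k + 2 : ℕ) + 2) : ℤ) = (secondPoly a b).coeff k := by
  have := h.betti (k + 2) (k + 2 + 2)
  rw [coeff_pathPoly_quadF ha hb, if_neg (by omega), if_neg (by omega), if_pos (by omega),
    if_neg (by omega), zero_add, zero_add, add_zero, Nat.add_sub_cancel] at this
  rw [← this]
  norm_cast

lemma HasCarpetBasis.betti_third (h : HasCarpetBasis F) (ha : 2 ≤ a) (hb : 2 ≤ b) (k : ℕ) :
    (F.betti (k + 3) ((k + 3 : ℕ) + 3) : ℤ) = (thirdPoly a b).coeff k := by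
  have := h.betti (k + 3) (k + 3 + 3)
  rw [coeff_pathPoly_quadF ha hb, if_neg (by omega), if_neg (by omega), if_neg (by omega),
    if_pos (by omega), zero_add, zero_add, zero_add, Nat.add_sub_cancel] at this
  rw [← this]
  norm_cast

lemma HasCarpetBasis.eq_of_betti_ne_zero (h : HasCarpetBasis F) (ha : 2 ≤ a) (hb : 2 ≤ b) (p : ℕ)
    (j : ℤ) (hne : F.betti p j ≠ 0) :
    (p = 0 ∧ j = 0) ∨ (1 ≤ p ∧ p ≤ a + b - 2 ∧ j = p + 1) ∨
      (2 ≤ p ∧ p ≤ a + b - 1 ∧ j = p + 2) ∨ (3 ≤ p ∧ p ≤ a + b - 1 ∧ j = p + 3) := by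
  obtain ⟨e, he⟩ := h p
  obtain ⟨n, rfl, hn⟩ := exists_of_betti_ne_zero e he hne
  rw [coeff_pathPoly_quadF ha hb] at hn
  have h1 : ¬ (p - 1 ≤ a + b - 3) → (firstPoly a b).coeff (p - 1) = 0 := fun h =>
    coeff_firstPoly_eq_zero ha hb (by omega)
  have h2 : ¬ (p - 2 ≤ a + b - 3) → (secondPoly a b).coeff (p - 2) = 0 := fun h =>
    coeff_secondPoly_eq_zero ha hb (by omega)
  have h3 : ¬ (p - 3 ≤ a + b - 4) → (thirdPoly a b).coeff (p - 3) = 0 := fun h =>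
    coeff_thirdPoly_eq_zero ha hb (by omega)
  split_ifs at hn <;> omega

/-- The top term is detected by the end of the third strand, whose coefficient there is C(a+b-4,
a+b-4). -/
lemma HasCarpetBasis.hasLength (h : HasCarpetBasis F) (ha : 2 ≤ a) (hb : 2 ≤ b) :
    F.HasLength (a + b - 1) := by
  constructor
  · have h3 := h.betti_third ha hb (a + b - 4)
    rw [show a + b - 4 + 3 = a + b - 1 by omega] at h3
    by_contra hne
    rw [not_nonempty_iff] at hne
    refine coeff_thirdPoly_ne_zero ha hb le_rfl (h3.symm.trans ?_)
    rw [GradedFreeComplex.betti, Nat.card_of_isEmpty, Nat.cast_zero]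
  · intro p hp
    by_contra hne
    rw [not_isEmpty_iff] at hne
    obtain ⟨i⟩ := hne
    have := h.eq_of_betti_ne_zero ha hb p _ (betti_deg_ne_zero F p i)
    omega

lemma binom_eq (n : ℕ) {z : ℤ} (k : ℕ) (h : z = k) : binom n z = n.choose k := by
  subst h
  simp [binom]

lemma cast_midCoeff (hb : 2 ≤ b) {z : ℤ} (k : ℕ) (h : z = k) : (midCoeff a b k : ℤ) =
    ∑ j ∈ Finset.Icc 0 (b - 2), binom (a + j - 2) z +
      ∑ j ∈ Finset.Icc 1 (b - 2), (j : ℤ) * binom (a + j - 2) z +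
      ((b : ℤ) - 2) * binom (a - 2 + b - 1) z := by
  simp only [binom_eq _ k h, midCoeff]
  push_cast [hb]
  rfl

lemma coeff_firstPoly_eq (ha : 2 ≤ a) (hb : 2 ≤ b) (k : ℕ) (p : ℤ) (hp : p = k + 1) :
    (firstPoly a b).coeff k = p * binom a (p + 1)
      + ∑ j ∈ Finset.Icc 0 (b - 2), (((a : ℤ) - 2) * binom (a + j - 1) (p - 1)
          + binom (a + j - 2) (p - 1))
      + ∑ j ∈ Finset.Icc 1 (b - 2), (j : ℤ) * binom (a + j - 2) (p - 1)
      + ((b : ℤ) - 2) * binom (a - 2 + b - 1) (p - 1)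
      + binom (b - 2) (p - 1) := by
  have hk : p - 1 = (k : ℕ) := by omega
  rw [coeff_firstPoly ha hb, binom_eq a (k + 2) (by push_cast; omega), binom_eq (b - 2) k hk,
    Finset.sum_add_distrib]
  push_cast [ha]
  rw [cast_midCoeff hb k hk]
  simp only [binom_eq _ k hk]
  rw [hp]
  ring

lemma coeff_secondPoly_eq (ha : 2 ≤ a) (hb : 2 ≤ b) (p k : ℕ) (hp : p = k + 2) :
    (secondPoly a b).coeff k = ∑ j ∈ Finset.Icc 0 (b - 2), binom (a + j - 2) ((p : ℤ) - 2)
      + ∑ j ∈ Finset.Icc 1 (b - 2), (j : ℤ) * binom (a + j - 2) ((p : ℤ) - 2)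
      + ((b : ℤ) - 2) * binom (a - 2 + b - 1) ((p : ℤ) - 2)
      + ∑ q ∈ Finset.Icc 0 (p - 2), binom (b - 2) q *
          (((p : ℤ) - q - 1) * binom a ((p : ℤ) - q)
            + ((a : ℤ) - p + q + 1) * binom a ((p : ℤ) - q - 2)
            + binom (a - 2) ((p : ℤ) - q - 4)) := by
  have hk : (p : ℤ) - 2 = (k : ℕ) := by omega
  rw [coeff_secondPoly ha hb, ← cast_midCoeff hb k hk, show p - 2 = k by omega]
  push_cast
  congr 1
  refine Finset.sum_congr rfl fun q hq => ?_
  have hq := (Finset.mem_Icc.1 hq).2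
  rw [lastCoeff_eq ha, binom_eq (b - 2) q rfl, binom_eq a (z := (p : ℤ) - q) (k - q + 2) (by omega),
    binom_eq a (z := (p : ℤ) - q - 2) (k - q) (by omega),
    show ((k - q : ℕ) : ℤ) - 2 = (p : ℤ) - q - 4 by omega, hp]
  push_cast [hq]
  ring

lemma coeff_thirdPoly_eq (ha : 2 ≤ a) (hb : 2 ≤ b) (p k : ℕ) (hp : p = k + 3) :
    (thirdPoly a b).coeff k = binom (a + b - 4) ((p : ℤ) - 3) := by
  rw [coeff_thirdPoly ha hb, binom_eq _ k (by omega)]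

/-! ### The Koszul decomposition of the terms. -/

lemma coeff_one_add_wSeries_pow (N k : ℕ) :
    PowerSeries.coeff k ((1 + wSeries) ^ N) = N.choose k • Polynomial.X ^ k := by
  rw [add_comm, add_pow, map_sum]
  simp only [one_pow, mul_one, wSeries, mul_pow, ← map_pow]
  have key : ∀ i : ℕ, PowerSeries.coeff k
      (PowerSeries.X ^ i * PowerSeries.C ((Polynomial.X : Polynomial ℤ) ^ i) * (N.choose i : PowerSeries _)) =
        if i = k then N.choose k • Polynomial.X ^ k else 0 := by
    intro i
    rw [mul_assoc, mul_comm (PowerSeries.C _), ← nsmul_eq_mul, ← map_nsmul,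
      PowerSeries.coeff_X_pow_mul', PowerSeries.coeff_C]
    split_ifs with h1 h2 h3 h3
    · rw [h3]
    · omega
    · omega
    · rfl
    · omega
    · rfl
  rw [Finset.sum_congr rfl fun i _ => key i, Finset.sum_ite_eq']
  split_ifs with h
  · rfl
  · rw [Nat.choose_eq_zero_of_lt (by simpa using h), zero_smul]

/-- The coefficient of X^{n+1} in `pathSeries_quadF`. The factor X of q shifts H to index n - q, and
the terms with q > b - 2 vanish, which truncates the sum. -/
lemma pathPoly_quadF_succ (ha : 2 ≤ a) (hb : 2 ≤ b) (n : ℕ) :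
    pathPoly (degRevLex (Var a b)) (quad a b (QF a b)) (n + 1) =
      pathPoly (degRevLex (Var a b)) (quad a b (QG a b)) (n + 1) +
        ∑ q ∈ Finset.range (min (b - 2) n + 1), (b - 2).choose q •
          (Polynomial.X ^ (q + 2) * pathPoly (degRevLex (Var a b)) (quad a b (QH a)) (n - q)) := by
  simp only [pathPoly_eq_coeff]
  rw [pathSeries_quadF ha hb, ← pathSeries_quadG ha hb, ← pathSeries_quadH_self ha hb, map_add,
    qSeries, mul_assoc, PowerSeries.coeff_succ_X_mul, PowerSeries.coeff_C_mul, PowerSeries.coeff_mul,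
    Finset.Nat.sum_antidiagonal_eq_sum_range_succ_mk, Finset.mul_sum]
  congr 1
  simp only [coeff_one_add_wSeries_pow]
  symm
  refine (Finset.sum_subset (fun q hq => ?_) fun q hq hq' => ?_).trans
    (Finset.sum_congr rfl fun q _ => ?_)
  · rw [Finset.mem_range] at hq ⊢
    omega
  · rw [Finset.mem_range] at hq hq'
    rw [Nat.choose_eq_zero_of_lt (by omega), zero_smul]
  · rw [smul_mul_assoc, mul_smul_comm, pow_add]
    congr 1
    ring

lemma card_koszulBasis (n q : ℕ) : Fintype.card (KoszulBasis n q) = n.choose q := by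
  rw [Fintype.card_finset_len, Fintype.card_fin]

lemma sum_koszulBasis_prod {ι : ℕ → Type} [∀ q, Fintype (ι q)] (N n : ℕ) (d : ∀ q, ι q → ℕ) :
    ∑ x : Σ q : Fin (min N n + 1), KoszulBasis N q × ι (n - q),
      (Polynomial.X : Polynomial ℤ) ^ (x.1.val + d _ x.2.2 + 2) =
    ∑ q ∈ Finset.range (min N n + 1),
      N.choose q • (Polynomial.X ^ (q + 2) * ∑ k : ι (n - q), Polynomial.X ^ d _ k) := by
  rw [Fintype.sum_sigma, Finset.sum_range]
  refine Finset.sum_congr rfl fun q _ => ?_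
  rw [Fintype.sum_prod_type]
  refine (Finset.sum_const (s := (Finset.univ : Finset (KoszulBasis N q)))
    (∑ k : ι (n - q), Polynomial.X ^ (q.val + d _ k + 2))).trans ?_
  rw [Finset.card_univ, card_koszulBasis, Finset.mul_sum]
  refine congrArg _ (Finset.sum_congr rfl fun k _ => ?_)
  ring

/-- Graded free modules are compared by their ranks in each degree, so an identity of generating
functions suffices to produce the bijection of bases. -/
theorem termDecomposes (ha : 2 ≤ a) (hb : 2 ≤ b) {G H : GradedFreeComplex (Var a b) R} {n : ℕ}
    (eF : F.ι (n + 1) ≃ Path (degRevLex (Var a b)) (quad a b (QF a b)) (n + 1))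
    (hF : ∀ k, F.deg (n + 1) k = ((eF k).1.sum.degree : ℕ))
    (eG : G.ι (n + 1) ≃ Path (degRevLex (Var a b)) (quad a b (QG a b)) (n + 1))
    (hG : ∀ k, G.deg (n + 1) k = ((eG k).1.sum.degree : ℕ))
    (eH : ∀ q, H.ι q ≃ Path (degRevLex (Var a b)) (quad a b (QH a)) q)
    (hH : ∀ q k, H.deg q k = ((eH q k).1.sum.degree : ℕ)) :
    TermDecomposes F G H (b - 2) (n + 1) := by
  have hsum : ∑ k, (Polynomial.X : Polynomial ℤ) ^ (eF k).1.sum.degree =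
      ∑ x : G.ι (n + 1) ⊕ (Σ q : Fin (min (b - 2) n + 1), KoszulBasis (b - 2) q × H.ι (n - q)),
        Polynomial.X ^ (Sum.elim (fun k => (eG k).1.sum.degree)
          (fun x => x.1.val + (eH _ x.2.2).1.sum.degree + 2) x) := by
    rw [sum_X_pow_eq_pathPoly eF, Fintype.sum_sum_type]
    simp only [Sum.elim_inl, Sum.elim_inr]
    rw [sum_X_pow_eq_pathPoly eG, pathPoly_quadF_succ ha hb,
      sum_koszulBasis_prod (b - 2) n fun q k => (eH q k).1.sum.degree]
    simp only [sum_X_pow_eq_pathPoly (eH _)]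
  obtain ⟨e, he⟩ := exists_equiv_of_sum_X_pow_eq hsum
  refine ⟨e, fun g => ?_, fun q s h => ?_⟩
  · rw [hF, hG, ← he, Equiv.apply_symm_apply, Sum.elim_inl]
  · rw [hF, hH, ← he, Equiv.apply_symm_apply, Sum.elim_inr]
    push_cast
    rfl

end CarpetBetti

end K3Carpet
end

theorem mainTheorem4 (R : Type*) [CommRing R] [IsDomain R] (a b : ℕ) (ha : 2 ≤ a) (hb : 2 ≤ b) :
    -- Schreyer resolutions of `in(I)` exist and are minimal free resolutions of `in(I)`
    (∃ F, IsSchreyerResolution (degRevLex (Var a b)) F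
      (carpetInitialIdeal R a b)) ∧
    (∀ F, IsSchreyerResolution (degRevLex (Var a b)) F
        (carpetInitialIdeal R a b) →
      F.IsMinimalResolution (carpetInitialIdeal R a b)) ∧
    -- Schreyer resolutions of `I` exist and are free resolutions of `I`
    (∃ F, IsSchreyerResolution (degRevLex (Var a b)) F
      (carpetIdeal R a b)) ∧
    (∀ F, IsSchreyerResolution (degRevLex (Var a b)) F
        (carpetIdeal R a b) →
      F.IsResolution (carpetIdeal R a b)) ∧
    -- the auxiliary Schreyer resolutions exist
    (∃ G, IsSchreyerResolution (degRevLex (Var a b)) G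
      (idealG R a b)) ∧
    (∃ H, IsSchreyerResolution (degRevLex (Var a b)) H
      (idealH R a b)) ∧
    -- length and Betti numbers of a minimal free resolution of `in(I)` or a Schreyer resolution
    -- of `I`
    (∀ F : GradedFreeComplex (Var a b) R,
      (F.IsMinimalResolution (carpetInitialIdeal R a b) ∨
        IsSchreyerResolution (degRevLex (Var a b)) F
          (carpetIdeal R a b)) →
      F.HasLength (a + b - 1) ∧
      F.betti 0 0 = 1 ∧
      (∀ p : ℕ, 1 ≤ p → p ≤ a + b - 2 →
        (F.betti p (p + 1) : ℤ) =
          p * binom a (p + 1)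
          + ∑ j ∈ Finset.Icc 0 (b - 2), (((a : ℤ) - 2) * binom (a + j - 1) (p - 1)
              + binom (a + j - 2) (p - 1))
          + ∑ j ∈ Finset.Icc 1 (b - 2), (j : ℤ) * binom (a + j - 2) (p - 1)
          + ((b : ℤ) - 2) * binom (a - 2 + b - 1) (p - 1)
          + binom (b - 2) (p - 1)) ∧
      (∀ p : ℕ, 2 ≤ p → p ≤ a + b - 1 →
        (F.betti p (p + 2) : ℤ) =
          ∑ j ∈ Finset.Icc 0 (b - 2), binom (a + j - 2) (p - 2)
          + ∑ j ∈ Finset.Icc 1 (b - 2), (j : ℤ) * binom (a + j - 2) (p - 2)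
          + ((b : ℤ) - 2) * binom (a - 2 + b - 1) (p - 2)
          + ∑ q ∈ Finset.Icc 0 (p - 2), binom (b - 2) q *
              (((p : ℤ) - q - 1) * binom a (p - q)
                + ((a : ℤ) - p + q + 1) * binom a (p - q - 2)
                + binom (a - 2) (p - q - 4))) ∧
      (∀ p : ℕ, 3 ≤ p → p ≤ a + b - 1 →
        (F.betti p (p + 3) : ℤ) = binom (a + b - 4) (p - 3)) ∧
      -- all other Betti numbers are zero
      (∀ (p : ℕ) (j : ℤ), F.betti p j ≠ 0 →
        (p = 0 ∧ j = 0) ∨ (1 ≤ p ∧ p ≤ a + b - 2 ∧ j = p + 1) ∨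
          (2 ≤ p ∧ p ≤ a + b - 1 ∧ j = p + 2) ∨ (3 ≤ p ∧ p ≤ a + b - 1 ∧ j = p + 3)) ∧
      -- those listed are nonzero, unless `a = b = 2`
      (5 ≤ a + b →
        (∀ p : ℕ, 1 ≤ p → p ≤ a + b - 2 → F.betti p (p + 1) ≠ 0) ∧
        (∀ p : ℕ, 2 ≤ p → p ≤ a + b - 1 → F.betti p (p + 2) ≠ 0)) ∧
      (∀ p : ℕ, 3 ≤ p → p ≤ a + b - 1 → F.betti p (p + 3) ≠ 0) ∧
      -- the decomposition of the terms of `F`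
      (∀ G H : GradedFreeComplex (Var a b) R,
        IsSchreyerResolution (degRevLex (Var a b)) G
          (idealG R a b) →
        IsSchreyerResolution (degRevLex (Var a b)) H
          (idealH R a b) →
        ∀ p : ℕ, 1 ≤ p → TermDecomposes F G H (b - 2) p)) := by
  have hinG : initialIdeal (degRevLex (Var a b)) (idealG R a b) =
      Ideal.span ((fun s => MvPolynomial.monomial s (1 : R)) '' quad a b (QG a b)) := by
    rw [idealG_eq, initialIdeal_span_monomial]
  have hinH : initialIdeal (degRevLex (Var a b)) (idealH R a b) =
      Ideal.span ((fun s => MvPolynomial.monomial s (1 : R)) '' quad a b (QH a)) := by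
    rw [idealH_eq, initialIdeal_span_monomial]
  refine ⟨?_, fun F hF => hF.isMinimalResolution_carpetInitialIdeal ha hb,
    exists_isSchreyerResolution_carpetIdeal ha hb, fun F hF => hF.isResolution, ?_, ?_, ?_⟩
  · obtain ⟨F, hF, -⟩ := exists_isMinimalResolution (R := R) ha hb
    exact ⟨F, hF⟩
  · obtain ⟨F, hF, -⟩ := exists_isSchreyerResolution_monomial (R := R) (degRevLex (Var a b))
      (isAntichain_quad (a := a) (b := b) (QG a b))
    exact ⟨F, idealG_eq (R := R) (a := a) (b := b) ▸ hF⟩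
  · obtain ⟨F, hF, -⟩ := exists_isSchreyerResolution_monomial (R := R) (degRevLex (Var a b))
      (isAntichain_quad (a := a) (b := b) (QH a))
    exact ⟨F, idealH_eq (R := R) (a := a) (b := b) ▸ hF⟩
  intro F hF
  -- From here on only the graded basis of `F` matters, and both alternatives for `F` are treated
  -- alike.
  have h : HasCarpetBasis F := exists_equiv_path_of_carpet ha hb hF
  refine ⟨h.hasLength ha hb, h.betti_zero ha hb, fun p hp _ => ?_, fun p hp _ => ?_,
    fun p hp _ => ?_, h.eq_of_betti_ne_zero ha hb, fun hab => ⟨fun p hp hp' => ?_,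
    fun p hp hp' => ?_⟩, fun p hp hp' => ?_, fun G H hG hH p hp => ?_⟩
  · obtain ⟨k, rfl⟩ := Nat.exists_eq_add_of_le' hp
    rw [h.betti_first ha hb, coeff_firstPoly_eq ha hb k (k + 1 : ℕ) (Nat.cast_succ k)]
  · obtain ⟨k, rfl⟩ := Nat.exists_eq_add_of_le' hp
    rw [h.betti_second ha hb, coeff_secondPoly_eq ha hb _ k rfl]
  · obtain ⟨k, rfl⟩ := Nat.exists_eq_add_of_le' hp
    rw [h.betti_third ha hb, coeff_thirdPoly_eq ha hb _ k rfl]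
  · obtain ⟨k, rfl⟩ := Nat.exists_eq_add_of_le' hp
    rw [← Nat.cast_ne_zero (R := ℤ), h.betti_first ha hb]
    exact coeff_firstPoly_ne_zero ha hb hab (by omega)
  · obtain ⟨k, rfl⟩ := Nat.exists_eq_add_of_le' hp
    rw [← Nat.cast_ne_zero (R := ℤ), h.betti_second ha hb]
    exact coeff_secondPoly_ne_zero ha hb hab (by omega)
  · obtain ⟨k, rfl⟩ := Nat.exists_eq_add_of_le' hp
    rw [← Nat.cast_ne_zero (R := ℤ), h.betti_third ha hb]
    exact coeff_thirdPoly_ne_zero ha hb (by omega)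
  · obtain ⟨n, rfl⟩ := Nat.exists_eq_add_of_le' hp
    obtain ⟨eF, hF⟩ := h (n + 1)
    obtain ⟨eG, hG⟩ := hG.exists_equiv_path (isAntichain_quad _) hinG (n + 1)
    choose eH hH using hH.exists_equiv_path (isAntichain_quad _) hinH
    exact termDecomposes ha hb eF hF eG hG eH hH
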